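/- **Setting.** For every prime $p$ let $I_p\subseteq\mathbb Z/p\mathbb Z$ be a set of residue classes such that, with $p,q$ always denoting primes: (a) $|I_p|\le p-1$ for all $p$; (b) $|I_p|\le B$ for all $p$, for some $B\in\mathbb N$; (c) $\prod_{p\le x}(1-|I_p|/p)\cdot\log x\to C_1$ as $x\to\infty$ for some $C_1>0$; (e) for $1\le\nu\le B$ the limit $\rho_\nu=\lim_{x\to\infty}\#\{p\le x:|I_p|=\nu\}/(x/\log x)$ exists; (f) with $N(v)=\#\{p: v\bmod p\in I_p-I_p\}$, one has $N(v)\ll v^{0.49}$ for all integers $v\ge1$; (g) there are constants $c_1,c_2>0$ such that, whenever $u\ge10$, $m_q$ is, for each $q$ with $|I_q|\ge1$, a nonzero integer with $m_q\bmod q\in I_q-I_q$, $w$ is an integer with $|w|\le u$, and $k\ge1$ is an integer, $$\#\{q:|I_q|\ge1,\ 0<|m_q|\le u,\ m_q+w\ne0,\ N(m_q+w)\ge k\}\ll u(\log u)^{c_1}e^{-c_2k},$$ with an implied constant depending only on the system. Let $\rho$ be the density of the primes with $|I_p|\ge1$ (relative to $x/\log x$, as in (e)), let $\mathcal N=\{1\le\nu\le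 B:\rho_\nu>0\}$, and put $$C(1)=\sup\Big\{\delta\in(0,\tfrac12):\frac{6\cdot10^{2\delta}}{\log(1/(2\delta))}<1\Big\}.$$ Given real $\delta,M,\xi,K$ and $x$, set $y=\lceil x(\log x)^\delta\rceil$, $z=y\log\log x/(\log x)^{1/2}$, $\sigma(w)=\prod_{p\le w}(1-|I_p|/p)$, $\sigma=\sigma(z)$, $$\mathfrak H=\Big\{H\in\{1,\xi,\xi^2,\dots\}:\frac{2y}{x}\le H\le\frac{y}{\xi z}\Big\},\qquad \mathcal Q_{H,\nu}=\Big\{q\in\Big(\frac{y}{\xi H},\frac yH\Big]:|I_q|=\nu\Big\},\qquad \mathcal Q^\nu=\bigcup_{H\in\mathfrak H}\mathcal Q_{H,\nu},$$ and for $q\in\mathcal Q^\nu$ let $H_q$ be the unique $H\in\mathfrak H$ with $y/(\xi H)<q\le y/H$. Fix for each prime $q$ an arbitrary enumeration $I_q=\{a_{1,q},\dots,a_{|I_q|,q}\}\bmod q$ by distinct integers $a_{i,q}\in[1,q]$. For an integer $b$ (only its class modulo $P(z)=\prod_{p\le z}p$ matters) let $S$ be the set of integers $n$ with $(n-b)\bmod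 p\notin I_p$ for all $p\le z$. For $H\in\mathfrak H$ let $S_1$, respectively $S_2$, be the set of integers $n$ with $(n-b)\bmod p\notin I_p$ for all $p\le H^M$, respectively for all $H^M<p\le z$; let $\sigma_2=\sigma(z)/\sigma(H^M)$, $$AP(KH;q,n)=\Big(\bigsqcup_{i=1}^{|I_q|}\{n+a_{i,q}+hq:1\le h\le KH\}\Big)\cap S_1,\qquad \lambda(H;q,n)=\frac{\mathbf 1_{AP(KH;q,n)\subset S_2}}{\sigma_2^{|AP(KH;q,n)|}}.$$ **Theorem 3.** Let $0<\delta<C(1)$, $M>6$, $\xi>1$, $K>0$. There are real numbers $C_{2,\nu}=C_{2,\nu}(x)$ ($\nu\in\mathcal N$), depending only on the system and on $x,\delta,M,\xi,K$, with $$C_{2,\nu}\longrightarrow\frac{K\rho_\nu}{(K+2)M}\cdot\frac{1-1/\xi}{\log\xi}\,\log\Big(\frac1{2\delta}\Big)\qquad(x\to\infty),$$ such that the following holds for every $0<\varepsilon<\frac17(M-6)$ and all $x$ large enough in terms of the system and of $\delta,M,\xi,K,\varepsilon$. There exist a choice of $b$ modulo $P(z)$ and subsets $\mathcal R^\nu\subseteq\mathcal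 Q^\nu$ for $\nu\in\mathcal N$ so that: (i) $|S\cap[1,y]|\le2\sigma y$; (ii) for every $q\in\mathcal R=\bigcup_{\nu\in\mathcal N}\mathcal R^\nu$, $$\Big|\sum_{-(K+1)y<n\le y}\lambda(H_q;q,n)-(K+2)y\Big|\le\frac{(K+2)y}{(\log x)^{\delta(1+\varepsilon)}};$$ (iii) for each $\nu\in\mathcal N$ and $i\in\{1,\dots,\nu\}$, all but at most $\frac{\rho x}{8B^2\log x}$ elements $n$ of $S\cap[1,y]$ satisfy $$\Big|\sum_{q\in\mathcal R^\nu}\ \sum_{1\le h\le KH_q}\lambda(H_q;q,n-a_{i,q}-qh)-C_{2,\nu}(K+2)y\Big|\le\frac{2(K+2)y}{(\log x)^{\delta(1+\varepsilon)}}.$$ -/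

import Mathlib

open Filter Topology

noncomputable section

/-- `C(ρ) = sup {δ ∈ (0, 1/2) : 6 · 10^{2δ} / log (1/(2δ)) < ρ}`. -/
def critExp (ρ : ℝ) : ℝ :=
  sSup {δ : ℝ | 0 < δ ∧ δ < 1 / 2 ∧ 6 * (10 : ℝ) ^ (2 * δ) / Real.log (1 / (2 * δ)) < ρ}

/-- The set `A` of natural numbers contains a proportion `r` of the primes:
`#{p ≤ x prime : p ∈ A} / (x / log x) → r`. -/
def HasPrimeDensity (A : Set ℕ) (r : ℝ) : Prop :=
  Tendsto (fun x : ℝ => ({p : ℕ | p.Prime ∧ (p : ℝ) ≤ x ∧ p ∈ A}.ncard : ℝ) / (x / Real.log x))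
    atTop (𝓝 r)

/-- `σ(w) = ∏_{p ≤ w} (1 - |I_p| / p)`. -/
def sieveProd (I : (p : ℕ) → Finset (ZMod p)) (w : ℝ) : ℝ :=
  ∏ p ∈ (Finset.Icc 1 ⌊w⌋₊).filter Nat.Prime, (1 - ((I p).card : ℝ) / (p : ℝ))

/-- The residue class of `v` modulo `p` lies in `I_p - I_p`. -/
def InDiff (I : (p : ℕ) → Finset (ZMod p)) (p : ℕ) (v : ℤ) : Prop :=
  ∃ s ∈ I p, ∃ t ∈ I p, (v : ZMod p) = s - t

/-- `{p prime : v mod p ∈ I_p - I_p}`, the set counted by `N(v)`. -/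
def diffPrimes (I : (p : ℕ) → Finset (ZMod p)) (v : ℤ) : Set ℕ :=
  {p | p.Prime ∧ InDiff I p v}

/-- The standing regularity conditions on a sieving system `(I_p)` (only prime `p` matter),
with bound `B` for `|I_p|` and density `ρ ν` of the primes with `|I_p| = ν`, `1 ≤ ν ≤ B`. -/
structure IsRegularSystem (I : (p : ℕ) → Finset (ZMod p)) (B : ℕ) (ρ : ℕ → ℝ) : Prop where
  card_le_sub_one : ∀ p : ℕ, p.Prime → (I p).card ≤ p - 1
  card_le_bound : ∀ p : ℕ, p.Prime → (I p).card ≤ B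
  mertens : ∃ C₁ : ℝ, 0 < C₁ ∧ Tendsto (fun x : ℝ => sieveProd I x * Real.log x) atTop (𝓝 C₁)
  density : ∀ ν : ℕ, 1 ≤ ν → ν ≤ B → HasPrimeDensity {p | (I p).card = ν} (ρ ν)
  few_diff : ∃ C : ℝ, ∀ v : ℤ, 1 ≤ v →
    (diffPrimes I v).Finite ∧ ((diffPrimes I v).ncard : ℝ) ≤ C * (v : ℝ) ^ (0.49 : ℝ)
  diff_overlap : ∃ c₁ c₂ C : ℝ, 0 < c₁ ∧ 0 < c₂ ∧
    ∀ u : ℝ, 10 ≤ u → ∀ m : ℕ → ℤ,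
      (∀ q : ℕ, q.Prime → 1 ≤ (I q).card → m q ≠ 0 ∧ InDiff I q (m q)) →
      ∀ w : ℤ, |(w : ℝ)| ≤ u → ∀ k : ℕ, 1 ≤ k →
        {q : ℕ | q.Prime ∧ 1 ≤ (I q).card ∧ 0 < |(m q : ℝ)| ∧ |(m q : ℝ)| ≤ u ∧ m q + w ≠ 0 ∧
          (k : ℕ∞) ≤ (diffPrimes I (m q + w)).encard}.Finite ∧
        ({q : ℕ | q.Prime ∧ 1 ≤ (I q).card ∧ 0 < |(m q : ℝ)| ∧ |(m q : ℝ)| ≤ u ∧ m q + w ≠ 0 ∧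
          (k : ℕ∞) ≤ (diffPrimes I (m q + w)).encard}.ncard : ℝ)
          ≤ C * (u * Real.log u ^ c₁ * Real.exp (-c₂ * k))

/-- `a i q`, `1 ≤ i ≤ |I_q|`, are the representatives in `[1, q]` of the distinct elements of
`I_q`, for each prime `q`. -/
def IsEnumeration (I : (p : ℕ) → Finset (ZMod p)) (a : ℕ → ℕ → ℤ) : Prop :=
  ∀ q : ℕ, q.Prime →
    (∀ i ∈ Set.Icc 1 (I q).card, a i q ∈ Set.Icc (1 : ℤ) (q : ℤ)) ∧
    Set.BijOn (fun i => (a i q : ZMod q)) (Set.Icc 1 (I q).card) (I q : Set (ZMod q))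

/-- `𝒩 = {1 ≤ ν ≤ B : ρ_ν > 0}`. -/
def goodSizes (B : ℕ) (ρ : ℕ → ℝ) : Set ℕ := {ν | 1 ≤ ν ∧ ν ≤ B ∧ 0 < ρ ν}

/-- `y = ⌈x (log x)^δ⌉`. -/
def yOf (δ x : ℝ) : ℕ := ⌈x * Real.log x ^ δ⌉₊

/-- `z = y log log x / (log x)^{1/2}`. -/
def zOf (δ x : ℝ) : ℝ := (yOf δ x : ℝ) * Real.log (Real.log x) / Real.log x ^ (1 / 2 : ℝ)

/-- The set of scales `H ∈ {1, ξ, ξ², …}` with `2y/x ≤ H ≤ y/(ξ z)`. -/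
def scales (δ ξ x : ℝ) : Set ℝ :=
  {H | (∃ j : ℕ, H = ξ ^ j) ∧ 2 * (yOf δ x : ℝ) / x ≤ H ∧ H ≤ (yOf δ x : ℝ) / (ξ * zOf δ x)}

/-- `𝒬_{H,ν}`: the primes `q ∈ (y/(ξH), y/H]` with `|I_q| = ν`. -/
def primesAt (I : (p : ℕ) → Finset (ZMod p)) (δ ξ x H : ℝ) (ν : ℕ) : Set ℕ :=
  {q | q.Prime ∧ (yOf δ x : ℝ) / (ξ * H) < (q : ℝ) ∧ (q : ℝ) ≤ (yOf δ x : ℝ) / H ∧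
    (I q).card = ν}

/-- `𝒬^ν`, the union of the `𝒬_{H,ν}` over all scales `H`. -/
def primesOfSize (I : (p : ℕ) → Finset (ZMod p)) (δ ξ x : ℝ) (ν : ℕ) : Set ℕ :=
  ⋃ H ∈ scales δ ξ x, primesAt I δ ξ x H ν

/-- `H_q`, the power `H` of `ξ` with `y/(ξH) < q ≤ y/H`; see `scaleOf_eq`. -/
def scaleOf (ξ y : ℝ) (q : ℕ) : ℝ := ξ ^ ⌊Real.logb ξ (y / q)⌋₊

/-- `scaleOf ξ y q` is the only power `H` of `ξ` with `y/(ξH) < q ≤ y/H`. -/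
theorem scaleOf_eq {ξ y : ℝ} {q j : ℕ} (hξ : 1 < ξ) (hq : 0 < q)
    (h1 : y / (ξ * ξ ^ j) < (q : ℝ)) (h2 : (q : ℝ) ≤ y / ξ ^ j) : scaleOf ξ y q = ξ ^ j := by
  have hξ0 : 0 < ξ := by linarith
  have hj : 0 < ξ ^ j := pow_pos hξ0 j
  have hq' : (0 : ℝ) < q := by exact_mod_cast hq
  have hy1 : ξ ^ j ≤ y / q := by
    rw [le_div_iff₀ hj] at h2
    rw [le_div_iff₀ hq']
    linarith
  have hy2 : y / q < ξ ^ (j + 1) := by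
    rw [div_lt_iff₀ (by positivity)] at h1
    rw [div_lt_iff₀ hq', pow_succ]
    linarith
  have hpos : 0 < y / q := lt_of_lt_of_le hj hy1
  have : ⌊Real.logb ξ (y / q)⌋₊ = j := by
    rw [Nat.floor_eq_iff (Real.logb_nonneg hξ (le_trans (one_le_pow₀ hξ.le) hy1))]
    constructor
    · rw [Real.le_logb_iff_rpow_le hξ hpos, Real.rpow_natCast]
      exact hy1
    · rw [Real.logb_lt_iff_lt_rpow hξ hpos]
      exact_mod_cast hy2
  rw [scaleOf, this]

/-- `S_{v,w} + b`: the integers `n` such that `n - b` avoids `I_p` for all primes `v < p ≤ w`. -/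
def sievedShift (I : (p : ℕ) → Finset (ZMod p)) (v w : ℝ) (b : ℤ) : Set ℤ :=
  {n | ∀ p : ℕ, p.Prime → v < (p : ℝ) → (p : ℝ) ≤ w → ((n - b : ℤ) : ZMod p) ∉ I p}

open Classical in
/-- `AP(J; q, n) = (⊔_i {n + a_{i,q} + h q : 1 ≤ h ≤ J}) ∩ (S_w + b)`. -/
def sievedAP (I : (p : ℕ) → Finset (ZMod p)) (a : ℕ → ℕ → ℤ) (b : ℤ) (w J : ℝ) (q : ℕ) (n : ℤ) :
    Finset ℤ :=
  ((Finset.Icc 1 (I q).card ×ˢ Finset.Icc 1 ⌊J⌋₊).image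
    (fun t : ℕ × ℕ => n + a t.1 q + (t.2 : ℤ) * (q : ℤ))).filter (· ∈ sievedShift I 0 w b)

open Classical in
/-- The weight `λ(H; q, n) = 1_{AP(KH; q, n) ⊆ S_{H^M, z} + b} / σ₂ ^ |AP(KH; q, n)|`, where
`AP` is taken with respect to `S_{H^M} + b` and `σ₂ = σ(z) / σ(H^M)`. -/
def weight (I : (p : ℕ) → Finset (ZMod p)) (a : ℕ → ℕ → ℤ) (b : ℤ) (K M z H : ℝ) (q : ℕ)
    (n : ℤ) : ℝ :=
  if (sievedAP I a b (H ^ M) (K * H) q n : Set ℤ) ⊆ sievedShift I (H ^ M) z b then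
    1 / (sieveProd I z / sieveProd I (H ^ M)) ^ (sievedAP I a b (H ^ M) (K * H) q n).card
  else 0

end

/-! Take b uniformly at random modulo P(z). `avgMod` is the expectation, and residues modulo
different primes are independent by the Chinese remainder theorem (`avgMod_prod`). Everything
follows from first and second moments, and `exists_le_avgMod` then extracts one good shift.

Fix a scale H, put v = H^M, and condition on the primes up to v. A progression is then a fixed set V
of at most BKH points, and its weight is the indicator that V survives the primes in (v, z], divided
by σ₂^|V|. As p > v is much larger than |V|, the survival probability is close to σ₂^|V|
(`survival_ge`, `survival_le`). It can be noticeably larger only because of collisions: primes p for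
which two points of V differ by an element of I_p - I_p. So a weight has mean about 1, and two
weights on disjoint progressions with few collisions are nearly uncorrelated. Hence the total X_q of
the weights of one modulus concentrates at T = (K+2)y (`avgMod_modulus_variance_le`).

Now fix n. Given that n survives the small primes, the weight of any progression through n vanishes
unless n survives the large primes too. Two progressions through n share that point, so their joint
mean is about 1/σ₂. This is exactly what makes the sum over all progressions through n at one scale
concentrate, on the event n ∈ S, at μ = |G|⌊KH⌋/σ₂ (`avgMod_point_variance_le`). Cross collisions of
two moduli are controlled by `diff_overlap`, coincidences of points by `few_diff`. Moduli whose own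
progression has many collisions are few, again by `diff_overlap`, and are removed in advance,
independently of b; G is what remains.

The set R depends on b: it consists of the q in G with |X_q - T| ≤ τT. A discarded q has X_q ≤ 2(X_q
- T)²/(τ²T), so the loss caused by discarding is also paid for by the variance
(`avgMod_exceptional_le`). With relative variance ε₀ = (log x)^(-δ(4+6ε)), tolerance τ = (log
x)^(-δ(1+ε)) and σ₂ ≪ log log x / log x, the expected number of exceptional points is at most of
order (x / log x) · log log x · (log x)^(-3δε) (`exceptional_bound`). Such an ε₀ is available
because the collision error is about H²/H^M up to a power of log log x, with H ≥ (log x)^δ: this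
requires 4 + 6ε < M - 2, whence M > 6.

The constant is the sum over scales of |Q|⌊KH⌋/(σ₂T). Each term is asymptotic to a constant over log
H, uniformly in H, and the sum of 1/log H over H = ξ^j between (log x)^δ and (log x)^(1/2), up to
lower order, tends to log(1/(2δ))/log ξ (`tendsto_scaleConst`). -/

noncomputable section

/-! ### Averages over residue classes and independence -/

/-- The average of `f` over a complete residue system modulo `m`. -/
def avgMod (m : ℕ) (f : ℤ → ℝ) : ℝ := (∑ b ∈ Finset.range m, f b) / m

theorem avgMod_add (m : ℕ) (f g : ℤ → ℝ) :
    avgMod m (fun b => f b + g b) = avgMod m f + avgMod m g := by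
  simp [avgMod, Finset.sum_add_distrib, add_div]

theorem avgMod_sum {ι : Type*} (m : ℕ) (s : Finset ι) (f : ι → ℤ → ℝ) :
    avgMod m (fun b => ∑ i ∈ s, f i b) = ∑ i ∈ s, avgMod m (f i) := by
  simp only [avgMod]
  rw [Finset.sum_comm, Finset.sum_div]

theorem avgMod_const_mul (m : ℕ) (c : ℝ) (f : ℤ → ℝ) :
    avgMod m (fun b => c * f b) = c * avgMod m f := by
  simp [avgMod, ← Finset.mul_sum, mul_div_assoc]

theorem avgMod_mul_const (m : ℕ) (c : ℝ) (f : ℤ → ℝ) :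
    avgMod m (fun b => f b * c) = avgMod m f * c := by
  simp only [avgMod, ← Finset.sum_mul]; ring

theorem avgMod_const {m : ℕ} (hm : 0 < m) (c : ℝ) : avgMod m (fun _ => c) = c := by
  have : (m : ℝ) ≠ 0 := by positivity
  simp [avgMod]; field_simp

theorem avgMod_mono {m : ℕ} {f g : ℤ → ℝ} (h : ∀ b, f b ≤ g b) : avgMod m f ≤ avgMod m g := by
  unfold avgMod
  gcongr with b _
  exact h b

/-- First-moment principle: all existence statements about shifts come from here. -/
theorem exists_le_avgMod {m : ℕ} (hm : 0 < m) (f : ℤ → ℝ) : ∃ b, f b ≤ avgMod m f := by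
  by_contra! h
  have h1 : ∑ b ∈ Finset.range m, avgMod m f < ∑ b ∈ Finset.range m, f b :=
    Finset.sum_lt_sum_of_nonempty ⟨0, by simpa using hm⟩ fun b _ => h b
  have : (m : ℝ) ≠ 0 := by positivity
  have h2 : (m : ℝ) * avgMod m f = ∑ b ∈ Finset.range m, f b := by
    unfold avgMod; field_simp
  simp only [Finset.sum_const, Finset.card_range, nsmul_eq_mul] at h1
  linarith

/-- By the Chinese remainder theorem a uniform class modulo `m * n` is a pair of independent uniform
classes, so the two arguments of `F` may be averaged separately. -/
theorem avgMod_mul {m n : ℕ} (hm : 0 < m) (hn : 0 < n) (hmn : m.Coprime n) (F : ℤ → ℤ → ℝ)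
    (hF : ∀ b b' c c' : ℤ, b ≡ b' [ZMOD m] → c ≡ c' [ZMOD n] → F b c = F b' c') :
    avgMod (m * n) (fun b => F b b) = avgMod m fun b => avgMod n fun c => F b c := by
  have key : ∑ b ∈ Finset.range (m * n), F b b
      = ∑ b ∈ Finset.range m, ∑ c ∈ Finset.range n, F b c := by
    rw [← Finset.sum_product']
    refine Finset.sum_nbij (fun b => (b % m, b % n)) ?_ ?_ ?_ ?_
    · intro b _
      simp [Nat.mod_lt _ hm, Nat.mod_lt _ hn]
    · intro b hb c hc h
      simp only [Finset.coe_range, Set.mem_Iio, Prod.mk.injEq] at hb hc h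
      have := (Nat.modEq_and_modEq_iff_modEq_mul hmn).1 ⟨h.1, h.2⟩
      exact Nat.ModEq.eq_of_lt_of_lt this hb hc
    · rintro ⟨b, c⟩ h
      simp only [Finset.coe_product, Finset.coe_range, Set.mem_prod, Set.mem_Iio] at h
      refine ⟨Nat.chineseRemainder hmn b c, ?_, ?_⟩
      · simpa using Nat.chineseRemainder_lt_mul hmn b c hm.ne' hn.ne'
      · have h1 := (Nat.chineseRemainder hmn b c).2.1
        have h2 := (Nat.chineseRemainder hmn b c).2.2
        simp only [Prod.mk.injEq]
        exact ⟨by rw [h1, Nat.mod_eq_of_lt h.1], by rw [h2, Nat.mod_eq_of_lt h.2]⟩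
    · intro b _
      apply hF <;> push_cast <;> exact (Int.mod_modEq _ _).symm
  simp only [avgMod]
  rw [key, Finset.sum_div, Finset.sum_div]
  refine Finset.sum_congr rfl fun b _ => ?_
  push_cast
  rw [div_div, mul_comm]

theorem avgMod_prod (P : Finset ℕ) (hP : ∀ p ∈ P, p.Prime) (f : ℕ → ℤ → ℝ)
    (hf : ∀ p ∈ P, ∀ b b' : ℤ, b ≡ b' [ZMOD p] → f p b = f p b') :
    avgMod (∏ p ∈ P, p) (fun b => ∏ p ∈ P, f p b) = ∏ p ∈ P, avgMod p (f p) := by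
  induction P using Finset.induction_on with
  | empty => simp [avgMod]
  | insert p P hp ih =>
    have hP' : ∀ q ∈ P, q.Prime := fun q hq => hP q (Finset.mem_insert_of_mem hq)
    simp only [Finset.prod_insert hp]
    rw [avgMod_mul (F := fun b c => f p b * ∏ q ∈ P, f q c)]
    · simp only [avgMod_const_mul, avgMod_mul_const]
      rw [ih hP' fun q hq => hf q (Finset.mem_insert_of_mem hq)]
    · exact (hP p (Finset.mem_insert_self _ _)).pos
    · exact Finset.prod_pos fun q hq => (hP' q hq).pos
    · refine Nat.Coprime.prod_right fun q hq => ?_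
      rw [Nat.coprime_primes (hP p (Finset.mem_insert_self _ _)) (hP' q hq)]
      rintro rfl
      exact hp hq
    · intro b b' c c' h1 h2
      rw [hf p (Finset.mem_insert_self _ _) b b' h1]
      congr 1
      refine Finset.prod_congr rfl fun q hq => hf q (Finset.mem_insert_of_mem hq) _ _ ?_
      refine h2.of_dvd ?_
      exact_mod_cast Finset.dvd_prod_of_mem (fun q => q) hq

theorem sum_range_zmod (p : ℕ) [NeZero p] (g : ZMod p → ℝ) :
    ∑ b ∈ Finset.range p, g ((b : ℤ) : ZMod p) = ∑ x : ZMod p, g x := by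
  refine Finset.sum_nbij' (fun b => ((b : ℤ) : ZMod p)) (fun x => x.val) ?_ ?_ ?_ ?_ ?_
  · simp
  · intro x _
    simpa using ZMod.val_lt x
  · intro b hb
    simp only [Finset.mem_range] at hb
    simp [ZMod.val_cast_of_lt hb]
  · simp
  · simp

open Classical in
theorem avgMod_notMem (p : ℕ) [NeZero p] (U : Finset (ZMod p)) :
    avgMod p (fun b => if (b : ZMod p) ∈ U then 0 else 1) = 1 - (U.card : ℝ) / p := by
  have hp : (p : ℝ) ≠ 0 := by exact_mod_cast NeZero.ne p
  unfold avgMod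
  rw [sum_range_zmod p (fun x => if x ∈ U then (0 : ℝ) else 1)]
  have : ∀ x : ZMod p, (if x ∈ U then (0 : ℝ) else 1) = 1 - if x ∈ U then 1 else 0 := by
    intro x; split_ifs <;> simp
  simp only [this, Finset.sum_sub_distrib]
  simp [ZMod.card]
  field_simp

/-! ### Sieve densities and moduli over intervals of primes -/

/-- The primes in `(v, w]`. -/
def primesIoc (v w : ℝ) : Finset ℕ :=
  (Finset.Icc 1 ⌊w⌋₊).filter (fun p => p.Prime ∧ v < p)

theorem mem_primesIoc {v w : ℝ} {p : ℕ} :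
    p ∈ primesIoc v w ↔ p.Prime ∧ v < p ∧ (p : ℝ) ≤ w := by
  simp only [primesIoc, Finset.mem_filter, Finset.mem_Icc]
  constructor
  · rintro ⟨⟨h1, h2⟩, h3, h4⟩
    exact ⟨h3, h4, (Nat.le_floor_iff' (by omega)).1 h2⟩
  · rintro ⟨h1, h2, h3⟩
    exact ⟨⟨h1.one_le, (Nat.le_floor_iff' h1.ne_zero).2 h3⟩, h1, h2⟩

theorem primesIoc_zero_left (w : ℝ) :
    primesIoc 0 w = (Finset.Icc 1 ⌊w⌋₊).filter Nat.Prime := by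
  ext p
  simp only [primesIoc, Finset.mem_filter, Finset.mem_Icc]
  constructor
  · tauto
  · rintro ⟨h1, h2⟩
    exact ⟨h1, h2, by exact_mod_cast h2.pos⟩

theorem disjoint_primesIoc (u v w : ℝ) : Disjoint (primesIoc u v) (primesIoc v w) := by
  rw [Finset.disjoint_left]
  intro p h1 h2
  rw [mem_primesIoc] at h1 h2
  linarith [h1.2.2, h2.2.1]

theorem primesIoc_union {v w : ℝ} (h : v ≤ w) :
    primesIoc 0 v ∪ primesIoc v w = primesIoc 0 w := by
  ext p
  simp only [Finset.mem_union, mem_primesIoc]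
  constructor
  · rintro (⟨h1, h2, h3⟩ | ⟨h1, h2, h3⟩)
    · exact ⟨h1, h2, h3.trans h⟩
    · exact ⟨h1, by exact_mod_cast h1.pos, h3⟩
  · rintro ⟨h1, h2, h3⟩
    rcases le_or_gt (p : ℝ) v with h4 | h4
    · exact Or.inl ⟨h1, h2, h4⟩
    · exact Or.inr ⟨h1, h4, h3⟩

/-- `∏_{v < p ≤ w} (1 - |I_p| / p)`. -/
def densityIoc (I : (p : ℕ) → Finset (ZMod p)) (v w : ℝ) : ℝ :=
  ∏ p ∈ primesIoc v w, (1 - ((I p).card : ℝ) / (p : ℝ))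

theorem densityIoc_zero_left (I : (p : ℕ) → Finset (ZMod p)) (w : ℝ) :
    densityIoc I 0 w = sieveProd I w := by
  rw [densityIoc, primesIoc_zero_left, sieveProd]

theorem sieveProd_mul_densityIoc (I : (p : ℕ) → Finset (ZMod p)) {v w : ℝ} (h : v ≤ w) :
    sieveProd I v * densityIoc I v w = sieveProd I w := by
  rw [← densityIoc_zero_left, ← densityIoc_zero_left, densityIoc, densityIoc, densityIoc,
    ← Finset.prod_union (disjoint_primesIoc _ _ _), primesIoc_union h]

theorem one_sub_card_div_pos {I : (p : ℕ) → Finset (ZMod p)}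
    (h : ∀ p : ℕ, p.Prime → (I p).card ≤ p - 1) {p : ℕ} (hp : p.Prime) :
    0 < 1 - ((I p).card : ℝ) / (p : ℝ) := by
  have h1 := h p hp
  have h2 := hp.pos
  have h3 : ((I p).card : ℝ) < p := by exact_mod_cast (by omega : (I p).card < p)
  have h4 : (0 : ℝ) < p := by exact_mod_cast h2
  rw [sub_pos, div_lt_one h4]
  exact h3

theorem densityIoc_pos {I : (p : ℕ) → Finset (ZMod p)}
    (h : ∀ p : ℕ, p.Prime → (I p).card ≤ p - 1) (v w : ℝ) : 0 < densityIoc I v w :=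
  Finset.prod_pos fun _ hp => one_sub_card_div_pos h (mem_primesIoc.1 hp).1

theorem densityIoc_le_one {I : (p : ℕ) → Finset (ZMod p)}
    (h : ∀ p : ℕ, p.Prime → (I p).card ≤ p - 1) (v w : ℝ) : densityIoc I v w ≤ 1 :=
  Finset.prod_le_one (fun _ hp => (one_sub_card_div_pos h (mem_primesIoc.1 hp).1).le)
    fun _ _ => sub_le_self _ (by positivity)

/-- `∏_{v < p ≤ w} p`. -/
def modulusIoc (v w : ℝ) : ℕ := ∏ p ∈ primesIoc v w, p

theorem modulusIoc_pos (v w : ℝ) : 0 < modulusIoc v w :=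
  Finset.prod_pos fun _ hp => (mem_primesIoc.1 hp).1.pos

theorem modulusIoc_mul {v w : ℝ} (h : v ≤ w) :
    modulusIoc 0 v * modulusIoc v w = modulusIoc 0 w := by
  rw [modulusIoc, modulusIoc, modulusIoc,
    ← Finset.prod_union (disjoint_primesIoc _ _ _), primesIoc_union h]

theorem coprime_modulusIoc (u v w : ℝ) : (modulusIoc u v).Coprime (modulusIoc v w) := by
  refine Nat.Coprime.prod_left fun p hp => Nat.Coprime.prod_right fun q hq => ?_
  rw [Nat.coprime_primes (mem_primesIoc.1 hp).1 (mem_primesIoc.1 hq).1]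
  rintro rfl
  exact Finset.disjoint_left.1 (disjoint_primesIoc u v w) hp hq

theorem sievedShift_congr (I : (p : ℕ) → Finset (ZMod p)) {v w : ℝ} {b b' : ℤ}
    (h : b ≡ b' [ZMOD modulusIoc v w]) : sievedShift I v w b = sievedShift I v w b' := by
  ext n
  refine forall_congr' fun p => forall_congr' fun hp => forall_congr' fun h1 =>
    forall_congr' fun h2 => ?_
  have h3 : b ≡ b' [ZMOD p] := h.of_dvd (by
    exact_mod_cast Finset.dvd_prod_of_mem (fun q => q) (mem_primesIoc.2 ⟨hp, h1, h2⟩))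
  have h4 : (b : ZMod p) = b' := (ZMod.intCast_eq_intCast_iff _ _ _).2 h3
  push_cast
  rw [h4]

theorem mem_sievedShift_split {I : (p : ℕ) → Finset (ZMod p)} {v w : ℝ} (h : v ≤ w) {b n : ℤ} :
    n ∈ sievedShift I 0 w b ↔ n ∈ sievedShift I 0 v b ∧ n ∈ sievedShift I v w b := by
  constructor
  · intro hn
    exact ⟨fun p hp h1 h2 => hn p hp h1 (h2.trans h),
      fun p hp h1 h2 => hn p hp (by exact_mod_cast hp.pos) h2⟩
  · rintro ⟨h1, h2⟩ p hp h3 h4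
    rcases le_or_gt (p : ℝ) v with h5 | h5
    · exact h1 p hp h3 h5
    · exact h2 p hp h5 h4

/-! ### Probability that a finite set survives the sieve -/

open Classical in
/-- The classes of `b` modulo `p` for which some `n - b`, `n ∈ V`, lies in `I_p`. -/
def forbidden (I : (p : ℕ) → Finset (ZMod p)) (V : Finset ℤ) (p : ℕ) : Finset (ZMod p) :=
  V.biUnion fun n => (I p).image fun s => (n : ZMod p) - s

theorem mem_forbidden {I : (p : ℕ) → Finset (ZMod p)} {V : Finset ℤ} {p : ℕ} {b : ℤ} :
    (b : ZMod p) ∈ forbidden I V p ↔ ∃ n ∈ V, ((n - b : ℤ) : ZMod p) ∈ I p := by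
  simp only [forbidden, Finset.mem_biUnion, Finset.mem_image]
  refine exists_congr fun n => and_congr_right fun _ => ?_
  constructor
  · rintro ⟨s, hs, h⟩
    push_cast
    rw [← h]
    simpa using hs
  · intro h
    refine ⟨_, h, ?_⟩
    push_cast
    ring

open Classical in
/-- The probability that `V` survives sieving a random translate by the primes in `(v, w]`. -/
def survival (I : (p : ℕ) → Finset (ZMod p)) (v w : ℝ) (V : Finset ℤ) : ℝ :=
  avgMod (modulusIoc v w) fun b => if (V : Set ℤ) ⊆ sievedShift I v w b then 1 else 0

/-- Survival means that the shift avoids the forbidden classes modulo every prime, and these are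
independent events. -/
theorem survival_eq_prod (I : (p : ℕ) → Finset (ZMod p)) (v w : ℝ) (V : Finset ℤ) :
    survival I v w V = ∏ p ∈ primesIoc v w, (1 - ((forbidden I V p).card : ℝ) / p) := by
  classical
  have h1 : ∀ b : ℤ, (if (V : Set ℤ) ⊆ sievedShift I v w b then (1 : ℝ) else 0)
      = ∏ p ∈ primesIoc v w, if (b : ZMod p) ∈ forbidden I V p then (0 : ℝ) else 1 := by
    intro b
    split_ifs with h
    · refine (Finset.prod_eq_one fun p hp => if_neg ?_).symm
      rw [mem_forbidden]
      rintro ⟨n, hn, h2⟩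
      rw [mem_primesIoc] at hp
      exact h hn p hp.1 hp.2.1 hp.2.2 h2
    · simp only [Set.subset_def, not_forall] at h
      obtain ⟨n, hn, h⟩ := h
      simp only [sievedShift, Set.mem_ofPred_eq, not_forall, not_not] at h
      obtain ⟨p, hp, h2, h3, h4⟩ := h
      symm
      apply Finset.prod_eq_zero (mem_primesIoc.2 ⟨hp, h2, h3⟩)
      exact if_pos (mem_forbidden.2 ⟨n, hn, h4⟩)
  unfold survival
  simp only [h1]
  unfold modulusIoc
  rw [avgMod_prod _ (fun p hp => (mem_primesIoc.1 hp).1)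
    (fun p b => if (b : ZMod p) ∈ forbidden I V p then (0 : ℝ) else 1)]
  · refine Finset.prod_congr rfl fun p hp => ?_
    have : NeZero p := ⟨(mem_primesIoc.1 hp).1.ne_zero⟩
    exact avgMod_notMem p _
  · intro p _ b b' h
    rw [(ZMod.intCast_eq_intCast_iff _ _ _).2 h]

theorem survival_le_one (I : (p : ℕ) → Finset (ZMod p)) (v w : ℝ) (V : Finset ℤ) :
    survival I v w V ≤ 1 := by
  rw [← avgMod_const (modulusIoc_pos v w) 1]
  exact avgMod_mono fun b => by split_ifs <;> norm_num

theorem forbidden_card_le (I : (p : ℕ) → Finset (ZMod p)) (V : Finset ℤ) (p : ℕ) :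
    (forbidden I V p).card ≤ V.card * (I p).card := by
  unfold forbidden
  refine (Finset.card_biUnion_le).trans ?_
  refine (Finset.sum_le_card_nsmul _ _ _ fun n _ => Finset.card_image_le).trans ?_
  simp

theorem survival_singleton (I : (p : ℕ) → Finset (ZMod p)) (v w : ℝ) (n : ℤ) :
    survival I v w {n} = densityIoc I v w := by
  rw [survival_eq_prod, densityIoc]
  refine Finset.prod_congr rfl fun p _ => ?_
  congr 3
  unfold forbidden
  rw [Finset.singleton_biUnion, Finset.card_image_of_injective]
  exact sub_right_injective

-- The translates n - I_p, n ∈ V, can overlap only for points that have a partner at a difference in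
-- I_p - I_p. Dropping all such points (the set `C`) makes the remaining translates disjoint, and
-- `C` is a projection of the set of colliding ordered pairs.
open Classical in
theorem le_forbidden_card (I : (p : ℕ) → Finset (ZMod p)) (V : Finset ℤ) (p : ℕ) :
    V.card * (I p).card ≤ (forbidden I V p).card
      + (V.offDiag.filter fun t => InDiff I p (t.1 - t.2)).card * (I p).card := by
  set C := V.filter fun v => ∃ v' ∈ V, v ≠ v' ∧ InDiff I p (v - v') with hC
  have h1 : C.card ≤ (V.offDiag.filter fun t => InDiff I p (t.1 - t.2)).card := by
    refine (Finset.card_le_card ?_).trans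
      (Finset.card_image_le (s := V.offDiag.filter fun t => InDiff I p (t.1 - t.2)) (f := Prod.fst))
    intro v hv
    rw [hC, Finset.mem_filter] at hv
    obtain ⟨hv, v', hv', hne, hd⟩ := hv
    rw [Finset.mem_image]
    exact ⟨(v, v'), by simp [hv, hv', hne, hd], rfl⟩
  have h2 : (V \ C).card * (I p).card ≤ (forbidden I V p).card := by
    have h3 : ((V \ C).biUnion fun n => (I p).image fun s => (n : ZMod p) - s).card
        = (V \ C).card * (I p).card := by
      rw [Finset.card_biUnion, Finset.sum_const_nat]
      · intro n _
        exact Finset.card_image_of_injective _ sub_right_injective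
      · intro n hn n' hn' hne
        refine Finset.disjoint_left.2 fun x hx hx' => ?_
        rw [Finset.mem_image] at hx hx'
        obtain ⟨s, hs, h⟩ := hx
        obtain ⟨s', hs', h'⟩ := hx'
        rw [Finset.mem_coe, Finset.mem_sdiff] at hn hn'
        refine hn.2 ?_
        rw [hC, Finset.mem_filter]
        refine ⟨hn.1, n', hn'.1, hne, s, hs, s', hs', ?_⟩
        push_cast
        linear_combination h - h'
    rw [← h3]
    unfold forbidden
    exact Finset.card_le_card (Finset.biUnion_subset_biUnion_of_subset_left _ Finset.sdiff_subset)
  have h4 : V.card ≤ (V \ C).card + C.card := by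
    have hCV : C ⊆ V := Finset.filter_subset _ _
    exact (Finset.card_sdiff_add_card_eq_card hCV).ge
  nlinarith [Nat.mul_le_mul_right (I p).card h1, Nat.mul_le_mul_right (I p).card h4]

theorem sum_inv_sq_primesIoc_le {w : ℝ} (hw : 0 < w) (z : ℝ) :
    ∑ p ∈ primesIoc w z, ((p : ℝ) ^ 2)⁻¹ ≤ 2 / w := by
  calc ∑ p ∈ primesIoc w z, ((p : ℝ) ^ 2)⁻¹
      ≤ ∑ p ∈ Finset.Ioo ⌊w⌋₊ (⌊z⌋₊ + 1), ((p : ℝ) ^ 2)⁻¹ := by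
        refine Finset.sum_le_sum_of_subset_of_nonneg ?_ fun _ _ _ => by positivity
        intro p hp
        rw [mem_primesIoc] at hp
        rw [Finset.mem_Ioo, Nat.floor_lt hw.le, Nat.lt_succ_iff, Nat.le_floor_iff' hp.1.ne_zero]
        exact hp.2
    _ ≤ 2 / ((⌊w⌋₊ : ℝ) + 1) := sum_Ioo_inv_sq_le _ _
    _ ≤ 2 / w := by
        gcongr
        exact (Nat.lt_floor_add_one w).le

/-- Here log(1-u) ≥ 1 - 1/(1-u) = -u - u²/(1-u), and 1/(1-u) ≤ 2 on this range. -/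
theorem exp_neg_le_one_sub {u : ℝ} (h0 : 0 ≤ u) (h1 : u ≤ 1 / 2) :
    Real.exp (-u - 2 * u ^ 2) ≤ 1 - u := by
  have h2 : 0 < 1 - u := by linarith
  rw [← Real.le_log_iff_exp_le h2]
  refine le_trans ?_ (Real.one_sub_inv_le_log_of_pos h2)
  rw [inv_eq_one_div, le_sub_comm, div_le_iff₀ h2]
  nlinarith [pow_nonneg h0 2, mul_nonneg (pow_nonneg h0 2) (by linarith : 0 ≤ 1 - 2 * u)]

/-- The number of primes `p ∈ (v, w]` with `m mod p ∈ I_p - I_p`. -/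
def collisions (I : (p : ℕ) → Finset (ZMod p)) (v w : ℝ) (m : ℤ) : ℕ :=
  open Classical in ((primesIoc v w).filter fun p => InDiff I p m).card

/-- `∑ 2B/p` over the primes `p ∈ (v, w]` with `m mod p ∈ I_p - I_p`. -/
def collisionSum (I : (p : ℕ) → Finset (ZMod p)) (B : ℕ) (v w : ℝ) (m : ℤ) : ℝ :=
  open Classical in ∑ p ∈ (primesIoc v w).filter fun p => InDiff I p m, 2 * (B : ℝ) / p

theorem collisionSum_nonneg (I : (p : ℕ) → Finset (ZMod p)) (B : ℕ) (v w : ℝ) (m : ℤ) :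
    0 ≤ collisionSum I B v w m :=
  Finset.sum_nonneg fun _ _ => by positivity

theorem collisionSum_le (I : (p : ℕ) → Finset (ZMod p)) (B : ℕ) {v : ℝ} (hv : 0 < v) (w : ℝ)
    (m : ℤ) : collisionSum I B v w m ≤ 2 * B * collisions I v w m / v := by
  classical
  unfold collisionSum collisions
  refine (Finset.sum_le_card_nsmul _ _ (2 * (B : ℝ) / v) fun p hp => ?_).trans (le_of_eq ?_)
  · rw [Finset.mem_filter, mem_primesIoc] at hp
    have := hp.1.2.1
    gcongr
  · rw [nsmul_eq_mul]; ring

theorem InDiff.neg {I : (p : ℕ) → Finset (ZMod p)} {p : ℕ} {m : ℤ} (h : InDiff I p m) :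
    InDiff I p (-m) := by
  obtain ⟨s, hs, t, ht, h⟩ := h
  exact ⟨t, ht, s, hs, by push_cast; rw [h]; ring⟩

theorem inDiff_neg {I : (p : ℕ) → Finset (ZMod p)} {p : ℕ} {m : ℤ} :
    InDiff I p (-m) ↔ InDiff I p m :=
  ⟨fun h => by simpa using h.neg, InDiff.neg⟩

theorem collisionSum_neg (I : (p : ℕ) → Finset (ZMod p)) (B : ℕ) (v w : ℝ) (m : ℤ) :
    collisionSum I B v w (-m) = collisionSum I B v w m := by
  unfold collisionSum
  refine Finset.sum_congr ?_ fun _ _ => rfl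
  ext p
  simp only [Finset.mem_filter, inDiff_neg]

/-- Collisions only reduce the number of forbidden classes, so the union bound suffices here. With u
= |V||I_p|/p, compare 1 - u ≥ exp(-u - 2u²) with (1 - |I_p|/p)^|V| ≤ exp(-u); the quadratic losses
sum to at most 4l²/v because Σ 1/p² ≤ 2/v. -/
theorem survival_ge {I : (p : ℕ) → Finset (ZMod p)} {B : ℕ}
    (h1 : ∀ p : ℕ, p.Prime → (I p).card ≤ p - 1) (hB : ∀ p : ℕ, p.Prime → (I p).card ≤ B)
    {v w : ℝ} (hv : 0 < v) {V : Finset ℤ} {l : ℝ} (hl : (V.card : ℝ) * B ≤ l)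
    (hlv : 2 * l ≤ v) :
    densityIoc I v w ^ V.card * (1 - 4 * l ^ 2 / v) ≤ survival I v w V := by
  have hl0 : 0 ≤ l := le_trans (by positivity) hl
  have hd : 0 ≤ densityIoc I v w ^ V.card := pow_nonneg (densityIoc_pos h1 v w).le _
  calc densityIoc I v w ^ V.card * (1 - 4 * l ^ 2 / v)
      ≤ densityIoc I v w ^ V.card *
          Real.exp (∑ p ∈ primesIoc v w, -(2 * l ^ 2 * ((p : ℝ) ^ 2)⁻¹)) := by
        gcongr
        refine le_trans ?_ (Real.one_sub_le_exp_neg (4 * l ^ 2 / v)) |>.trans ?_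
        · exact le_rfl
        · rw [Real.exp_le_exp, Finset.sum_neg_distrib, ← Finset.mul_sum, neg_le_neg_iff]
          calc 2 * l ^ 2 * ∑ p ∈ primesIoc v w, ((p : ℝ) ^ 2)⁻¹
              ≤ 2 * l ^ 2 * (2 / v) := by
                gcongr
                exact sum_inv_sq_primesIoc_le hv w
            _ = 4 * l ^ 2 / v := by ring
    _ = ∏ p ∈ primesIoc v w, ((1 - ((I p).card : ℝ) / (p : ℝ)) ^ V.card *
          Real.exp (-(2 * l ^ 2 * ((p : ℝ) ^ 2)⁻¹))) := by
        rw [Finset.prod_mul_distrib, Finset.prod_pow, Real.exp_sum, densityIoc]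
    _ ≤ survival I v w V := by
        rw [survival_eq_prod]
        refine Finset.prod_le_prod (fun p hp => ?_) fun p hp => ?_
        · have := one_sub_card_div_pos h1 (mem_primesIoc.1 hp).1
          positivity
        · rw [mem_primesIoc] at hp
          have hp0 : (0 : ℝ) < p := by linarith [hp.2.1]
          set u : ℝ := (V.card : ℝ) * ((I p).card / p) with hu
          have hIB : ((I p).card : ℝ) ≤ B := by exact_mod_cast hB p hp.1
          have hu0 : 0 ≤ u := by positivity
          have hul : u ≤ l / p := by
            rw [hu, ← mul_div_assoc]
            gcongr
            exact le_trans (by gcongr) hl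
          have hu2 : u ≤ 1 / 2 := by
            refine hul.trans ?_
            rw [div_le_div_iff₀ hp0 two_pos]
            linarith [hp.2.1]
          have hpos := one_sub_card_div_pos h1 hp.1
          calc (1 - ((I p).card : ℝ) / (p : ℝ)) ^ V.card *
                Real.exp (-(2 * l ^ 2 * ((p : ℝ) ^ 2)⁻¹))
              ≤ Real.exp (-((I p).card / p)) ^ V.card * Real.exp (-(2 * u ^ 2)) := by
                have h3 : 2 * u ^ 2 ≤ 2 * l ^ 2 * ((p : ℝ) ^ 2)⁻¹ := by
                  calc 2 * u ^ 2 ≤ 2 * (l / p) ^ 2 := by gcongr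
                    _ = 2 * l ^ 2 * ((p : ℝ) ^ 2)⁻¹ := by ring
                refine mul_le_mul (pow_le_pow_left₀ hpos.le (Real.one_sub_le_exp_neg _) _)
                  (Real.exp_le_exp.2 (neg_le_neg h3)) (Real.exp_nonneg _) (by positivity)
            _ = Real.exp (-u - 2 * u ^ 2) := by
                rw [← Real.exp_nat_mul, ← Real.exp_add, hu]
                congr 1; ring
            _ ≤ 1 - u := exp_neg_le_one_sub hu0 hu2
            _ ≤ 1 - ((forbidden I V p).card : ℝ) / p := by
                have : ((forbidden I V p).card : ℝ) ≤ V.card * (I p).card := by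
                  exact_mod_cast forbidden_card_le I V p
                rw [hu, ← mul_div_assoc]
                gcongr

/-- Bernoulli's inequality compares 1 - |V||I_p|/p with (1 - |I_p|/p)^|V|. Each colliding ordered
pair adds at most B/p, and dividing by a main factor of size at least 1/2 turns this into a relative
gain of 2B/p. -/
theorem survival_le {I : (p : ℕ) → Finset (ZMod p)} {B : ℕ}
    (h1 : ∀ p : ℕ, p.Prime → (I p).card ≤ p - 1) (hB : ∀ p : ℕ, p.Prime → (I p).card ≤ B)
    {v w : ℝ} (hv : 0 < v) {V : Finset ℤ} (hV : 2 * ((V.card : ℝ) * B) ≤ v) :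
    survival I v w V ≤ densityIoc I v w ^ V.card *
      Real.exp (∑ t ∈ V.offDiag, collisionSum I B v w (t.1 - t.2)) := by
  classical
  have hsum : ∑ t ∈ V.offDiag, collisionSum I B v w (t.1 - t.2)
      = ∑ p ∈ primesIoc v w,
        2 * (B : ℝ) / p * (V.offDiag.filter fun t => InDiff I p (t.1 - t.2)).card := by
    simp only [collisionSum, Finset.sum_filter]
    rw [Finset.sum_comm]
    refine Finset.sum_congr rfl fun p _ => ?_
    rw [← Finset.sum_filter, Finset.sum_const, nsmul_eq_mul, mul_comm]
  rw [hsum, Real.exp_sum, densityIoc, ← Finset.prod_pow, ← Finset.prod_mul_distrib,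
    survival_eq_prod]
  refine Finset.prod_le_prod (fun p hp => ?_) fun p hp => ?_
  · rw [mem_primesIoc] at hp
    have : NeZero p := ⟨hp.1.ne_zero⟩
    have h2 : (forbidden I V p).card ≤ p := by
      simpa [ZMod.card] using Finset.card_le_univ (forbidden I V p)
    have hp0 : (0 : ℝ) < p := by exact_mod_cast hp.1.pos
    rw [sub_nonneg, div_le_one hp0]
    exact_mod_cast h2
  · rw [mem_primesIoc] at hp
    have hp0 : (0 : ℝ) < p := by linarith [hp.2.1]
    have hIB : ((I p).card : ℝ) ≤ B := by exact_mod_cast hB p hp.1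
    set c : ℝ := ((V.offDiag.filter fun t => InDiff I p (t.1 - t.2)).card : ℝ) with hc
    have hc0 : 0 ≤ c := by positivity
    have hU : (V.card : ℝ) * (I p).card ≤ (forbidden I V p).card + c * (I p).card := by
      rw [hc]; exact_mod_cast le_forbidden_card I V p
    have hpos := one_sub_card_div_pos h1 hp.1
    have hbern : 1 - (V.card : ℝ) * ((I p).card / p) ≤ (1 - ((I p).card : ℝ) / p) ^ V.card := by
      have := one_add_mul_le_pow (a := -(((I p).card : ℝ) / p)) (by linarith) V.card
      simpa [sub_eq_add_neg] using this
    -- Holds because p > v ≥ 2|V|B; this is the source of the 2 in `collisionSum`.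
    have hhalf : (1 : ℝ) / 2 ≤ (1 - ((I p).card : ℝ) / p) ^ V.card := by
      refine le_trans ?_ hbern
      have : (V.card : ℝ) * ((I p).card / p) ≤ 1 / 2 := by
        rw [← mul_div_assoc, div_le_div_iff₀ hp0 two_pos]
        have : (V.card : ℝ) * (I p).card ≤ V.card * B := by gcongr
        linarith [hp.2.1]
      linarith
    calc 1 - ((forbidden I V p).card : ℝ) / p
        ≤ 1 - (V.card : ℝ) * ((I p).card / p) + c * B / p := by
          have h3 : (V.card : ℝ) * ((I p).card / p) ≤ (forbidden I V p).card / p + c * B / p := by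
            rw [← mul_div_assoc, ← add_div]
            gcongr
            refine hU.trans ?_
            gcongr
          linarith
      _ ≤ (1 - ((I p).card : ℝ) / p) ^ V.card + c * B / p := by linarith
      _ ≤ (1 - ((I p).card : ℝ) / p) ^ V.card * (1 + 2 * B / p * c) := by
          have h4 : 0 ≤ c * B / p := by positivity
          have h5 : 2 * B / p * c = 2 * (c * B / p) := by ring
          rw [h5]
          nlinarith
      _ ≤ _ := by
          gcongr
          linarith [Real.add_one_le_exp (2 * (B : ℝ) / p * c)]

/-! ### Exponential moments of collision sums over an interval -/

theorem sum_Ioc_le_of_periodic {Q : ℕ} (hQ : 0 < Q) {f : ℤ → ℝ} (h0 : ∀ m, 0 ≤ f m)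
    (hf : ∀ m m' : ℤ, m ≡ m' [ZMOD Q] → f m = f m') {a b : ℤ} (hab : a ≤ b) :
    ∑ m ∈ Finset.Ioc a b, f m ≤ ((b - a : ℝ) / Q + 1) * ∑ r ∈ Finset.range Q, f r := by
  have hQ' : (0 : ℤ) < Q := by exact_mod_cast hQ
  have hQr : (0 : ℚ) < Q := by exact_mod_cast hQ
  have hmaps : ∀ m ∈ Finset.Ioc a b, (m % Q).toNat ∈ Finset.range Q := by
    intro m _
    have h1 := Int.emod_nonneg m hQ'.ne'
    have h2 := Int.emod_lt_of_pos m hQ'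
    rw [Finset.mem_range]
    omega
  rw [← Finset.sum_fiberwise_of_maps_to hmaps, Finset.mul_sum]
  refine Finset.sum_le_sum fun r hr => ?_
  rw [Finset.mem_range] at hr
  have hfilter : (Finset.Ioc a b).filter (fun m : ℤ => (m % Q).toNat = r)
      = (Finset.Ioc a b).filter (fun m : ℤ => m ≡ (r : ℤ) [ZMOD Q]) := by
    refine Finset.filter_congr fun m _ => ?_
    have h1 := Int.emod_nonneg m hQ'.ne'
    rw [Int.ModEq, Int.emod_eq_of_lt (a := (r : ℤ)) (by omega) (by omega)]
    omega
  rw [hfilter]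
  have hval : ∀ m ∈ (Finset.Ioc a b).filter (fun m : ℤ => m ≡ (r : ℤ) [ZMOD Q]), f m = f r :=
    fun m hm => hf _ _ (Finset.mem_filter.1 hm).2
  rw [Finset.sum_congr rfl hval, Finset.sum_const, nsmul_eq_mul]
  refine mul_le_mul_of_nonneg_right ?_ (h0 _)
  have hcard := Int.Ioc_filter_modEq_card a b hQ' (r : ℤ)
  have h1 : (((Finset.Ioc a b).filter (fun m : ℤ => m ≡ (r : ℤ) [ZMOD Q])).card : ℚ)
      ≤ (b - a : ℚ) / Q + 1 := by
    have : (((Finset.Ioc a b).filter (fun m : ℤ => m ≡ (r : ℤ) [ZMOD Q])).card : ℚ)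
      = (((Finset.Ioc a b).filter (fun m : ℤ => m ≡ (r : ℤ) [ZMOD Q])).card : ℤ) := by push_cast; rfl
    rw [this, hcard]
    push_cast
    refine max_le ?_ ?_
    · have h2 := Int.floor_le (((b : ℚ) - r) / Q)
      have h3 := Int.lt_floor_add_one (((a : ℚ) - r) / Q)
      have h4 : ((b : ℚ) - r) / Q - ((a : ℚ) - r) / Q = (b - a : ℚ) / Q := by ring
      linarith
    · have : (a : ℚ) ≤ b := by exact_mod_cast hab
      have : 0 ≤ (b - a : ℚ) / Q := div_nonneg (by linarith) hQr.le
      linarith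
  have h2 : ((((Finset.Ioc a b).filter (fun m : ℤ => m ≡ (r : ℤ) [ZMOD Q])).card : ℚ) : ℝ)
      ≤ (((b - a : ℚ) / Q + 1 : ℚ) : ℝ) := by exact_mod_cast h1
  push_cast at h2
  exact h2

theorem avgMod_ite_mem (p : ℕ) [NeZero p] (D : Finset (ZMod p)) (A : ℝ) :
    avgMod p (fun m => if (m : ZMod p) ∈ D then A / (p : ℝ) else 0)
      = A * D.card / (p : ℝ) ^ 2 := by
  have hp0 : (p : ℝ) ≠ 0 := by exact_mod_cast NeZero.ne p
  unfold avgMod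
  rw [sum_range_zmod p (fun x => if x ∈ D then A / (p : ℝ) else 0), Finset.sum_ite_mem,
    Finset.univ_inter, Finset.sum_const, nsmul_eq_mul]
  field_simp

/-- The product is periodic modulo ∏ p with mean ∏ A|D_p|/p². An interval is covered by (b - a)/∏ p
+ 1 periods, and the extra period accounts for the second product. -/
theorem sum_Ioc_prod_ite_le {T : Finset ℕ} (hT : ∀ p ∈ T, p.Prime)
    (D : (p : ℕ) → Finset (ZMod p)) {A : ℝ} (hA : 0 ≤ A) {a b : ℤ} (hab : a ≤ b) :
    ∑ m ∈ Finset.Ioc a b, ∏ p ∈ T, (if (m : ZMod p) ∈ D p then A / (p : ℝ) else 0)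
      ≤ (b - a : ℝ) * ∏ p ∈ T, (A * (D p).card / (p : ℝ) ^ 2)
        + ∏ p ∈ T, (A * (D p).card / (p : ℝ)) := by
  have hQ : 0 < ∏ p ∈ T, p := Finset.prod_pos fun p hp => (hT p hp).pos
  have hmod : ∀ p ∈ T, ∀ m m' : ℤ, m ≡ m' [ZMOD p] →
      (if (m : ZMod p) ∈ D p then A / (p : ℝ) else 0) = if (m' : ZMod p) ∈ D p then A / p else 0 := by
    intro p _ m m' h
    rw [(ZMod.intCast_eq_intCast_iff _ _ _).2 h]
  have hnonneg : ∀ m : ℤ, 0 ≤ ∏ p ∈ T, if (m : ZMod p) ∈ D p then A / (p : ℝ) else 0 :=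
    fun m => Finset.prod_nonneg fun p _ => by split_ifs <;> positivity
  have hper : ∀ m m' : ℤ, m ≡ m' [ZMOD (∏ p ∈ T, p : ℕ)] →
      (∏ p ∈ T, if (m : ZMod p) ∈ D p then A / (p : ℝ) else 0)
        = ∏ p ∈ T, if (m' : ZMod p) ∈ D p then A / (p : ℝ) else 0 :=
    fun m m' h => Finset.prod_congr rfl fun p hp => hmod p hp m m' (h.of_dvd
      (Int.natCast_dvd_natCast.2 (Finset.dvd_prod_of_mem (fun q => q) hp)))
  have h1 := sum_Ioc_le_of_periodic hQ hnonneg hper hab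
  refine h1.trans (le_of_eq ?_)
  have hQr : ((∏ p ∈ T, p : ℕ) : ℝ) ≠ 0 := by exact_mod_cast hQ.ne'
  have h2 := avgMod_prod T hT (fun p m => if (m : ZMod p) ∈ D p then A / p else 0) hmod
  have h3 : ∀ p ∈ T, avgMod p (fun m => if (m : ZMod p) ∈ D p then A / (p : ℝ) else 0)
      = A * (D p).card / (p : ℝ) ^ 2 := by
    intro p hp
    have : NeZero p := ⟨(hT p hp).ne_zero⟩
    exact avgMod_ite_mem p (D p) A
  rw [Finset.prod_congr rfl h3, avgMod, div_eq_iff hQr] at h2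
  rw [h2]
  have h4 : ∏ p ∈ T, A * (D p).card / (p : ℝ)
      = (∏ p ∈ T, A * (D p).card / (p : ℝ) ^ 2) * ((∏ p ∈ T, p : ℕ) : ℝ) := by
    rw [Nat.cast_prod, ← Finset.prod_mul_distrib]
    refine Finset.prod_congr rfl fun p hp => ?_
    have hp0 : (p : ℝ) ≠ 0 := by exact_mod_cast (hT p hp).ne_zero
    field_simp
  rw [h4]
  generalize (∏ p ∈ T, A * ((D p).card : ℝ) / (p : ℝ) ^ 2) = X
  generalize ((∏ p ∈ T, p : ℕ) : ℝ) = Q at *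
  field_simp

/-- Expand the product over subsets of P, treat each subset by periodicity, and resum both resulting
families. -/
theorem sum_Ioc_prod_one_add_le {P : Finset ℕ} (hP : ∀ p ∈ P, p.Prime)
    (D : (p : ℕ) → Finset (ZMod p)) {A : ℝ} (hA : 0 ≤ A) {a b : ℤ} (hab : a ≤ b) :
    ∑ m ∈ Finset.Ioc a b, ∏ p ∈ P, (1 + if (m : ZMod p) ∈ D p then A / p else 0)
      ≤ (b - a : ℝ) * ∏ p ∈ P, (1 + A * (D p).card / (p : ℝ) ^ 2)
        + ∏ p ∈ P, (1 + A * (D p).card / (p : ℝ)) := by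
  simp only [Finset.prod_one_add]
  rw [Finset.sum_comm, Finset.mul_sum, ← Finset.sum_add_distrib]
  exact Finset.sum_le_sum fun T hT =>
    sum_Ioc_prod_ite_le (fun p hp => hP p (Finset.mem_powerset.1 hT hp)) D hA hab

/-- `log (1 / ∏_{v < p ≤ w} (1 - |I_p| / p))`. -/
def logLoss (I : (p : ℕ) → Finset (ZMod p)) (v w : ℝ) : ℝ := -Real.log (densityIoc I v w)

theorem logLoss_nonneg {I : (p : ℕ) → Finset (ZMod p)}
    (h : ∀ p : ℕ, p.Prime → (I p).card ≤ p - 1) (v w : ℝ) : 0 ≤ logLoss I v w := by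
  have := Real.log_nonpos (densityIoc_pos h v w).le (densityIoc_le_one h v w)
  unfold logLoss; linarith

theorem inv_densityIoc_pow {I : (p : ℕ) → Finset (ZMod p)}
    (h : ∀ p : ℕ, p.Prime → (I p).card ≤ p - 1) (v w : ℝ) (n : ℕ) :
    1 / densityIoc I v w ^ n = Real.exp (n * logLoss I v w) := by
  rw [Real.exp_nat_mul, logLoss, Real.exp_neg, Real.exp_log (densityIoc_pos h v w), inv_pow,
    one_div]

theorem sum_card_div_le_logLoss {I : (p : ℕ) → Finset (ZMod p)}
    (h : ∀ p : ℕ, p.Prime → (I p).card ≤ p - 1) (v w : ℝ) :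
    ∑ p ∈ primesIoc v w, ((I p).card : ℝ) / p ≤ logLoss I v w := by
  unfold logLoss
  rw [le_neg, ← Real.log_exp (-∑ p ∈ primesIoc v w, ((I p).card : ℝ) / p)]
  refine Real.log_le_log (densityIoc_pos h v w) ?_
  rw [← Finset.sum_neg_distrib, Real.exp_sum]
  exact Finset.prod_le_prod
    (fun p hp => (one_sub_card_div_pos h (mem_primesIoc.1 hp).1).le)
    fun p _ => Real.one_sub_le_exp_neg _

theorem exp_le_one_add_two_mul {u : ℝ} (h0 : 0 ≤ u) (h1 : u ≤ 1) : Real.exp u ≤ 1 + 2 * u := by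
  have := Real.abs_exp_sub_one_le (x := u) (by rw [abs_of_nonneg h0]; exact h1)
  rw [abs_of_nonneg h0] at this
  linarith [le_abs_self (Real.exp u - 1)]

/-- The exponential factors over primes and is dominated by ∏ (1 + 4Bc·1/p) over colliding p. A
prime collides for at most B² classes, so the mean involves only Σ 1/p² over p > v and is close to
1. The incomplete period costs a sum over |I_p|/p, which the sieve product itself bounds through
`logLoss`. -/
theorem sum_Ioc_exp_collisionSum_le {I : (p : ℕ) → Finset (ZMod p)} {B : ℕ}
    (h1 : ∀ p : ℕ, p.Prime → (I p).card ≤ p - 1) (hB : ∀ p : ℕ, p.Prime → (I p).card ≤ B)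
    {v : ℝ} (hv : 0 < v) (w : ℝ) {c : ℝ} (hc : 0 ≤ c) (hcv : 2 * B * c ≤ v) {a b : ℤ}
    (hab : a ≤ b) :
    ∑ m ∈ Finset.Ioc a b, Real.exp (c * collisionSum I B v w m)
      ≤ (b - a : ℝ) * Real.exp (8 * c * B ^ 3 / v)
        + Real.exp (4 * c * B ^ 2 * logLoss I v w) := by
  classical
  let D : (p : ℕ) → Finset (ZMod p) := fun p => (I p ×ˢ I p).image fun t => t.1 - t.2
  have hD : ∀ (p : ℕ) (m : ℤ), InDiff I p m ↔ (m : ZMod p) ∈ D p := by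
    intro p m
    simp only [InDiff, D, Finset.mem_image, Finset.mem_product, Prod.exists]
    constructor
    · rintro ⟨s, hs, t, ht, h⟩; exact ⟨s, t, ⟨hs, ht⟩, h.symm⟩
    · rintro ⟨s, t, ⟨hs, ht⟩, h⟩; exact ⟨s, hs, t, ht, h.symm⟩
  have hDcard : ∀ p ∈ primesIoc v w, ((D p).card : ℝ) ≤ B * (I p).card := by
    intro p hp
    have h2 : (D p).card ≤ (I p).card * (I p).card := by
      refine Finset.card_image_le.trans ?_
      rw [Finset.card_product]
    have h3 := hB p (mem_primesIoc.1 hp).1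
    exact_mod_cast h2.trans (Nat.mul_le_mul_right _ h3)
  have hDcard2 : ∀ p ∈ primesIoc v w, ((D p).card : ℝ) ≤ (B : ℝ) ^ 2 := by
    intro p hp
    have h3 : ((I p).card : ℝ) ≤ B := by exact_mod_cast hB p (mem_primesIoc.1 hp).1
    refine (hDcard p hp).trans ?_
    rw [sq]
    gcongr
  have hpt : ∀ m : ℤ, Real.exp (c * collisionSum I B v w m)
      ≤ ∏ p ∈ primesIoc v w, (1 + if (m : ZMod p) ∈ D p then (4 * B * c) / p else 0) := by
    intro m
    unfold collisionSum
    rw [Finset.sum_filter, Finset.mul_sum, Real.exp_sum]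
    refine Finset.prod_le_prod (fun _ _ => (Real.exp_pos _).le) fun p hp => ?_
    rw [mem_primesIoc] at hp
    have hp0 : (0 : ℝ) < p := by linarith [hp.2.1]
    by_cases h : (m : ZMod p) ∈ D p
    · rw [if_pos ((hD p m).2 h), if_pos h]
      -- The assumption 2Bc ≤ v < p keeps each exponent at most 1, where exp is bounded linearly.
      have h2 : c * (2 * (B : ℝ) / p) ≤ 1 := by
        rw [← mul_div_assoc, div_le_one hp0]
        linarith [hp.2.1]
      refine (exp_le_one_add_two_mul (by positivity) h2).trans (le_of_eq ?_)
      ring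
    · rw [if_neg (fun h' => h ((hD p m).1 h')), if_neg h]
      simp
  refine (Finset.sum_le_sum fun m _ => hpt m).trans ?_
  refine (sum_Ioc_prod_one_add_le (fun p hp => (mem_primesIoc.1 hp).1) D (by positivity) hab).trans ?_
  have hab' : (0 : ℝ) ≤ b - a := by
    have : (a : ℝ) ≤ b := by exact_mod_cast hab
    linarith
  gcongr
  · calc ∏ p ∈ primesIoc v w, (1 + 4 * B * c * (D p).card / (p : ℝ) ^ 2)
        ≤ ∏ p ∈ primesIoc v w, Real.exp (4 * B ^ 3 * c * ((p : ℝ) ^ 2)⁻¹) := by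
          refine Finset.prod_le_prod (fun _ _ => by positivity) fun p hp => ?_
          rw [add_comm]
          refine le_trans ?_ (Real.add_one_le_exp _)
          rw [div_eq_mul_inv]
          have h2 : 4 * B * c * ((D p).card : ℝ) ≤ 4 * B ^ 3 * c := by
            calc 4 * B * c * ((D p).card : ℝ) ≤ 4 * B * c * (B : ℝ) ^ 2 := by
                  gcongr
                  exact hDcard2 p hp
              _ = 4 * B ^ 3 * c := by ring
          have h3 := mul_le_mul_of_nonneg_right h2
            (inv_nonneg.2 (by positivity : (0 : ℝ) ≤ (p : ℝ) ^ 2))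
          linarith
      _ ≤ Real.exp (8 * c * B ^ 3 / v) := by
          rw [← Real.exp_sum, ← Finset.mul_sum, Real.exp_le_exp]
          calc 4 * B ^ 3 * c * ∑ p ∈ primesIoc v w, ((p : ℝ) ^ 2)⁻¹
              ≤ 4 * B ^ 3 * c * (2 / v) := by
                gcongr
                exact sum_inv_sq_primesIoc_le hv w
            _ = 8 * c * B ^ 3 / v := by ring
  · calc ∏ p ∈ primesIoc v w, (1 + 4 * B * c * (D p).card / (p : ℝ))
        ≤ ∏ p ∈ primesIoc v w, Real.exp (4 * c * B ^ 2 * ((I p).card / (p : ℝ))) := by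
          refine Finset.prod_le_prod (fun _ _ => by positivity) fun p hp => ?_
          rw [add_comm]
          refine le_trans ?_ (Real.add_one_le_exp _)
          have h2 : 4 * B * c * ((D p).card : ℝ) ≤ 4 * c * B ^ 2 * (I p).card := by
            calc 4 * B * c * ((D p).card : ℝ) ≤ 4 * B * c * (B * (I p).card) := by
                  gcongr
                  exact hDcard p hp
              _ = 4 * c * B ^ 2 * (I p).card := by ring
          rw [← mul_div_assoc]
          have h3 := div_le_div_of_nonneg_right h2 (Nat.cast_nonneg (α := ℝ) p)
          linarith
      _ ≤ Real.exp (4 * c * B ^ 2 * logLoss I v w) := by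
          rw [← Real.exp_sum, ← Finset.mul_sum, Real.exp_le_exp]
          gcongr
          exact sum_card_div_le_logLoss h1 v w

/-- Jensen's inequality. It decouples the many differences between two progressions, so that each
can be summed on its own. -/
theorem exp_sum_le_avg_exp {ι : Type*} {s : Finset ι} (hs : s.Nonempty) (f : ι → ℝ) :
    Real.exp (∑ i ∈ s, f i) ≤ (∑ i ∈ s, Real.exp (s.card * f i)) / s.card := by
  have hc : (0 : ℝ) < s.card := by exact_mod_cast hs.card_pos
  have h := convexOn_exp.map_sum_le (t := s) (w := fun _ => 1 / (s.card : ℝ))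
    (p := fun i => s.card * f i) (fun _ _ => by positivity)
    (by simp; field_simp) (fun _ _ => Set.mem_univ _)
  simp only [smul_eq_mul] at h
  calc Real.exp (∑ i ∈ s, f i) = Real.exp (∑ i ∈ s, 1 / (s.card : ℝ) * (s.card * f i)) := by
        congr 1
        refine Finset.sum_congr rfl fun i _ => ?_
        field_simp
    _ ≤ _ := h
    _ = _ := by rw [← Finset.mul_sum]; ring

/-! ### Progressions and their weights, with small and large primes decoupled -/

/-- The indices `(i, h)` of the elements `n + a_{i,q} + h q` of a full progression. -/
def apIndex (I : (p : ℕ) → Finset (ZMod p)) (J : ℝ) (q : ℕ) : Finset (ℕ × ℕ) :=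
  Finset.Icc 1 (I q).card ×ˢ Finset.Icc 1 ⌊J⌋₊

/-- The offset `a_{i,q} + h q`. -/
def apOffset (a : ℕ → ℕ → ℤ) (q : ℕ) (t : ℕ × ℕ) : ℤ := a t.1 q + (t.2 : ℤ) * (q : ℤ)

/-- The progression before sieving. -/
def fullAP (I : (p : ℕ) → Finset (ZMod p)) (a : ℕ → ℕ → ℤ) (J : ℝ) (q : ℕ) (n : ℤ) :
    Finset ℤ :=
  (apIndex I J q).image fun t => n + apOffset a q t

theorem card_apIndex (I : (p : ℕ) → Finset (ZMod p)) (J : ℝ) (q : ℕ) :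
    (apIndex I J q).card = (I q).card * ⌊J⌋₊ := by
  simp [apIndex]

theorem mem_sievedAP {I : (p : ℕ) → Finset (ZMod p)} {a : ℕ → ℕ → ℤ} {b : ℤ} {v J : ℝ} {q : ℕ}
    {n m : ℤ} :
    m ∈ sievedAP I a b v J q n ↔ m ∈ fullAP I a J q n ∧ m ∈ sievedShift I 0 v b := by
  simp only [sievedAP, fullAP, apIndex, apOffset, Finset.mem_filter, Finset.mem_image, add_assoc]

theorem sievedAP_subset (I : (p : ℕ) → Finset (ZMod p)) (a : ℕ → ℕ → ℤ) (b : ℤ) (v J : ℝ)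
    (q : ℕ) (n : ℤ) : sievedAP I a b v J q n ⊆ fullAP I a J q n :=
  fun _ hm => (mem_sievedAP.1 hm).1

theorem card_fullAP_le (I : (p : ℕ) → Finset (ZMod p)) (a : ℕ → ℕ → ℤ) (J : ℝ)
    (q : ℕ) (n : ℤ) : (fullAP I a J q n).card ≤ (apIndex I J q).card :=
  Finset.card_image_le

theorem card_sievedAP_le (I : (p : ℕ) → Finset (ZMod p)) (a : ℕ → ℕ → ℤ) (b : ℤ) (v J : ℝ)
    (q : ℕ) (n : ℤ) : (sievedAP I a b v J q n).card ≤ (apIndex I J q).card :=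
  (Finset.card_le_card (sievedAP_subset I a b v J q n)).trans (card_fullAP_le I a J q n)

theorem sievedAP_congr (I : (p : ℕ) → Finset (ZMod p)) (a : ℕ → ℕ → ℤ) {b b' : ℤ} {v : ℝ}
    (h : b ≡ b' [ZMOD modulusIoc 0 v]) (J : ℝ) (q : ℕ) (n : ℤ) :
    sievedAP I a b v J q n = sievedAP I a b' v J q n := by
  ext m
  rw [mem_sievedAP, mem_sievedAP, sievedShift_congr I h]

open Classical in
/-- The weight `λ` with the sieving below `v` shifted by `b` and that in `(v, z]` by `c`. -/
def splitWeight (I : (p : ℕ) → Finset (ZMod p)) (a : ℕ → ℕ → ℤ) (v z J : ℝ) (q : ℕ) (b c : ℤ)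
    (n : ℤ) : ℝ :=
  if (sievedAP I a b v J q n : Set ℤ) ⊆ sievedShift I v z c then
    1 / densityIoc I v z ^ (sievedAP I a b v J q n).card
  else 0

/-- The progression sees the shift only through primes up to H^M, and its survival only through the
larger ones. Two separate shift arguments make this independence usable. -/
theorem weight_eq_splitWeight {I : (p : ℕ) → Finset (ZMod p)}
    (h1 : ∀ p : ℕ, p.Prime → (I p).card ≤ p - 1) (a : ℕ → ℕ → ℤ) (b : ℤ) (K M z H : ℝ)
    (h : H ^ M ≤ z) (q : ℕ) (n : ℤ) :
    weight I a b K M z H q n = splitWeight I a (H ^ M) z (K * H) q b b n := by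
  have h2 : sieveProd I z / sieveProd I (H ^ M) = densityIoc I (H ^ M) z := by
    have h3 : sieveProd I (H ^ M) ≠ 0 := by
      rw [← densityIoc_zero_left]; exact (densityIoc_pos h1 _ _).ne'
    rw [div_eq_iff h3, mul_comm]
    exact (sieveProd_mul_densityIoc I h).symm
  unfold weight splitWeight
  rw [h2]

theorem splitWeight_nonneg {I : (p : ℕ) → Finset (ZMod p)}
    (h1 : ∀ p : ℕ, p.Prime → (I p).card ≤ p - 1) (a : ℕ → ℕ → ℤ) (v z J : ℝ) (q : ℕ) (b c n : ℤ) :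
    0 ≤ splitWeight I a v z J q b c n := by
  have := densityIoc_pos h1 v z
  unfold splitWeight
  split_ifs <;> positivity

theorem splitWeight_congr (I : (p : ℕ) → Finset (ZMod p)) (a : ℕ → ℕ → ℤ) {v z : ℝ} (J : ℝ)
    (q : ℕ) (n : ℤ) {b b' c c' : ℤ} (hb : b ≡ b' [ZMOD modulusIoc 0 v])
    (hc : c ≡ c' [ZMOD modulusIoc v z]) :
    splitWeight I a v z J q b c n = splitWeight I a v z J q b' c' n := by
  unfold splitWeight
  rw [sievedAP_congr I a hb, sievedShift_congr I hc]

/-- This is conditioning on the primes up to v: the inner average runs over the large primes with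
the small ones frozen. -/
theorem avgMod_split {v z : ℝ} (h : v ≤ z) (F : ℤ → ℤ → ℝ)
    (hF : ∀ b b' c c' : ℤ, b ≡ b' [ZMOD modulusIoc 0 v] → c ≡ c' [ZMOD modulusIoc v z] →
      F b c = F b' c') :
    avgMod (modulusIoc 0 z) (fun b => F b b)
      = avgMod (modulusIoc 0 v) fun b => avgMod (modulusIoc v z) fun c => F b c := by
  rw [← modulusIoc_mul h]
  exact avgMod_mul (modulusIoc_pos _ _) (modulusIoc_pos _ _) (coprime_modulusIoc _ _ _) F hF

theorem avgMod_splitWeight (I : (p : ℕ) → Finset (ZMod p)) (a : ℕ → ℕ → ℤ) (v z J : ℝ)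
    (q : ℕ) (b n : ℤ) :
    avgMod (modulusIoc v z) (fun c => splitWeight I a v z J q b c n)
      = survival I v z (sievedAP I a b v J q n)
        * (1 / densityIoc I v z ^ (sievedAP I a b v J q n).card) := by
  unfold survival
  rw [← avgMod_mul_const]
  congr 1
  ext c
  unfold splitWeight
  rw [ite_mul, one_mul, zero_mul]

theorem avgMod_splitWeight_mul (I : (p : ℕ) → Finset (ZMod p)) (a : ℕ → ℕ → ℤ) (v z J : ℝ)
    (q q' : ℕ) (b n n' : ℤ) :
    avgMod (modulusIoc v z)
        (fun c => splitWeight I a v z J q b c n * splitWeight I a v z J q' b c n')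
      = survival I v z (sievedAP I a b v J q n ∪ sievedAP I a b v J q' n')
        * (1 / densityIoc I v z ^
          ((sievedAP I a b v J q n).card + (sievedAP I a b v J q' n').card)) := by
  unfold survival
  rw [← avgMod_mul_const]
  congr 1
  ext c
  unfold splitWeight
  rw [Finset.coe_union]
  by_cases h1 : (sievedAP I a b v J q n : Set ℤ) ⊆ sievedShift I v z c
  · by_cases h2 : (sievedAP I a b v J q' n' : Set ℤ) ⊆ sievedShift I v z c
    · rw [if_pos h1, if_pos h2, if_pos (Set.union_subset h1 h2), pow_add]
      ring
    · rw [if_neg h2, if_neg (fun h => h2 (Set.subset_union_right.trans h))]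
      ring
  · rw [if_neg h1, if_neg (fun h => h1 (Set.subset_union_left.trans h))]
    ring

/-- Only a lower bound for the mean is needed, since the variance is the second moment minus 2T
times the mean plus T². -/
theorem le_avgMod_splitWeight {I : (p : ℕ) → Finset (ZMod p)} {B : ℕ}
    (h1 : ∀ p : ℕ, p.Prime → (I p).card ≤ p - 1) (hB : ∀ p : ℕ, p.Prime → (I p).card ≤ B)
    (a : ℕ → ℕ → ℤ) {v : ℝ} (hv : 0 < v) (z J : ℝ) (q : ℕ) (b n : ℤ) {l : ℝ}
    (hl : ((apIndex I J q).card : ℝ) * B ≤ l) (hlv : 2 * l ≤ v) :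
    1 - 4 * l ^ 2 / v ≤ avgMod (modulusIoc v z) (fun c => splitWeight I a v z J q b c n) := by
  rw [avgMod_splitWeight]
  have hd := pow_pos (densityIoc_pos h1 v z) (sievedAP I a b v J q n).card
  have hc : ((sievedAP I a b v J q n).card : ℝ) * B ≤ l := by
    refine le_trans ?_ hl
    gcongr
    exact card_sievedAP_le I a b v J q n
  have := survival_ge h1 hB hv hc hlv (w := z)
  rw [mul_one_div, le_div_iff₀ hd, mul_comm]
  exact this

/-- Crude bound for the degenerate pairs: the joint survival probability is at most 1 and only the
normalisation is left. -/
theorem avgMod_splitWeight_mul_le_exp {I : (p : ℕ) → Finset (ZMod p)}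
    (h1 : ∀ p : ℕ, p.Prime → (I p).card ≤ p - 1)
    (a : ℕ → ℕ → ℤ) (v z J : ℝ) (q q' : ℕ) (b n n' : ℤ) {L : ℕ}
    (hL : (apIndex I J q).card ≤ L) (hL' : (apIndex I J q').card ≤ L) :
    avgMod (modulusIoc v z)
        (fun c => splitWeight I a v z J q b c n * splitWeight I a v z J q' b c n')
      ≤ Real.exp (2 * L * logLoss I v z) := by
  rw [avgMod_splitWeight_mul, inv_densityIoc_pow h1]
  refine (mul_le_of_le_one_left (Real.exp_nonneg _) (survival_le_one _ _ _ _)).trans ?_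
  rw [Real.exp_le_exp]
  refine mul_le_mul_of_nonneg_right ?_ (logLoss_nonneg h1 v z)
  have h2 := (card_sievedAP_le I a b v J q n).trans hL
  have h3 := (card_sievedAP_le I a b v J q' n').trans hL'
  have : (sievedAP I a b v J q n).card + (sievedAP I a b v J q' n').card ≤ 2 * L := by omega
  exact_mod_cast this

/-- A pair not contained in F₁ or in F₂ has one point in F₁ \ F₂ and the other in F₂ \ F₁. Keeping
the set differences matters: pairs that involve a shared point count as internal to one progression.
-/
theorem sum_offDiag_union_le {F₁ F₂ : Finset ℤ} {s : ℤ → ℝ} (h0 : ∀ m, 0 ≤ s m)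
    (hs : ∀ m, s (-m) = s m) :
    ∑ t ∈ (F₁ ∪ F₂).offDiag, s (t.1 - t.2)
      ≤ ∑ t ∈ F₁.offDiag, s (t.1 - t.2) + ∑ t ∈ F₂.offDiag, s (t.1 - t.2)
        + 2 * ∑ t ∈ (F₁ \ F₂) ×ˢ (F₂ \ F₁), s (t.1 - t.2) := by
  classical
  have hsub : (F₁ ∪ F₂).offDiag ⊆ (F₁.offDiag ∪ F₂.offDiag) ∪
      ((F₁ \ F₂) ×ˢ (F₂ \ F₁) ∪ (F₂ \ F₁) ×ˢ (F₁ \ F₂)) := by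
    rintro ⟨u, v⟩
    simp only [Finset.mem_offDiag, Finset.mem_union, Finset.mem_product, Finset.mem_sdiff]
    tauto
  have hle : ∀ A C : Finset (ℤ × ℤ), ∑ t ∈ A ∪ C, s (t.1 - t.2)
      ≤ ∑ t ∈ A, s (t.1 - t.2) + ∑ t ∈ C, s (t.1 - t.2) := by
    intro A C
    rw [← Finset.sum_union_inter]
    exact le_add_of_nonneg_right (Finset.sum_nonneg fun _ _ => h0 _)
  have hswap : ∑ t ∈ (F₂ \ F₁) ×ˢ (F₁ \ F₂), s (t.1 - t.2)
      = ∑ t ∈ (F₁ \ F₂) ×ˢ (F₂ \ F₁), s (t.1 - t.2) := by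
    rw [Finset.sum_product, Finset.sum_product_right]
    refine Finset.sum_congr rfl fun u _ => Finset.sum_congr rfl fun v _ => ?_
    rw [← hs, neg_sub]
  have h1 := Finset.sum_le_sum_of_subset_of_nonneg hsub
    (f := fun t : ℤ × ℤ => s (t.1 - t.2)) fun _ _ _ => h0 _
  have h2 := hle (F₁.offDiag ∪ F₂.offDiag) ((F₁ \ F₂) ×ˢ (F₂ \ F₁) ∪ (F₂ \ F₁) ×ˢ (F₁ \ F₂))
  have h3 := hle F₁.offDiag F₂.offDiag
  have h4 := hle ((F₁ \ F₂) ×ˢ (F₂ \ F₁)) ((F₂ \ F₁) ×ˢ (F₁ \ F₂))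
  linarith

/-- As |V₁ ∪ V₂| = |V₁| + |V₂| - |V₁ ∩ V₂|, the normalisation cancels up to one factor 1/σ₂ per
common point. The collision exponent is enlarged to the full progressions so that it no longer
depends on `b`. -/
theorem avgMod_splitWeight_mul_le {I : (p : ℕ) → Finset (ZMod p)} {B : ℕ}
    (h1 : ∀ p : ℕ, p.Prime → (I p).card ≤ p - 1) (hB : ∀ p : ℕ, p.Prime → (I p).card ≤ B)
    (a : ℕ → ℕ → ℤ) {v : ℝ} (hv : 0 < v) (z J : ℝ) (q q' : ℕ) (b n n' : ℤ) {L : ℕ}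
    (hL : (apIndex I J q).card ≤ L) (hL' : (apIndex I J q').card ≤ L)
    (hLv : 4 * (B : ℝ) * L ≤ v) :
    avgMod (modulusIoc v z)
        (fun c => splitWeight I a v z J q b c n * splitWeight I a v z J q' b c n')
      ≤ 1 / densityIoc I v z ^ (sievedAP I a b v J q n ∩ sievedAP I a b v J q' n').card
        * Real.exp (∑ t ∈ (fullAP I a J q n ∪ fullAP I a J q' n').offDiag,
            collisionSum I B v z (t.1 - t.2)) := by
  rw [avgMod_splitWeight_mul]
  set V₁ := sievedAP I a b v J q n
  set V₂ := sievedAP I a b v J q' n'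
  have hV₁ : V₁.card ≤ L := (card_sievedAP_le I a b v J q n).trans hL
  have hV₂ : V₂.card ≤ L := (card_sievedAP_le I a b v J q' n').trans hL'
  have hd := densityIoc_pos h1 v z
  have hcard : 2 * (((V₁ ∪ V₂).card : ℝ) * B) ≤ v := by
    have h2 : ((V₁ ∪ V₂).card : ℝ) ≤ 2 * L := by
      have := Finset.card_union_le V₁ V₂
      exact_mod_cast (by omega : (V₁ ∪ V₂).card ≤ 2 * L)
    calc 2 * (((V₁ ∪ V₂).card : ℝ) * B) ≤ 2 * (2 * L * B) := by gcongr
      _ = 4 * B * L := by ring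
      _ ≤ v := hLv
  have hsub : V₁ ∪ V₂ ⊆ fullAP I a J q n ∪ fullAP I a J q' n' :=
    Finset.union_subset_union (sievedAP_subset _ _ _ _ _ _ _) (sievedAP_subset _ _ _ _ _ _ _)
  have hs : ∑ t ∈ (V₁ ∪ V₂).offDiag, collisionSum I B v z (t.1 - t.2)
      ≤ ∑ t ∈ (fullAP I a J q n ∪ fullAP I a J q' n').offDiag,
            collisionSum I B v z (t.1 - t.2) :=
    Finset.sum_le_sum_of_subset_of_nonneg (Finset.offDiag_mono hsub)
      fun _ _ _ => collisionSum_nonneg _ _ _ _ _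
  rw [← Finset.card_union_add_card_inter, pow_add]
  have h3 := (survival_le h1 hB hv hcard (w := z)).trans
    (mul_le_mul_of_nonneg_left (Real.exp_le_exp.2 hs) (pow_nonneg hd.le _))
  refine (mul_le_mul_of_nonneg_right h3 (by positivity)).trans (le_of_eq ?_)
  field_simp

/-- All differences of two distinct elements of the progression modulo `q` have at most `k`
collisions among the primes in `(v, z]`. -/
def IsGoodModulus (I : (p : ℕ) → Finset (ZMod p)) (a : ℕ → ℕ → ℤ) (v z J : ℝ) (k q : ℕ) :
    Prop :=
  ∀ t ∈ apIndex I J q, ∀ t' ∈ apIndex I J q, t ≠ t' →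
    collisions I v z (apOffset a q t - apOffset a q t') ≤ k

theorem sum_offDiag_fullAP_le {I : (p : ℕ) → Finset (ZMod p)} {B : ℕ} {a : ℕ → ℕ → ℤ}
    {v z J : ℝ} {k q : ℕ} (hv : 0 < v) (hg : IsGoodModulus I a v z J k q) (n : ℤ) :
    ∑ t ∈ (fullAP I a J q n).offDiag, collisionSum I B v z (t.1 - t.2)
      ≤ ((apIndex I J q).card : ℝ) ^ 2 * (2 * B * k / v) := by
  refine (Finset.sum_le_card_nsmul _ _ (2 * (B : ℝ) * k / v) ?_).trans ?_
  · rintro ⟨u, u'⟩ hu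
    rw [Finset.mem_offDiag] at hu
    obtain ⟨hu, hu', hne⟩ := hu
    simp only [fullAP, Finset.mem_image] at hu hu'
    obtain ⟨t, ht, rfl⟩ := hu
    obtain ⟨t', ht', rfl⟩ := hu'
    have h := hg t ht t' ht' (by rintro rfl; exact hne rfl)
    refine (collisionSum_le I B hv z _).trans ?_
    have h2 : n + apOffset a q t - (n + apOffset a q t') = apOffset a q t - apOffset a q t' := by
      ring
    simp only
    rw [h2]
    gcongr
  · rw [nsmul_eq_mul]
    refine mul_le_mul_of_nonneg_right ?_ (by positivity)
    have h2 := card_fullAP_le I a J q n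
    rw [Finset.offDiag_card]
    have h3 : (fullAP I a J q n).card * (fullAP I a J q n).card
        ≤ (apIndex I J q).card * (apIndex I J q).card := Nat.mul_le_mul h2 h2
    rw [sq]
    exact_mod_cast (Nat.sub_le _ _).trans h3

theorem sum_fullAP_product_le {I : (p : ℕ) → Finset (ZMod p)} {a : ℕ → ℕ → ℤ} {J : ℝ}
    (q q' : ℕ) (n n' : ℤ) {s : ℤ × ℤ → ℝ} (hs : ∀ t, 0 ≤ s t) :
    ∑ t ∈ fullAP I a J q n ×ˢ fullAP I a J q' n', s t
      ≤ ∑ t ∈ apIndex I J q ×ˢ apIndex I J q',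
          s (n + apOffset a q t.1, n' + apOffset a q' t.2) := by
  classical
  have himg : fullAP I a J q n ×ˢ fullAP I a J q' n'
      = (apIndex I J q ×ˢ apIndex I J q').image
          fun t => (n + apOffset a q t.1, n' + apOffset a q' t.2) := by
    ext ⟨u, u'⟩
    simp only [fullAP, Finset.mem_product, Finset.mem_image, Prod.mk.injEq]
    constructor
    · rintro ⟨⟨t, ht, rfl⟩, ⟨t', ht', rfl⟩⟩
      exact ⟨(t, t'), ⟨ht, ht'⟩, rfl, rfl⟩
    · rintro ⟨⟨t, t'⟩, ⟨ht, ht'⟩, rfl, rfl⟩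
      exact ⟨⟨t, ht, rfl⟩, ⟨t', ht', rfl⟩⟩
  rw [himg]
  refine Finset.sum_image_le_of_nonneg ?_
  intro _ _
  exact hs _

theorem sum_le_card_mul {ι : Type*} {s : Finset ι} {f : ι → ℝ} {c N : ℝ}
    (hN : (s.card : ℝ) = N) (h : ∀ i ∈ s, f i ≤ c) : ∑ i ∈ s, f i ≤ N * c := by
  rw [← hN, ← nsmul_eq_mul]
  exact Finset.sum_le_card_nsmul _ _ _ h

theorem sum_Ioc_shift (f : ℤ → ℝ) (α β d : ℤ) :
    ∑ n ∈ Finset.Ioc α β, f (n + d) = ∑ m ∈ Finset.Ioc (α + d) (β + d), f m := by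
  rw [← Finset.image_add_right_Ioc α β d, Finset.sum_image]
  intro x _ y _ h
  simpa using h

/-! ### Second moments for one modulus and for one point -/

/-- Second moment of the sum of the weights of a fixed good modulus. -/
theorem avgMod_sum_splitWeight_sq_le {I : (p : ℕ) → Finset (ZMod p)} {B : ℕ}
    (h1 : ∀ p : ℕ, p.Prime → (I p).card ≤ p - 1) (hB : ∀ p : ℕ, p.Prime → (I p).card ≤ B)
    {a : ℕ → ℕ → ℤ} {v z J : ℝ} (hv : 0 < v) (hvz : v ≤ z) {k q L : ℕ}
    (hL : (apIndex I J q).card = L) (hL1 : 1 ≤ L) (hLv : 4 * (B : ℝ) * L ^ 2 ≤ v)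
    (hg : IsGoodModulus I a v z J k q) {α β : ℤ} (hαβ : α ≤ β) :
    avgMod (modulusIoc 0 z)
        (fun b => (∑ n ∈ Finset.Ioc α β, splitWeight I a v z J q b b n) ^ 2)
      ≤ (β - α : ℝ) ^ 2 * Real.exp (4 * B * L ^ 2 * k / v + 16 * L ^ 2 * B ^ 3 / v)
        + (β - α : ℝ) * (L ^ 2 * Real.exp (2 * L * logLoss I v z)
          + Real.exp (4 * B * L ^ 2 * k / v + 8 * L ^ 2 * B ^ 2 * logLoss I v z)) := by
  classical
  set N : ℝ := (β - α : ℝ) with hN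
  have hN0 : 0 ≤ N := by
    have : (α : ℝ) ≤ β := by exact_mod_cast hαβ
    rw [hN]; linarith
  set X := apIndex I J q with hX
  have hL0 : (0 : ℝ) < L := by exact_mod_cast hL1
  have hLv' : 4 * (B : ℝ) * L ≤ v := by
    refine le_trans ?_ hLv
    have : (1 : ℝ) ≤ L := by exact_mod_cast hL1
    have h2 : (L : ℝ) ≤ L ^ 2 := by nlinarith
    gcongr
  have hcardN : ((Finset.Ioc α β).card : ℝ) = N := by
    rw [Int.card_Ioc, hN]
    have : ((β - α).toNat : ℤ) = β - α := Int.toNat_of_nonneg (by omega)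
    exact_mod_cast this
  -- split the average and bound each pair
  have hsplit := avgMod_split hvz
    (fun b c => (∑ n ∈ Finset.Ioc α β, splitWeight I a v z J q b c n) ^ 2) (by
      intro b b' c c' hb hc
      congr 1
      exact Finset.sum_congr rfl fun n _ => splitWeight_congr I a J q n hb hc)
  -- It suffices to bound the average over the large primes uniformly in the small-prime shift.
  rw [hsplit, ← avgMod_const (modulusIoc_pos 0 v) (N ^ 2 * _ + _)]
  refine avgMod_mono fun b => ?_
  simp only [sq (∑ n ∈ Finset.Ioc α β, splitWeight I a v z J q b _ n), Finset.sum_mul_sum,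
    avgMod_sum]
  -- The pairs whose unsieved progressions share a point; each n has at most L² such partners.
  set near : ℤ → ℤ → Prop := fun n n' => ∃ t ∈ X ×ˢ X,
    n' = n + apOffset a q t.1 - apOffset a q t.2 with hnear
  set E : ℝ := Real.exp (4 * B * L ^ 2 * k / v) with hE
  have hpair : ∀ n n' : ℤ, avgMod (modulusIoc v z)
      (fun c => splitWeight I a v z J q b c n * splitWeight I a v z J q b c n')
      ≤ (if near n n' then Real.exp (2 * L * logLoss I v z) else 0)
        + E * ((∑ t ∈ X ×ˢ X, Real.exp (2 * (L : ℝ) ^ 2 *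
          collisionSum I B v z (n' + (apOffset a q t.2 - apOffset a q t.1 - n)))) / L ^ 2) := by
    intro n n'
    split_ifs with h
    · have h2 := avgMod_splitWeight_mul_le_exp h1 a v z J q q b n n' hL.le hL.le
      refine h2.trans (le_add_of_nonneg_right ?_)
      have := Finset.sum_nonneg fun (t : (ℕ × ℕ) × (ℕ × ℕ)) (_ : t ∈ X ×ˢ X) =>
        (Real.exp_pos (2 * (L : ℝ) ^ 2 *
          collisionSum I B v z (n' + (apOffset a q t.2 - apOffset a q t.1 - n)))).le
      positivity
    · have hdisj : Disjoint (fullAP I a J q n) (fullAP I a J q n') := by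
        rw [Finset.disjoint_left]
        intro u hu hu'
        simp only [fullAP, Finset.mem_image] at hu hu'
        obtain ⟨t, ht, rfl⟩ := hu
        obtain ⟨t', ht', h'⟩ := hu'
        exact h ⟨(t, t'), Finset.mem_product.2 ⟨ht, ht'⟩, by simp only; linarith⟩
      have hinter : (sievedAP I a b v J q n ∩ sievedAP I a b v J q n') = ∅ := by
        rw [← Finset.disjoint_iff_inter_eq_empty]
        exact Finset.disjoint_of_subset_left (sievedAP_subset _ _ _ _ _ _ _)
          (Finset.disjoint_of_subset_right (sievedAP_subset _ _ _ _ _ _ _) hdisj)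
      have h2 := avgMod_splitWeight_mul_le h1 hB a hv z J q q b n n' hL.le hL.le hLv'
      rw [hinter, Finset.card_empty, pow_zero, div_one, one_mul] at h2
      rw [zero_add]
      refine h2.trans ?_
      have h3 := sum_offDiag_union_le (F₁ := fullAP I a J q n) (F₂ := fullAP I a J q n')
        (collisionSum_nonneg I B v z) (collisionSum_neg I B v z)
      have h4 := sum_offDiag_fullAP_le (B := B) hv hg n
      have h5 := sum_offDiag_fullAP_le (B := B) hv hg n'
      rw [hL] at h4 h5
      have h6 : ∑ t ∈ (fullAP I a J q n \ fullAP I a J q n') ×ˢ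
          (fullAP I a J q n' \ fullAP I a J q n), collisionSum I B v z (t.1 - t.2)
          ≤ ∑ t ∈ X ×ˢ X,
            collisionSum I B v z (n' + (apOffset a q t.2 - apOffset a q t.1 - n)) := by
        refine (Finset.sum_le_sum_of_subset_of_nonneg
          (Finset.product_subset_product Finset.sdiff_subset Finset.sdiff_subset)
          fun _ _ _ => collisionSum_nonneg _ _ _ _ _).trans ?_
        refine (sum_fullAP_product_le q q n n' (s := fun t => collisionSum I B v z (t.1 - t.2))
          fun _ => collisionSum_nonneg _ _ _ _ _).trans (le_of_eq ?_)
        refine Finset.sum_congr rfl fun t _ => ?_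
        simp only
        rw [← collisionSum_neg]
        congr 1
        ring
      set W := ∑ t ∈ X ×ˢ X,
            collisionSum I B v z (n' + (apOffset a q t.2 - apOffset a q t.1 - n)) with hW
      have h7 : ∑ t ∈ (fullAP I a J q n ∪ fullAP I a J q n').offDiag,
            collisionSum I B v z (t.1 - t.2) ≤ 4 * B * L ^ 2 * k / v + 2 * W := by
        have : (4 : ℝ) * B * L ^ 2 * k / v = 2 * ((L : ℝ) ^ 2 * (2 * B * k / v)) := by ring
        linarith
      refine (Real.exp_le_exp.2 h7).trans ?_
      rw [Real.exp_add]
      refine mul_le_mul_of_nonneg_left ?_ (Real.exp_nonneg _)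
      have hne : (X ×ˢ X).Nonempty := by
        have : X.Nonempty := by rw [← Finset.card_pos, hL]; omega
        exact this.product this
      rw [hW, Finset.mul_sum]
      -- Jensen over the L² cross differences. For fixed n and t the difference is a translate of
      -- n', so the sum over n' becomes a sum over an interval.
      refine (exp_sum_le_avg_exp hne _).trans (le_of_eq ?_)
      rw [Finset.card_product, hL]
      push_cast
      rw [← sq]
      congr 1
      refine Finset.sum_congr rfl fun t _ => ?_
      congr 1
      ring
  refine (Finset.sum_le_sum fun n _ => Finset.sum_le_sum fun n' _ => hpair n n').trans ?_
  simp only [Finset.sum_add_distrib]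
  -- near pairs
  have hA : ∑ n ∈ Finset.Ioc α β, ∑ n' ∈ Finset.Ioc α β,
      (if near n n' then Real.exp (2 * L * logLoss I v z) else 0)
      ≤ N * (L ^ 2 * Real.exp (2 * L * logLoss I v z)) := by
    refine sum_le_card_mul hcardN fun n _ => ?_
    rw [← Finset.sum_filter, Finset.sum_const, nsmul_eq_mul]
    gcongr
    have h2 : ((Finset.Ioc α β).filter fun n' => near n n') ⊆
        (X ×ˢ X).image fun t => n + apOffset a q t.1 - apOffset a q t.2 := by
      intro n' hn'
      rw [Finset.mem_filter] at hn'
      obtain ⟨t, ht, h⟩ := hn'.2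
      exact Finset.mem_image.2 ⟨t, ht, h.symm⟩
    have h3 := (Finset.card_le_card h2).trans Finset.card_image_le
    rw [Finset.card_product, hL, ← sq] at h3
    exact_mod_cast h3
  -- remaining pairs
  have hC : ∑ n ∈ Finset.Ioc α β, ∑ n' ∈ Finset.Ioc α β,
      E * ((∑ t ∈ X ×ˢ X, Real.exp (2 * (L : ℝ) ^ 2 *
          collisionSum I B v z (n' + (apOffset a q t.2 - apOffset a q t.1 - n)))) / L ^ 2)
      ≤ N * (E * (N * Real.exp (16 * L ^ 2 * B ^ 3 / v)
        + Real.exp (8 * L ^ 2 * B ^ 2 * logLoss I v z))) := by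
    refine sum_le_card_mul hcardN fun n _ => ?_
    rw [← Finset.mul_sum, ← Finset.sum_div, Finset.sum_comm]
    refine mul_le_mul_of_nonneg_left ?_ (Real.exp_nonneg _)
    rw [div_le_iff₀ (by positivity)]
    have hcard : ((X ×ˢ X).card : ℝ) = (L : ℝ) ^ 2 := by
      rw [Finset.card_product, hL]; push_cast; ring
    refine (?_ : _ ≤ (L : ℝ) ^ 2 * _).trans_eq (mul_comm _ _)
    refine sum_le_card_mul hcard fun t _ => ?_
    set d := apOffset a q t.2 - apOffset a q t.1 - n
    rw [sum_Ioc_shift (fun m => Real.exp (2 * (L : ℝ) ^ 2 * collisionSum I B v z m)) α β d]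
    -- With c = 2L² the requirement 2Bc ≤ v reads 4BL² ≤ v.
    have h2 := sum_Ioc_exp_collisionSum_le h1 hB hv z (c := 2 * (L : ℝ) ^ 2) (by positivity)
      (by linarith) (a := α + d) (b := β + d) (by omega)
    refine h2.trans (le_of_eq ?_)
    push_cast
    rw [show (β : ℝ) + d - (α + d) = N by rw [hN]; ring]
    ring_nf
  refine (add_le_add hA hC).trans (le_of_eq ?_)
  rw [Real.exp_add, Real.exp_add, ← hE]
  ring

/-- Reduction modulo q recovers i, because the enumerated classes are distinct; then h is
determined. -/
theorem apOffset_injOn {I : (p : ℕ) → Finset (ZMod p)} {a : ℕ → ℕ → ℤ} (ha : IsEnumeration I a)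
    {q : ℕ} (hq : q.Prime) (J : ℝ) {t t' : ℕ × ℕ} (ht : t ∈ apIndex I J q)
    (ht' : t' ∈ apIndex I J q) (h : apOffset a q t = apOffset a q t') : t = t' := by
  simp only [apIndex, Finset.mem_product, Finset.mem_Icc] at ht ht'
  have h1 : t.1 = t'.1 := by
    refine (ha q hq).2.injOn ht.1 ht'.1 ?_
    have h2 := congrArg (fun m : ℤ => (m : ZMod q)) h
    simpa [apOffset] using h2
  have h3 : (t.2 : ℤ) * q = t'.2 * q := by
    unfold apOffset at h
    rw [h1] at h
    linarith
  have hq0 : (q : ℤ) ≠ 0 := by exact_mod_cast hq.ne_zero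
  have h4 : (t.2 : ℤ) = t'.2 := mul_right_cancel₀ hq0 h3
  exact Prod.ext h1 (by exact_mod_cast h4)

/-- The multiples of q disappear modulo q. This makes offset differences admissible as the integers
m_q in `diff_overlap`. -/
theorem inDiff_apOffset_sub {I : (p : ℕ) → Finset (ZMod p)} {a : ℕ → ℕ → ℤ}
    (ha : IsEnumeration I a) {q : ℕ} (hq : q.Prime) {t t' : ℕ × ℕ}
    (ht : t.1 ∈ Set.Icc 1 (I q).card) (ht' : t'.1 ∈ Set.Icc 1 (I q).card) :
    InDiff I q (apOffset a q t - apOffset a q t') :=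
  ⟨(a t.1 q : ZMod q), (ha q hq).2.mapsTo ht, (a t'.1 q : ZMod q), (ha q hq).2.mapsTo ht', by
    simp [apOffset]⟩

/-- `∑_q ∑_h λ(q, n - a_{i,q} - q h)` over the moduli `q ∈ G`. -/
def weightSum (I : (p : ℕ) → Finset (ZMod p)) (a : ℕ → ℕ → ℤ) (v z J : ℝ) (i : ℕ)
    (G : Finset ℕ) (b c n : ℤ) : ℝ :=
  ∑ q ∈ G, ∑ h ∈ Finset.Icc 1 ⌊J⌋₊, splitWeight I a v z J q b c (n - a i q - (q : ℤ) * (h : ℤ))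

theorem weightSum_congr (I : (p : ℕ) → Finset (ZMod p)) (a : ℕ → ℕ → ℤ) {v z : ℝ} (J : ℝ)
    (i : ℕ) (G : Finset ℕ) (n : ℤ) {b b' c c' : ℤ} (hb : b ≡ b' [ZMOD modulusIoc 0 v])
    (hc : c ≡ c' [ZMOD modulusIoc v z]) :
    weightSum I a v z J i G b c n = weightSum I a v z J i G b' c' n :=
  Finset.sum_congr rfl fun q _ => Finset.sum_congr rfl fun _ _ =>
    splitWeight_congr I a J q _ hb hc

theorem mem_sievedAP_of_mem_sievedShift {I : (p : ℕ) → Finset (ZMod p)} {a : ℕ → ℕ → ℤ}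
    {v J : ℝ} {i q h : ℕ} {b n : ℤ} (hi : i ∈ Finset.Icc 1 (I q).card)
    (hh : h ∈ Finset.Icc 1 ⌊J⌋₊) (hn : n ∈ sievedShift I 0 v b) :
    n ∈ sievedAP I a b v J q (n - a i q - (q : ℤ) * (h : ℤ)) := by
  rw [mem_sievedAP]
  refine ⟨Finset.mem_image.2 ⟨(i, h), Finset.mem_product.2 ⟨hi, hh⟩, ?_⟩, hn⟩
  simp only [apOffset]
  ring

/-- The point n lies on the progression and survives the small primes, so the weight requires it to
survive the large ones as well. -/
theorem splitWeight_eq_zero_of_notMem {I : (p : ℕ) → Finset (ZMod p)} {a : ℕ → ℕ → ℤ}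
    {v z J : ℝ} {i q h : ℕ} {b c n : ℤ} (hi : i ∈ Finset.Icc 1 (I q).card)
    (hh : h ∈ Finset.Icc 1 ⌊J⌋₊) (hn : n ∈ sievedShift I 0 v b) (hn' : n ∉ sievedShift I v z c) :
    splitWeight I a v z J q b c (n - a i q - (q : ℤ) * (h : ℤ)) = 0 := by
  unfold splitWeight
  rw [if_neg]
  intro hsub
  exact hn' (hsub (mem_sievedAP_of_mem_sievedShift hi hh hn))

/-- Upper bound for the conditional second moment of `weightSum` at a point `n` that survives
the sieving below `v`. -/
theorem avgMod_weightSum_sq_le {I : (p : ℕ) → Finset (ZMod p)} {B : ℕ}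
    (h1 : ∀ p : ℕ, p.Prime → (I p).card ≤ p - 1) (hB : ∀ p : ℕ, p.Prime → (I p).card ≤ B)
    {a : ℕ → ℕ → ℤ} (ha : IsEnumeration I a) {v z J : ℝ} (hv : 0 < v) {k L ν i : ℕ}
    {G : Finset ℕ} (hGp : ∀ q ∈ G, q.Prime) (hGν : ∀ q ∈ G, (I q).card = ν)
    (hi : i ∈ Finset.Icc 1 ν) (hL : ν * ⌊J⌋₊ = L) (hL1 : 1 ≤ L) (hLv : 4 * (B : ℝ) * L ≤ v)
    (hGg : ∀ q ∈ G, IsGoodModulus I a v z J k q)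
    {u NU Γ : ℝ}
    (hu : ∀ q ∈ G, ∀ t ∈ apIndex I J q, ∀ t' ∈ apIndex I J q,
      |((apOffset a q t - apOffset a q t' : ℤ) : ℝ)| ≤ u)
    (hNU0 : 0 ≤ NU)
    (hNU : ∀ m : ℤ, m ≠ 0 → |(m : ℝ)| ≤ u → ∀ Q : Finset ℕ, (∀ q ∈ Q, q.Prime ∧ InDiff I q m) →
      (Q.card : ℝ) ≤ NU)
    (hΓ0 : (G.card : ℝ) ≤ Γ)
    (hΓ : ∀ (m : ℕ → ℤ) (w : ℤ), (∀ q ∈ G, m q ≠ 0 ∧ InDiff I q (m q) ∧ |(m q : ℝ)| ≤ u) →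
      |(w : ℝ)| ≤ u → ∑ q ∈ G, Real.exp (4 * B * L ^ 2 / v *
        (if m q + w = 0 then 0 else collisions I v z (m q + w) : ℕ)) ≤ Γ)
    {b n : ℤ} (hn : n ∈ sievedShift I 0 v b) :
    avgMod (modulusIoc v z) (fun c => weightSum I a v z J i G b c n ^ 2)
      ≤ G.card * (⌊J⌋₊ : ℝ) ^ 2 * (L ^ 2 * NU * Real.exp (2 * L * logLoss I v z)
        + 1 / densityIoc I v z * Real.exp (4 * B * L ^ 2 * k / v) * Γ) := by
  classical
  set X : Finset (ℕ × ℕ) := Finset.Icc 1 ν ×ˢ Finset.Icc 1 ⌊J⌋₊ with hX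
  have hXq : ∀ q ∈ G, apIndex I J q = X := fun q hq => by rw [apIndex, hGν q hq]
  have hXc : X.card = L := by rw [hX, Finset.card_product]; simpa using hL
  have hL0 : (0 : ℝ) < L := by exact_mod_cast hL1
  have hd := densityIoc_pos h1 v z
  set W : Finset ℕ := Finset.Icc 1 ⌊J⌋₊ with hW
  have hih : ∀ h ∈ W, (i, h) ∈ X := fun h hh => Finset.mem_product.2 ⟨hi, hh⟩
  -- Coordinates relative to n: the points of the progression (q, h) through n are n + D q h t.
  let D : ℕ → ℕ → ℕ × ℕ → ℤ := fun q h t => apOffset a q t - apOffset a q (i, h)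
  have hDin : ∀ q ∈ G, ∀ h ∈ W, ∀ t ∈ X, InDiff I q (D q h t) := by
    intro q hq h hh t ht
    refine inDiff_apOffset_sub ha (hGp q hq) ?_ ?_
    · rw [hGν q hq]; simpa using (Finset.mem_product.1 ht).1
    · rw [hGν q hq]; simpa using hi
  have hDu : ∀ q ∈ G, ∀ h ∈ W, ∀ t ∈ X, |(D q h t : ℝ)| ≤ u := by
    intro q hq h hh t ht
    refine hu q hq t ?_ (i, h) ?_
    · rw [hXq q hq]; exact ht
    · rw [hXq q hq]; exact hih h hh
  have hD0 : ∀ q ∈ G, ∀ h ∈ W, ∀ t ∈ X, t ≠ (i, h) → D q h t ≠ 0 := by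
    intro q hq h hh t ht hne h0
    refine hne (apOffset_injOn ha (hGp q hq) J ?_ ?_ (sub_eq_zero.1 h0))
    · rw [hXq q hq]; exact ht
    · rw [hXq q hq]; exact hih h hh
  -- Two progressions through n that meet in a further point.
  let bad : ℕ → ℕ → ℕ → ℕ → Prop := fun q h q' h' =>
    ∃ t ∈ X ×ˢ X, D q h t.1 = D q' h' t.2 ∧ D q' h' t.2 ≠ 0
  -- Cross collisions, set to zero when one of the two points is n itself (the pair is then internal
  -- to the other progression) or when the points coincide.
  let e : ℕ → ℕ → ℕ → ℕ → (ℕ × ℕ) × (ℕ × ℕ) → ℝ := fun q h q' h' t =>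
    if D q h t.1 = 0 ∨ D q' h' t.2 = 0 ∨ D q h t.1 - D q' h' t.2 = 0 then 0
    else collisionSum I B v z (D q h t.1 - D q' h' t.2)
  have he0 : ∀ q h q' h' t, 0 ≤ e q h q' h' t := by
    intro q h q' h' t
    simp only [e]
    split_ifs
    · exact le_rfl
    · exact collisionSum_nonneg _ _ _ _ _
  set E : ℝ := Real.exp (4 * B * L ^ 2 * k / v) with hE
  -- the contribution of a pair of progressions through `n`
  have hpair : ∀ q ∈ G, ∀ h ∈ W, ∀ q' ∈ G, ∀ h' ∈ W, avgMod (modulusIoc v z)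
      (fun c => splitWeight I a v z J q b c (n - a i q - (q : ℤ) * (h : ℤ))
        * splitWeight I a v z J q' b c (n - a i q' - (q' : ℤ) * (h' : ℤ)))
      ≤ (if bad q h q' h' then Real.exp (2 * L * logLoss I v z) else 0)
        + 1 / densityIoc I v z * E *
          ((∑ t ∈ X ×ˢ X, Real.exp (2 * (L : ℝ) ^ 2 * e q h q' h' t)) / L ^ 2) := by
    intro q hq h hh q' hq' h' hh'
    have hcq : (apIndex I J q).card ≤ L := by rw [hXq q hq, hXc]
    have hcq' : (apIndex I J q').card ≤ L := by rw [hXq q' hq', hXc]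
    split_ifs with hbad
    · refine (avgMod_splitWeight_mul_le_exp h1 a v z J q q' b _ _ hcq hcq').trans
        (le_add_of_nonneg_right ?_)
      have := Finset.sum_nonneg fun (t : (ℕ × ℕ) × (ℕ × ℕ)) (_ : t ∈ X ×ˢ X) =>
        (Real.exp_pos (2 * (L : ℝ) ^ 2 * e q h q' h' t)).le
      positivity
    · set n₁ := n - a i q - (q : ℤ) * (h : ℤ) with hn₁
      set n₂ := n - a i q' - (q' : ℤ) * (h' : ℤ) with hn₂
      have hel : ∀ t, n₁ + apOffset a q t = n + D q h t := by
        intro t; simp only [hn₁, D, apOffset]; ring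
      have hel' : ∀ t, n₂ + apOffset a q' t = n + D q' h' t := by
        intro t; simp only [hn₂, D, apOffset]; ring
      have hi1 : i ∈ Finset.Icc 1 (I q).card := by rw [hGν q hq]; exact hi
      have hi2 : i ∈ Finset.Icc 1 (I q').card := by rw [hGν q' hq']; exact hi
      have hnV₁ : n ∈ sievedAP I a b v J q n₁ := mem_sievedAP_of_mem_sievedShift hi1 hh hn
      have hnV₂ : n ∈ sievedAP I a b v J q' n₂ := mem_sievedAP_of_mem_sievedShift hi2 hh' hn
      have hFF : ∀ m, m ∈ fullAP I a J q n₁ → m ∈ fullAP I a J q' n₂ → m = n := by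
        intro m hm hm'
        simp only [fullAP, Finset.mem_image, hXq q hq, hXq q' hq'] at hm hm'
        obtain ⟨t, ht, rfl⟩ := hm
        obtain ⟨t', ht', h2⟩ := hm'
        rw [hel, hel'] at h2
        by_contra hne
        refine hbad ⟨(t, t'), Finset.mem_product.2 ⟨ht, ht'⟩, by simp only; linarith, ?_⟩
        intro h3
        simp only at h3
        rw [hel] at hne
        rw [h3] at h2
        omega
      have hinter : sievedAP I a b v J q n₁ ∩ sievedAP I a b v J q' n₂ = {n} := by
        ext m
        rw [Finset.mem_inter, Finset.mem_singleton]
        constructor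
        · rintro ⟨hm, hm'⟩
          exact hFF m (sievedAP_subset _ _ _ _ _ _ _ hm) (sievedAP_subset _ _ _ _ _ _ _ hm')
        · rintro rfl
          exact ⟨hnV₁, hnV₂⟩
      have h2 := avgMod_splitWeight_mul_le h1 hB a hv z J q q' b n₁ n₂ hcq hcq' hLv
      rw [hinter, Finset.card_singleton, pow_one] at h2
      rw [zero_add]
      refine h2.trans ?_
      rw [mul_assoc]
      refine mul_le_mul_of_nonneg_left ?_ (by positivity)
      have h3 := sum_offDiag_union_le (F₁ := fullAP I a J q n₁) (F₂ := fullAP I a J q' n₂)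
        (collisionSum_nonneg I B v z) (collisionSum_neg I B v z)
      have h4 := sum_offDiag_fullAP_le (B := B) hv (hGg q hq) n₁
      have h5 := sum_offDiag_fullAP_le (B := B) hv (hGg q' hq') n₂
      rw [hXq q hq, hXc] at h4
      rw [hXq q' hq', hXc] at h5
      have h6 : ∑ t ∈ (fullAP I a J q n₁ \ fullAP I a J q' n₂) ×ˢ
          (fullAP I a J q' n₂ \ fullAP I a J q n₁), collisionSum I B v z (t.1 - t.2)
          ≤ ∑ t ∈ X ×ˢ X, e q h q' h' t := by
        let s : ℤ × ℤ → ℝ := fun t => if t.1 = n ∨ t.2 = n ∨ t.1 - t.2 = 0 then 0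
          else collisionSum I B v z (t.1 - t.2)
        have hs0 : ∀ t, 0 ≤ s t := by
          intro t
          simp only [s]
          split_ifs
          · exact le_rfl
          · exact collisionSum_nonneg _ _ _ _ _
        have h7 : ∑ t ∈ (fullAP I a J q n₁ \ fullAP I a J q' n₂) ×ˢ
          (fullAP I a J q' n₂ \ fullAP I a J q n₁), collisionSum I B v z (t.1 - t.2)
          = ∑ t ∈ (fullAP I a J q n₁ \ fullAP I a J q' n₂) ×ˢ
          (fullAP I a J q' n₂ \ fullAP I a J q n₁), s t := by
          refine Finset.sum_congr rfl fun t ht => ?_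
          rw [Finset.mem_product, Finset.mem_sdiff, Finset.mem_sdiff] at ht
          refine (if_neg ?_).symm
          rintro (h8 | h8 | h8)
          · exact ht.1.2 (h8 ▸ sievedAP_subset _ _ _ _ _ _ _ hnV₂)
          · exact ht.2.2 (h8 ▸ sievedAP_subset _ _ _ _ _ _ _ hnV₁)
          · rw [sub_eq_zero] at h8
            exact ht.1.2 (h8 ▸ ht.2.1)
        rw [h7]
        refine (Finset.sum_le_sum_of_subset_of_nonneg
          (Finset.product_subset_product Finset.sdiff_subset Finset.sdiff_subset)
          fun _ _ _ => hs0 _).trans ?_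
        refine (sum_fullAP_product_le q q' n₁ n₂ hs0).trans (le_of_eq ?_)
        rw [hXq q hq, hXq q' hq']
        refine Finset.sum_congr rfl fun t _ => ?_
        simp only [s, e, hel, hel', add_eq_left, add_sub_add_left_eq_sub]
      have h7 : ∑ t ∈ (fullAP I a J q n₁ ∪ fullAP I a J q' n₂).offDiag,
            collisionSum I B v z (t.1 - t.2)
            ≤ 4 * B * L ^ 2 * k / v + 2 * ∑ t ∈ X ×ˢ X, e q h q' h' t := by
        have : (4 : ℝ) * B * L ^ 2 * k / v = 2 * ((L : ℝ) ^ 2 * (2 * B * k / v)) := by ring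
        linarith
      refine (Real.exp_le_exp.2 h7).trans ?_
      rw [Real.exp_add]
      refine mul_le_mul_of_nonneg_left ?_ (Real.exp_nonneg _)
      have hne : (X ×ˢ X).Nonempty := by
        have : X.Nonempty := by rw [← Finset.card_pos, hXc]; omega
        exact this.product this
      rw [Finset.mul_sum]
      refine (exp_sum_le_avg_exp hne _).trans (le_of_eq ?_)
      rw [Finset.card_product, hXc]
      push_cast
      rw [← sq]
      congr 1
      refine Finset.sum_congr rfl fun t _ => ?_
      congr 1
      ring
  -- bad pairs
  have hbadcount : ∀ h ∈ W, ∀ q' ∈ G, ∀ h' ∈ W,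
      ∑ q ∈ G, (if bad q h q' h' then Real.exp (2 * L * logLoss I v z) else 0)
        ≤ NU * (L ^ 2 * Real.exp (2 * L * logLoss I v z)) := by
    intro h hh q' hq' h' hh'
    rw [← Finset.sum_filter, Finset.sum_const, nsmul_eq_mul]
    rw [← mul_assoc]
    refine mul_le_mul_of_nonneg_right ?_ (Real.exp_nonneg _)
    have hsub : G.filter (fun q => bad q h q' h') ⊆ (X ×ˢ X).biUnion fun t =>
        G.filter fun q => D q h t.1 = D q' h' t.2 ∧ D q' h' t.2 ≠ 0 := by
      intro q hq
      rw [Finset.mem_filter] at hq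
      obtain ⟨hq, t, ht, h2⟩ := hq
      exact Finset.mem_biUnion.2 ⟨t, ht, Finset.mem_filter.2 ⟨hq, h2⟩⟩
    have h2 : ((G.filter (fun q => bad q h q' h')).card : ℝ) ≤ ∑ t ∈ X ×ˢ X,
        ((G.filter fun q => D q h t.1 = D q' h' t.2 ∧ D q' h' t.2 ≠ 0).card : ℝ) := by
      exact_mod_cast (Finset.card_le_card hsub).trans Finset.card_biUnion_le
    refine h2.trans ?_
    have hcard : ((X ×ˢ X).card : ℝ) = (L : ℝ) ^ 2 := by
      rw [Finset.card_product, hXc]; push_cast; ring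
    refine (sum_le_card_mul hcard (c := NU) fun t ht => ?_).trans_eq (mul_comm _ _)
    rw [Finset.mem_product] at ht
    -- The integer D q' h' t.2 does not depend on q. When nonzero it lies in I_q - I_q for every q
    -- counted, and `hNU` bounds the number of such primes.
    by_cases h3 : D q' h' t.2 = 0
    · simpa [h3] using hNU0
    · refine hNU _ h3 (hDu q' hq' h' hh' t.2 ht.2) _ fun q hq => ?_
      rw [Finset.mem_filter] at hq
      refine ⟨hGp q hq.1, ?_⟩
      rw [← hq.2.1]
      exact hDin q hq.1 h hh t.1 ht.1
  -- the remaining pairs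
  have hrest : ∀ h ∈ W, ∀ q' ∈ G, ∀ h' ∈ W, ∀ t ∈ X ×ˢ X,
      ∑ q ∈ G, Real.exp (2 * (L : ℝ) ^ 2 * e q h q' h' t) ≤ Γ := by
    intro h hh q' hq' h' hh' t ht
    rw [Finset.mem_product] at ht
    by_cases hz : t.1 = (i, h) ∨ D q' h' t.2 = 0
    · refine le_trans (le_of_eq ?_) hΓ0
      rw [Finset.sum_congr rfl (g := fun _ => (1 : ℝ))]
      · simp
      · intro q _
        have : e q h q' h' t = 0 := by
          refine if_pos ?_
          rcases hz with hz | hz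
          · left; simp [D, hz]
          · right; left; exact hz
        rw [this, mul_zero, Real.exp_zero]
    · push Not at hz
      -- With q', h', t fixed, w = -D q' h' t.2 is constant while m_q = D q h t.1 varies with q: the
      -- shape required by `hΓ`.
      refine le_trans (Finset.sum_le_sum fun q hq => ?_)
        (hΓ (fun q => D q h t.1) (-D q' h' t.2)
          (fun q hq => ⟨hD0 q hq h hh t.1 ht.1 hz.1, hDin q hq h hh t.1 ht.1,
            hDu q hq h hh t.1 ht.1⟩) (by
            push_cast; rw [abs_neg]; exact hDu q' hq' h' hh' t.2 ht.2))
      rw [Real.exp_le_exp, ← sub_eq_add_neg]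
      have hne := hD0 q hq h hh t.1 ht.1 hz.1
      by_cases h3 : D q h t.1 - D q' h' t.2 = 0
      · simp only [e]
        rw [if_pos (Or.inr (Or.inr h3)), if_pos h3]
        simp
      · simp only [e]
        rw [if_neg (by tauto), if_neg h3]
        calc 2 * (L : ℝ) ^ 2 * collisionSum I B v z (D q h t.1 - D q' h' t.2)
            ≤ 2 * (L : ℝ) ^ 2 * (2 * B * collisions I v z (D q h t.1 - D q' h' t.2) / v) := by
              gcongr
              exact collisionSum_le I B hv z _
          _ = _ := by ring
  -- The sum over q is kept innermost, because coincidences and overlaps are counted in q with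
  -- everything else fixed.
  have hexpand : ∀ c, weightSum I a v z J i G b c n ^ 2
      = ∑ q' ∈ G, ∑ h' ∈ W, ∑ h ∈ W, ∑ q ∈ G,
        splitWeight I a v z J q b c (n - a i q - (q : ℤ) * (h : ℤ))
        * splitWeight I a v z J q' b c (n - a i q' - (q' : ℤ) * (h' : ℤ)) := by
    intro c
    unfold weightSum
    rw [sq, Finset.mul_sum]
    refine Finset.sum_congr rfl fun q' _ => ?_
    rw [Finset.mul_sum]
    refine Finset.sum_congr rfl fun h' _ => ?_
    rw [Finset.sum_comm, Finset.sum_mul]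
    refine Finset.sum_congr rfl fun h _ => ?_
    rw [Finset.sum_mul]
  simp only [hexpand, avgMod_sum]
  have hWc : (W.card : ℝ) = (⌊J⌋₊ : ℝ) := by simp [hW]
  have hfinal : ∀ q' ∈ G, ∀ h' ∈ W, ∀ h ∈ W, ∑ q ∈ G, avgMod (modulusIoc v z)
      (fun c => splitWeight I a v z J q b c (n - a i q - (q : ℤ) * (h : ℤ))
        * splitWeight I a v z J q' b c (n - a i q' - (q' : ℤ) * (h' : ℤ)))
      ≤ L ^ 2 * NU * Real.exp (2 * L * logLoss I v z) + 1 / densityIoc I v z * E * Γ := by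
    intro q' hq' h' hh' h hh
    refine (Finset.sum_le_sum fun q hq => hpair q hq h hh q' hq' h' hh').trans ?_
    rw [Finset.sum_add_distrib]
    refine add_le_add ?_ ?_
    · refine (hbadcount h hh q' hq' h' hh').trans (le_of_eq ?_)
      ring
    · rw [← Finset.mul_sum, ← Finset.sum_div, Finset.sum_comm]
      refine mul_le_mul_of_nonneg_left ?_ (by positivity)
      rw [div_le_iff₀ (by positivity)]
      have hcard : ((X ×ˢ X).card : ℝ) = (L : ℝ) ^ 2 := by
        rw [Finset.card_product, hXc]; push_cast; ring
      refine (?_ : _ ≤ (L : ℝ) ^ 2 * Γ).trans_eq (mul_comm _ _)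
      exact sum_le_card_mul hcard fun t ht => hrest h hh q' hq' h' hh' t ht
  calc _ ≤ ∑ q' ∈ G, ∑ h' ∈ W, ∑ h ∈ W, (L ^ 2 * NU * Real.exp (2 * L * logLoss I v z)
          + 1 / densityIoc I v z * E * Γ) :=
        Finset.sum_le_sum fun q' hq' => Finset.sum_le_sum fun h' hh' =>
          Finset.sum_le_sum fun h hh => hfinal q' hq' h' hh' h hh
    _ = _ := by
        simp only [Finset.sum_const, nsmul_eq_mul, hWc]
        ring

/-! ### Consequences of the overlap hypothesis -/

/-- The bound for overlapping differences in `IsRegularSystem`, with explicit constants. -/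
def OverlapBound (I : (p : ℕ) → Finset (ZMod p)) (c₁ c₂ C : ℝ) : Prop :=
  ∀ u : ℝ, 10 ≤ u → ∀ m : ℕ → ℤ,
      (∀ q : ℕ, q.Prime → 1 ≤ (I q).card → m q ≠ 0 ∧ InDiff I q (m q)) →
      ∀ w : ℤ, |(w : ℝ)| ≤ u → ∀ k : ℕ, 1 ≤ k →
        {q : ℕ | q.Prime ∧ 1 ≤ (I q).card ∧ 0 < |(m q : ℝ)| ∧ |(m q : ℝ)| ≤ u ∧ m q + w ≠ 0 ∧
          (k : ℕ∞) ≤ (diffPrimes I (m q + w)).encard}.Finite ∧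
        ({q : ℕ | q.Prime ∧ 1 ≤ (I q).card ∧ 0 < |(m q : ℝ)| ∧ |(m q : ℝ)| ≤ u ∧ m q + w ≠ 0 ∧
          (k : ℕ∞) ≤ (diffPrimes I (m q + w)).encard}.ncard : ℝ)
          ≤ C * (u * Real.log u ^ c₁ * Real.exp (-c₂ * k))

theorem natCast_le_encard_diffPrimes {I : (p : ℕ) → Finset (ZMod p)} {v z : ℝ} {m : ℤ} {k : ℕ}
    (h : k ≤ collisions I v z m) : (k : ℕ∞) ≤ (diffPrimes I m).encard := by
  classical
  have hsub : (((primesIoc v z).filter fun p => InDiff I p m : Finset ℕ) : Set ℕ)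
      ⊆ diffPrimes I m := by
    intro p hp
    rw [Finset.mem_coe, Finset.mem_filter, mem_primesIoc] at hp
    exact ⟨hp.1.1, hp.2⟩
  refine le_trans ?_ (Set.encard_le_encard hsub)
  rw [Set.encard_coe_eq_coe_finsetCard]
  unfold collisions at h
  exact Nat.cast_le.2 (by convert h)

theorem card_collisions_ge_le {I : (p : ℕ) → Finset (ZMod p)} {c₁ c₂ C : ℝ}
    (hov : OverlapBound I c₁ c₂ C) {u : ℝ} (hu : 10 ≤ u) {G : Finset ℕ}
    (hGp : ∀ q ∈ G, q.Prime) (hG1 : ∀ q ∈ G, 1 ≤ (I q).card) {m : ℕ → ℤ}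
    (hm : ∀ q ∈ G, m q ≠ 0 ∧ InDiff I q (m q) ∧ |(m q : ℝ)| ≤ u) {w : ℤ} (hw : |(w : ℝ)| ≤ u)
    {v z : ℝ} {k : ℕ} (hk : 1 ≤ k) :
    ((G.filter fun q => m q + w ≠ 0 ∧ k ≤ collisions I v z (m q + w)).card : ℝ)
      ≤ C * (u * Real.log u ^ c₁ * Real.exp (-c₂ * k)) := by
  classical
  -- The hypothesis asks for m_q at every prime with I_q nonempty. Outside G the value q serves: it
  -- is nonzero and its class 0 lies in I_q - I_q.
  let m' : ℕ → ℤ := fun q => if q ∈ G then m q else q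
  have hm' : ∀ q : ℕ, q.Prime → 1 ≤ (I q).card → m' q ≠ 0 ∧ InDiff I q (m' q) := by
    intro q hq hc
    by_cases hqG : q ∈ G
    · simp only [m', if_pos hqG]
      exact ⟨(hm q hqG).1, (hm q hqG).2.1⟩
    · simp only [m', if_neg hqG]
      refine ⟨by exact_mod_cast hq.ne_zero, ?_⟩
      obtain ⟨s, hs⟩ := Finset.card_pos.1 hc
      exact ⟨s, hs, s, hs, by simp⟩
  obtain ⟨hfin, hcard⟩ := hov u hu m' hm' w hw k hk
  refine le_trans ?_ hcard
  rw [← Set.ncard_coe_finset]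
  have : ((G.filter fun q => m q + w ≠ 0 ∧ k ≤ collisions I v z (m q + w) : Finset ℕ) : Set ℕ) ⊆
      {q : ℕ | q.Prime ∧ 1 ≤ (I q).card ∧ 0 < |(m' q : ℝ)| ∧ |(m' q : ℝ)| ≤ u ∧ m' q + w ≠ 0 ∧
          (k : ℕ∞) ≤ (diffPrimes I (m' q + w)).encard} := by
    intro q hq
    rw [Finset.mem_coe, Finset.mem_filter] at hq
    obtain ⟨hqG, h2, h3⟩ := hq
    have hmq : m' q = m q := if_pos hqG
    refine ⟨hGp q hqG, hG1 q hqG, ?_⟩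
    rw [hmq]
    exact ⟨abs_pos.2 (by exact_mod_cast (hm q hqG).1), (hm q hqG).2.2, h2,
      natCast_le_encard_diffPrimes h3⟩
  exact_mod_cast Set.ncard_le_ncard this hfin

/-- Either N ≤ k₀ and the first term suffices, or the term k = N of the sum does. This turns tail
counts into an exponential moment. -/
theorem exp_mul_le_add_sum {A : ℝ} (hA : 0 ≤ A) (k₀ N K : ℕ) (hNK : N ≤ K) :
    Real.exp (A * N) ≤ Real.exp (A * k₀)
      + ∑ k ∈ Finset.Ioc k₀ K, if k ≤ N then Real.exp (A * k) else 0 := by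
  rcases le_or_gt N k₀ with h | h
  · refine le_add_of_le_of_nonneg ?_ (Finset.sum_nonneg fun _ _ => by positivity)
    gcongr
  · refine le_add_of_nonneg_of_le (Real.exp_nonneg _) ?_
    refine le_trans ?_ (Finset.single_le_sum (fun _ _ => by positivity)
      (Finset.mem_Ioc.2 ⟨h, hNK⟩))
    simp

/-- Moduli with at most k₀ collisions give the first term. Beyond k₀ the count decays like exp(-c₂k)
and the weight grows at most like exp(c₂k/2), which leaves a geometric tail. -/
theorem sum_exp_collisions_le {I : (p : ℕ) → Finset (ZMod p)} {c₁ c₂ C : ℝ} (hc₂ : 0 < c₂)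
    (hC : 0 ≤ C) (hov : OverlapBound I c₁ c₂ C) {u : ℝ} (hu : 10 ≤ u) {G : Finset ℕ}
    (hGp : ∀ q ∈ G, q.Prime) (hG1 : ∀ q ∈ G, 1 ≤ (I q).card) {m : ℕ → ℤ}
    (hm : ∀ q ∈ G, m q ≠ 0 ∧ InDiff I q (m q) ∧ |(m q : ℝ)| ≤ u) {w : ℤ} (hw : |(w : ℝ)| ≤ u)
    {v z A : ℝ} (hA : 0 ≤ A) (hA2 : A ≤ c₂ / 2) (k₀ : ℕ) :
    ∑ q ∈ G, Real.exp (A *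
        (if m q + w = 0 then 0 else collisions I v z (m q + w) : ℕ))
      ≤ G.card * Real.exp (A * k₀) + C * (u * Real.log u ^ c₁) *
        (Real.exp (-(c₂ / 2) * k₀) / (1 - Real.exp (-(c₂ / 2)))) := by
  classical
  set N : ℕ → ℕ := fun q => if m q + w = 0 then 0 else collisions I v z (m q + w) with hN
  set K := (primesIoc v z).card
  have hNK : ∀ q, N q ≤ K := by
    intro q
    simp only [hN]
    split_ifs
    · exact Nat.zero_le _
    · exact Finset.card_filter_le _ _
  refine (Finset.sum_le_sum fun q _ => exp_mul_le_add_sum hA k₀ (N q) K (hNK q)).trans ?_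
  rw [Finset.sum_add_distrib, Finset.sum_const, nsmul_eq_mul, Finset.sum_comm]
  gcongr
  have hlog : 0 ≤ u * Real.log u ^ c₁ := by
    have := Real.log_nonneg (by linarith : 1 ≤ u)
    have h2 : 0 ≤ u := by linarith
    positivity
  set r := Real.exp (-(c₂ / 2)) with hr
  have hr1 : r < 1 := by rw [hr, Real.exp_lt_one_iff]; linarith
  have hterm : ∀ k ∈ Finset.Ioc k₀ K, ∑ q ∈ G, (if k ≤ N q then Real.exp (A * k) else 0)
      ≤ C * (u * Real.log u ^ c₁) * r ^ k := by
    intro k hk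
    rw [Finset.mem_Ioc] at hk
    rw [← Finset.sum_filter, Finset.sum_const, nsmul_eq_mul]
    have h2 := card_collisions_ge_le hov hu hGp hG1 hm hw (v := v) (z := z) (k := k) (by omega)
    have h3 : G.filter (fun q => k ≤ N q)
        ⊆ G.filter fun q => m q + w ≠ 0 ∧ k ≤ collisions I v z (m q + w) := by
      intro q hq
      rw [Finset.mem_filter] at hq ⊢
      refine ⟨hq.1, ?_⟩
      have h4 := hq.2
      simp only [hN] at h4
      split_ifs at h4 with h5
      · omega
      · exact ⟨h5, h4⟩
    have h4 : ((G.filter (fun q => k ≤ N q)).card : ℝ)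
        ≤ C * (u * Real.log u ^ c₁ * Real.exp (-c₂ * k)) :=
      le_trans (by exact_mod_cast Finset.card_le_card h3) h2
    calc ((G.filter (fun q => k ≤ N q)).card : ℝ) * Real.exp (A * k)
        ≤ C * (u * Real.log u ^ c₁ * Real.exp (-c₂ * k)) * Real.exp (c₂ / 2 * k) := by
          gcongr
      _ = C * (u * Real.log u ^ c₁) * (Real.exp (-c₂ * k) * Real.exp (c₂ / 2 * k)) := by ring
      _ = C * (u * Real.log u ^ c₁) * r ^ k := by
          rw [← Real.exp_add, hr, ← Real.exp_nat_mul]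
          congr 2
          ring
  refine (Finset.sum_le_sum hterm).trans ?_
  rw [← Finset.mul_sum]
  refine mul_le_mul_of_nonneg_left ?_ (by positivity)
  have hsub : Finset.Ioc k₀ K ⊆ Finset.Ico k₀ (K + 1) := by
    intro k hk
    rw [Finset.mem_Ioc] at hk
    rw [Finset.mem_Ico]
    omega
  refine (Finset.sum_le_sum_of_subset_of_nonneg hsub
    fun _ _ _ => pow_nonneg (Real.exp_nonneg _) _).trans ?_
  refine (geom_sum_Ico_le_of_lt_one (Real.exp_nonneg _) hr1).trans (le_of_eq ?_)
  rw [hr, ← Real.exp_nat_mul]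
  congr 2
  ring

/-- Union bound over the L² pairs of indices, each handled by the overlap hypothesis with w = 0 and
threshold k + 1. -/
theorem card_not_isGoodModulus_le {I : (p : ℕ) → Finset (ZMod p)} {c₁ c₂ C : ℝ}
    (hc₂ : 0 < c₂) (hC : 0 ≤ C) (hov : OverlapBound I c₁ c₂ C) {u : ℝ} (hu : 10 ≤ u)
    {a : ℕ → ℕ → ℤ} (ha : IsEnumeration I a) {J : ℝ} {ν L : ℕ} {Q : Finset ℕ}
    (hQp : ∀ q ∈ Q, q.Prime) (hν : 1 ≤ ν) (hQν : ∀ q ∈ Q, (I q).card = ν) (hL : ν * ⌊J⌋₊ = L)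
    (hQu : ∀ q ∈ Q, ∀ t ∈ apIndex I J q, ∀ t' ∈ apIndex I J q,
      |((apOffset a q t - apOffset a q t' : ℤ) : ℝ)| ≤ u) (v z : ℝ) (k : ℕ) :
    open Classical in ((Q.filter fun q => ¬ IsGoodModulus I a v z J k q).card : ℝ)
      ≤ L ^ 2 * (C * (u * Real.log u ^ c₁ * Real.exp (-c₂ * k))) := by
  classical
  set X : Finset (ℕ × ℕ) := Finset.Icc 1 ν ×ˢ Finset.Icc 1 ⌊J⌋₊ with hX
  have hXq : ∀ q ∈ Q, apIndex I J q = X := fun q hq => by rw [apIndex, hQν q hq]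
  have hXc : X.card = L := by rw [hX, Finset.card_product]; simpa using hL
  have hlog : 0 ≤ u * Real.log u ^ c₁ := by
    have := Real.log_nonneg (by linarith : 1 ≤ u)
    have h2 : 0 ≤ u := by linarith
    positivity
  have hsub : (Q.filter fun q => ¬ IsGoodModulus I a v z J k q) ⊆ (X ×ˢ X).biUnion fun t =>
      Q.filter fun q => t.1 ≠ t.2 ∧ k + 1 ≤ collisions I v z (apOffset a q t.1 - apOffset a q t.2) := by
    intro q hq
    rw [Finset.mem_filter] at hq
    obtain ⟨hq, h⟩ := hq
    unfold IsGoodModulus at h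
    push Not at h
    obtain ⟨t, ht, t', ht', hne, h⟩ := h
    rw [hXq q hq] at ht ht'
    exact Finset.mem_biUnion.2 ⟨(t, t'), Finset.mem_product.2 ⟨ht, ht'⟩,
      Finset.mem_filter.2 ⟨hq, hne, h⟩⟩
  have h2 : ((Q.filter fun q => ¬ IsGoodModulus I a v z J k q).card : ℝ) ≤ ∑ t ∈ X ×ˢ X,
      ((Q.filter fun q => t.1 ≠ t.2 ∧
        k + 1 ≤ collisions I v z (apOffset a q t.1 - apOffset a q t.2)).card : ℝ) := by
    exact_mod_cast (Finset.card_le_card hsub).trans Finset.card_biUnion_le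
  refine h2.trans ?_
  have hcard : ((X ×ˢ X).card : ℝ) = (L : ℝ) ^ 2 := by
    rw [Finset.card_product, hXc]; push_cast; ring
  refine sum_le_card_mul hcard fun t ht => ?_
  rw [Finset.mem_product] at ht
  by_cases hne : t.1 = t.2
  · simp only [hne, ne_eq, not_true_eq_false, false_and, Finset.filter_false, Finset.card_empty,
      Nat.cast_zero]
    positivity
  · have hD0 : ∀ q ∈ Q, apOffset a q t.1 - apOffset a q t.2 ≠ 0 := by
      intro q hq h0
      refine hne (apOffset_injOn ha (hQp q hq) J ?_ ?_ (sub_eq_zero.1 h0)) <;> rw [hXq q hq]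
      · exact ht.1
      · exact ht.2
    have h3 := card_collisions_ge_le hov hu hQp (fun q hq => by rw [hQν q hq]; exact hν)
      (m := fun q => apOffset a q t.1 - apOffset a q t.2) (fun q hq => ⟨hD0 q hq,
        inDiff_apOffset_sub ha (hQp q hq)
          (by rw [hQν q hq]; simpa using (Finset.mem_product.1 ht.1).1)
          (by rw [hQν q hq]; simpa using (Finset.mem_product.1 ht.2).1),
        hQu q hq t.1 (by rw [hXq q hq]; exact ht.1) t.2 (by rw [hXq q hq]; exact ht.2)⟩)
      (w := 0) (by simp; linarith) (v := v) (z := z) (k := k + 1) (by omega)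
    refine le_trans ?_ (h3.trans ?_)
    · norm_cast
      refine Finset.card_le_card fun q hq => ?_
      rw [Finset.mem_filter] at hq ⊢
      simp only [add_zero]
      exact ⟨hq.1, hD0 q hq.1, hq.2.2⟩
    · refine mul_le_mul_of_nonneg_left (mul_le_mul_of_nonneg_left (Real.exp_le_exp.2 ?_) hlog) hC
      push_cast
      nlinarith

/-! ### Centred second moments -/

theorem avgMod_sq_sub_le {m : ℕ} (hm : 0 < m) {f : ℤ → ℝ} {T m₁ m₂ : ℝ} (hT : 0 ≤ T)
    (h1 : m₁ ≤ avgMod m f) (h2 : avgMod m (fun b => f b ^ 2) ≤ m₂) :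
    avgMod m (fun b => (f b - T) ^ 2) ≤ m₂ - 2 * T * m₁ + T ^ 2 := by
  have h3 : (fun b => (f b - T) ^ 2) = fun b => (f b ^ 2 + (-(2 * T)) * f b) + T ^ 2 := by
    ext b; ring
  rw [h3, avgMod_add, avgMod_add, avgMod_const_mul, avgMod_const hm]
  have := mul_le_mul_of_nonneg_left h1 (by linarith : 0 ≤ 2 * T)
  linarith

theorem le_avgMod_sum_splitWeight {I : (p : ℕ) → Finset (ZMod p)} {B : ℕ}
    (h1 : ∀ p : ℕ, p.Prime → (I p).card ≤ p - 1) (hB : ∀ p : ℕ, p.Prime → (I p).card ≤ B)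
    (a : ℕ → ℕ → ℤ) {v z J : ℝ} (hv : 0 < v) (hvz : v ≤ z) {q : ℕ} {l : ℝ}
    (hl : ((apIndex I J q).card : ℝ) * B ≤ l) (hlv : 2 * l ≤ v) {α β : ℤ} (hαβ : α ≤ β) :
    (β - α : ℝ) * (1 - 4 * l ^ 2 / v) ≤ avgMod (modulusIoc 0 z)
        (fun b => ∑ n ∈ Finset.Ioc α β, splitWeight I a v z J q b b n) := by
  rw [avgMod_split hvz (fun b c => ∑ n ∈ Finset.Ioc α β, splitWeight I a v z J q b c n)
    fun b b' c c' hb hc => Finset.sum_congr rfl fun n _ => splitWeight_congr I a J q n hb hc]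
  rw [← avgMod_const (modulusIoc_pos 0 v) ((β - α : ℝ) * _)]
  refine avgMod_mono fun b => ?_
  rw [avgMod_sum]
  have hcardN : ((Finset.Ioc α β).card : ℝ) = β - α := by
    rw [Int.card_Ioc]
    have : ((β - α).toNat : ℤ) = β - α := Int.toNat_of_nonneg (by omega)
    exact_mod_cast this
  rw [← hcardN, ← nsmul_eq_mul]
  exact Finset.card_nsmul_le_sum _ _ _ fun n _ => le_avgMod_splitWeight h1 hB a hv z J q b n hl hlv

open Classical in
/-- The indicator function of the randomly shifted sieved set. -/
def sieveInd (I : (p : ℕ) → Finset (ZMod p)) (v z : ℝ) (b n : ℤ) : ℝ :=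
  if n ∈ sievedShift I v z b then 1 else 0

theorem avgMod_sieveInd (I : (p : ℕ) → Finset (ZMod p)) (v z : ℝ) (n : ℤ) :
    avgMod (modulusIoc v z) (fun b => sieveInd I v z b n) = densityIoc I v z := by
  rw [← survival_singleton I v z n]
  classical
  unfold survival sieveInd
  congr 1
  ext b
  exact if_congr (by simp) rfl rfl

theorem sieveInd_congr (I : (p : ℕ) → Finset (ZMod p)) {v z : ℝ} {b b' : ℤ} (n : ℤ)
    (h : b ≡ b' [ZMOD modulusIoc v z]) : sieveInd I v z b n = sieveInd I v z b' n := by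
  unfold sieveInd
  rw [sievedShift_congr I h]

theorem sieveInd_split (I : (p : ℕ) → Finset (ZMod p)) {v z : ℝ} (h : v ≤ z) (b n : ℤ) :
    sieveInd I 0 z b n = sieveInd I 0 v b n * sieveInd I v z b n := by
  have h3 := mem_sievedShift_split (I := I) h (b := b) (n := n)
  unfold sieveInd
  by_cases h1 : n ∈ sievedShift I 0 v b <;> by_cases h2 : n ∈ sievedShift I v z b <;>
    simp [h1, h2, h3]

/-- Survival of n at the large primes is already enforced by the weights, so its indicator may be
dropped. -/
theorem sieveInd_mul_weightSum {I : (p : ℕ) → Finset (ZMod p)} {a : ℕ → ℕ → ℤ} {v z J : ℝ}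
    {ν i : ℕ} {G : Finset ℕ} (hGν : ∀ q ∈ G, (I q).card = ν) (hi : i ∈ Finset.Icc 1 ν)
    (b c n : ℤ) :
    sieveInd I 0 v b n * sieveInd I v z c n * weightSum I a v z J i G b c n
      = sieveInd I 0 v b n * weightSum I a v z J i G b c n := by
  unfold sieveInd
  by_cases hn : n ∈ sievedShift I 0 v b
  · by_cases hn' : n ∈ sievedShift I v z c
    · simp [hn, hn']
    · have : weightSum I a v z J i G b c n = 0 :=
        Finset.sum_eq_zero fun q hq => Finset.sum_eq_zero fun h hh =>
          splitWeight_eq_zero_of_notMem (by rw [hGν q hq]; exact hi) hh hn hn'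
      rw [this, mul_zero, mul_zero]
  · simp [hn]

/-- Second moment of `weightSum` about `μ` over the shifts for which `n` survives. -/
theorem avgMod_sieveInd_mul_sq_le {I : (p : ℕ) → Finset (ZMod p)} {B : ℕ}
    (h1 : ∀ p : ℕ, p.Prime → (I p).card ≤ p - 1) (hB : ∀ p : ℕ, p.Prime → (I p).card ≤ B)
    (a : ℕ → ℕ → ℤ) {v z J : ℝ} (hv : 0 < v) (hvz : v ≤ z) {ν i L : ℕ} {G : Finset ℕ}
    (hGν : ∀ q ∈ G, (I q).card = ν) (hi : i ∈ Finset.Icc 1 ν) (hL : ν * ⌊J⌋₊ = L)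
    {l μ M₂ : ℝ} (hl : (L : ℝ) * B ≤ l) (hlv : 2 * l ≤ v) (hμ : 0 ≤ μ) {n : ℤ}
    (hM₂ : ∀ b, n ∈ sievedShift I 0 v b →
      avgMod (modulusIoc v z) (fun c => weightSum I a v z J i G b c n ^ 2) ≤ M₂) :
    avgMod (modulusIoc 0 z)
        (fun b => sieveInd I 0 z b n * (weightSum I a v z J i G b b n - μ) ^ 2)
      ≤ densityIoc I 0 v * (M₂ - 2 * μ * (G.card * ⌊J⌋₊ * (1 - 4 * l ^ 2 / v))
        + μ ^ 2 * densityIoc I v z) := by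
  -- After expanding the square, the large-prime indicator remains only in the constant term, which
  -- is why σ₂ multiplies μ² but neither of the other two terms.
  have hexp : ∀ b c, sieveInd I 0 v b n * sieveInd I v z c n *
      (weightSum I a v z J i G b c n - μ) ^ 2 = sieveInd I 0 v b n *
      (weightSum I a v z J i G b c n ^ 2 + (-(2 * μ)) * weightSum I a v z J i G b c n
        + μ ^ 2 * sieveInd I v z c n) := by
    intro b c
    have h := sieveInd_mul_weightSum (I := I) (a := a) (v := v) (z := z) (J := J) hGν hi b c n
    linear_combination (weightSum I a v z J i G b c n - 2 * μ) * h
  simp only [sieveInd_split I hvz]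
  rw [avgMod_split hvz (fun b c => sieveInd I 0 v b n * sieveInd I v z c n *
      (weightSum I a v z J i G b c n - μ) ^ 2) (fun b b' c c' hb hc => by
        rw [sieveInd_congr I n hb, sieveInd_congr I n hc, weightSum_congr I a J i G n hb hc])]
  rw [← avgMod_sieveInd I 0 v n, ← avgMod_mul_const]
  refine avgMod_mono fun b => ?_
  simp only [hexp]
  rw [avgMod_const_mul]
  by_cases hn : n ∈ sievedShift I 0 v b
  · refine mul_le_mul_of_nonneg_left ?_ (by unfold sieveInd; positivity)
    rw [avgMod_add, avgMod_add, avgMod_const_mul, avgMod_const_mul, avgMod_sieveInd]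
    have h2 := hM₂ b hn
    have h3 : (G.card : ℝ) * ⌊J⌋₊ * (1 - 4 * l ^ 2 / v)
        ≤ avgMod (modulusIoc v z) (fun c => weightSum I a v z J i G b c n) := by
      unfold weightSum
      simp only [avgMod_sum]
      rw [mul_assoc, ← nsmul_eq_mul]
      refine Finset.card_nsmul_le_sum _ _ _ fun q hq => ?_
      have hW : (⌊J⌋₊ : ℝ) = ((Finset.Icc 1 ⌊J⌋₊).card : ℝ) := by simp
      rw [hW, ← nsmul_eq_mul]
      refine Finset.card_nsmul_le_sum _ _ _ fun h _ => ?_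
      exact le_avgMod_splitWeight h1 hB a hv z J q b _
        (by rw [card_apIndex, hGν q hq, hL]; exact hl) hlv
    have := mul_le_mul_of_nonneg_left h3 (by linarith : 0 ≤ 2 * μ)
    linarith
  · have : sieveInd I 0 v b n = 0 := if_neg hn
    rw [this, zero_mul, zero_mul]

/-! ### Exceptional points after discarding atypical moduli -/

/-- Write D for the deviation. Since D > τT, both T and D are at most D²/(τ²T), and X ≤ T + D. Thus
the whole mass of a discarded modulus is charged to its variance. -/
theorem le_sq_div_of_lt_abs_sub {X T τ : ℝ} (hT : 0 < T) (hτ : 0 < τ) (hτ1 : τ ≤ 1)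
    (h : τ * T < |X - T|) : X ≤ 2 * (X - T) ^ 2 / (τ ^ 2 * T) := by
  have h1 : X ≤ T + |X - T| := by linarith [le_abs_self (X - T)]
  have h2 : (X - T) ^ 2 = |X - T| ^ 2 := (sq_abs _).symm
  rw [h2, le_div_iff₀ (by positivity)]
  set D := |X - T|
  have hD : 0 < D := lt_trans (by positivity) h
  have hτT : 0 < τ * T := by positivity
  have h3 : (T + D) * (τ ^ 2 * T) = (τ * T) ^ 2 + (τ * T) * τ * D := by ring
  have h4 : (τ * T) ^ 2 ≤ D ^ 2 := by gcongr
  have h5 : (τ * T) * τ * D ≤ D * 1 * D := by gcongr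
  have h6 : X * (τ ^ 2 * T) ≤ (T + D) * (τ ^ 2 * T) := by gcongr
  nlinarith

theorem sq_scaling {τ T : ℝ} (hT : T ≠ 0) (hτ : τ ≠ 0) (c C y σ κ : ℝ) :
    4 / (τ * T) ^ 2 * c * (y * σ * κ * (C * T) ^ 2) = 4 * c * C ^ 2 * y * σ * κ / τ ^ 2 := by
  field_simp

theorem cube_scaling {τ T : ℝ} (hT : T ≠ 0) (hτ : τ ≠ 0) (C κ θ : ℝ) :
    1 / (τ * T) * (2 / (τ ^ 2 * T) * (κ * T ^ 2) * (θ * (C * T))) = 2 * C * κ * θ * T / τ ^ 3 := by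
  field_simp

set_option maxHeartbeats 1000000 in
/-- If the weights of most moduli have total close to `T`, and their sums through most surviving
points are close to the expected value, then discarding the other moduli leaves few exceptional
points on average. -/
theorem avgMod_exceptional_le {ι : Type*} {m : ℕ} (𝔥 : Finset ι) (G : ι → Finset ℕ)
    (J : ι → ℕ) (lam : ι → ℕ → ℤ → ℤ → ℝ) (hlam : ∀ H q b n, 0 ≤ lam H q b n)
    (s : ℤ → ℤ → ℝ) (hs0 : ∀ b n, 0 ≤ s b n) (hs1 : ∀ b n, s b n ≤ 1)
    (d : ℕ → ℤ) (α β : ℤ) (y : ℕ)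
    (hpos : ∀ H ∈ 𝔥, ∀ q ∈ G H, ∀ h ∈ Finset.Icc 1 (J H), ∀ n ∈ Finset.Icc 1 (y : ℤ),
      n - d q - (q : ℤ) * (h : ℤ) ∈ Finset.Ioc α β)
    {T τ κ σ C θ C₂ : ℝ} (μ : ι → ℝ) (hT : 0 < T) (hτ : 0 < τ) (hτ1 : τ ≤ 1)
    (hκ : 0 ≤ κ) (hσ : 0 ≤ σ) (hθ : 0 ≤ θ) (hμ : ∀ H ∈ 𝔥, 0 ≤ μ H)
    (hX : ∀ H ∈ 𝔥, ∀ q ∈ G H,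
      avgMod m (fun b => (∑ n ∈ Finset.Ioc α β, lam H q b n - T) ^ 2) ≤ κ * T ^ 2)
    (hY : ∀ H ∈ 𝔥, ∀ n ∈ Finset.Icc 1 (y : ℤ),
      avgMod m (fun b => s b n * (∑ q ∈ G H, ∑ h ∈ Finset.Icc 1 (J H),
        lam H q b (n - d q - (q : ℤ) * (h : ℤ)) - μ H) ^ 2) ≤ σ * κ * μ H ^ 2)
    (hC : ∑ H ∈ 𝔥, μ H ≤ C * T) (hC₂ : |∑ H ∈ 𝔥, μ H - C₂ * T| ≤ τ * T / 2)
    (hGJ : ∀ H ∈ 𝔥, ((G H).card : ℝ) * J H ≤ θ * μ H) :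
    open Classical in avgMod m (fun b => ∑ n ∈ Finset.Icc 1 (y : ℤ), s b n *
        if |∑ H ∈ 𝔥, ∑ q ∈ (G H).filter (fun q =>
              |∑ n ∈ Finset.Ioc α β, lam H q b n - T| ≤ τ * T),
            ∑ h ∈ Finset.Icc 1 (J H), lam H q b (n - d q - (q : ℤ) * (h : ℤ)) - C₂ * T|
          ≤ 2 * τ * T then 0 else 1)
      ≤ 4 * 𝔥.card * C ^ 2 * y * σ * κ / τ ^ 2 + 2 * C * κ * θ * T / τ ^ 3 := by
  classical
  set X : ι → ℕ → ℤ → ℝ := fun H q b => ∑ n ∈ Finset.Ioc α β, lam H q b n with hXdef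
  set Y : ι → ℤ → ℤ → ℝ := fun H b n => ∑ q ∈ G H, ∑ h ∈ Finset.Icc 1 (J H),
        lam H q b (n - d q - (q : ℤ) * (h : ℤ)) with hYdef
  -- The part of the point sum lost with the discarded moduli.
  let rem : ℤ → ℤ → ℝ := fun b n => ∑ H ∈ 𝔥, ∑ q ∈ (G H).filter (fun q => ¬ |X H q b - T| ≤ τ * T),
            ∑ h ∈ Finset.Icc 1 (J H), lam H q b (n - d q - (q : ℤ) * (h : ℤ))
  have hrem0 : ∀ b n, 0 ≤ rem b n := fun b n => Finset.sum_nonneg fun H _ =>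
    Finset.sum_nonneg fun q _ => Finset.sum_nonneg fun h _ => hlam _ _ _ _
  have hτT : 0 < τ * T := by positivity
  -- pointwise bound for the indicator of exceptional points
  have hpt : ∀ b n, (if |∑ H ∈ 𝔥, ∑ q ∈ (G H).filter (fun q => |X H q b - T| ≤ τ * T),
            ∑ h ∈ Finset.Icc 1 (J H), lam H q b (n - d q - (q : ℤ) * (h : ℤ)) - C₂ * T|
          ≤ 2 * τ * T then (0 : ℝ) else 1)
      ≤ 4 / (τ * T) ^ 2 * 𝔥.card * ∑ H ∈ 𝔥, (Y H b n - μ H) ^ 2 + 1 / (τ * T) * rem b n := by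
    intro b n
    have hr := hrem0 b n
    have hsq : 0 ≤ ∑ H ∈ 𝔥, (Y H b n - μ H) ^ 2 := Finset.sum_nonneg fun _ _ => sq_nonneg _
    split_ifs with h
    · positivity
    · rw [not_le] at h
      set Z := ∑ H ∈ 𝔥, ∑ q ∈ (G H).filter (fun q => |X H q b - T| ≤ τ * T),
            ∑ h ∈ Finset.Icc 1 (J H), lam H q b (n - d q - (q : ℤ) * (h : ℤ)) with hZ
      have hZrem : Z + rem b n = ∑ H ∈ 𝔥, Y H b n := by
        rw [hZ, ← Finset.sum_add_distrib]
        exact Finset.sum_congr rfl fun H _ => Finset.sum_filter_add_sum_filter_not _ _ _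
      set A := ∑ H ∈ 𝔥, |Y H b n - μ H| with hA
      have hA1 : |∑ H ∈ 𝔥, Y H b n - ∑ H ∈ 𝔥, μ H| ≤ A := by
        rw [← Finset.sum_sub_distrib]
        exact Finset.abs_sum_le_sum_abs _ _
      have hA0 : 0 ≤ A := Finset.sum_nonneg fun _ _ => abs_nonneg _
      have hA2 : A ^ 2 ≤ 𝔥.card * ∑ H ∈ 𝔥, (Y H b n - μ H) ^ 2 := by
        have := sq_sum_le_card_mul_sum_sq (s := 𝔥) (f := fun H => |Y H b n - μ H|)
        simpa only [sq_abs] using this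
      have htri : |Z - C₂ * T| ≤ A + rem b n + τ * T / 2 := by
        have h2 : Z - C₂ * T = (∑ H ∈ 𝔥, Y H b n - ∑ H ∈ 𝔥, μ H) - rem b n
            + (∑ H ∈ 𝔥, μ H - C₂ * T) := by linarith
        rw [h2]
        have h3 := abs_add_le ((∑ H ∈ 𝔥, Y H b n - ∑ H ∈ 𝔥, μ H) - rem b n)
          (∑ H ∈ 𝔥, μ H - C₂ * T)
        have h4 := abs_sub (∑ H ∈ 𝔥, Y H b n - ∑ H ∈ 𝔥, μ H) (rem b n)
        rw [abs_of_nonneg hr] at h4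
        linarith
      -- The deviation exceeds 2τT and at most τT/2 comes from replacing Σ μ by C₂T. So either the
      -- fluctuations reach τT/2 or the discarded mass reaches τT.
      rcases le_or_gt (τ * T / 2) A with h2 | h2
      · have h3 : 1 ≤ 4 / (τ * T) ^ 2 * A ^ 2 := by
          rw [div_mul_eq_mul_div, one_le_div (by positivity)]
          nlinarith
        have h4 : 4 / (τ * T) ^ 2 * A ^ 2
            ≤ 4 / (τ * T) ^ 2 * (𝔥.card * ∑ H ∈ 𝔥, (Y H b n - μ H) ^ 2) := by gcongr
        have h5 : 0 ≤ 1 / (τ * T) * rem b n := by positivity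
        rw [mul_assoc]
        linarith
      · have h3 : τ * T ≤ rem b n := by linarith
        have h4 : 1 ≤ 1 / (τ * T) * rem b n := by
          rw [div_mul_eq_mul_div, one_mul, one_le_div hτT]
          exact h3
        have h5 : 0 ≤ 4 / (τ * T) ^ 2 * 𝔥.card * ∑ H ∈ 𝔥, (Y H b n - μ H) ^ 2 := by positivity
        linarith
  -- total contribution of the discarded moduli
  have hremsum : ∀ b, ∑ n ∈ Finset.Icc 1 (y : ℤ), s b n * rem b n
      ≤ ∑ H ∈ 𝔥, ∑ q ∈ G H, 2 * J H / (τ ^ 2 * T) * (X H q b - T) ^ 2 := by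
    intro b
    calc ∑ n ∈ Finset.Icc 1 (y : ℤ), s b n * rem b n
        ≤ ∑ n ∈ Finset.Icc 1 (y : ℤ), rem b n :=
          Finset.sum_le_sum fun n _ => mul_le_of_le_one_left (hrem0 b n) (hs1 b n)
      _ = ∑ H ∈ 𝔥, ∑ q ∈ (G H).filter (fun q => ¬ |X H q b - T| ≤ τ * T),
            ∑ h ∈ Finset.Icc 1 (J H), ∑ n ∈ Finset.Icc 1 (y : ℤ),
              lam H q b (n - d q - (q : ℤ) * (h : ℤ)) := by
          rw [Finset.sum_comm]
          refine Finset.sum_congr rfl fun H _ => ?_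
          rw [Finset.sum_comm]
          refine Finset.sum_congr rfl fun q _ => ?_
          rw [Finset.sum_comm]
      _ ≤ ∑ H ∈ 𝔥, ∑ q ∈ (G H).filter (fun q => ¬ |X H q b - T| ≤ τ * T),
            2 * J H / (τ ^ 2 * T) * (X H q b - T) ^ 2 := by
          refine Finset.sum_le_sum fun H hH => Finset.sum_le_sum fun q hq => ?_
          rw [Finset.mem_filter, not_le] at hq
          -- For fixed h the base point is an injective function of n with values in (α, β], so the
          -- sum over n is part of X.
          have hh : ∀ h ∈ Finset.Icc 1 (J H), ∑ n ∈ Finset.Icc 1 (y : ℤ),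
              lam H q b (n - d q - (q : ℤ) * (h : ℤ)) ≤ X H q b := by
            intro h hh
            have hinj : Set.InjOn (fun n : ℤ => n - d q - (q : ℤ) * (h : ℤ))
                (Finset.Icc 1 (y : ℤ) : Set ℤ) := by
              intro n _ n' _ h2
              simpa using h2
            rw [← Finset.sum_image (f := fun n => lam H q b n) hinj]
            refine Finset.sum_le_sum_of_subset_of_nonneg ?_ fun _ _ _ => hlam _ _ _ _
            intro n hn
            obtain ⟨n', hn', rfl⟩ := Finset.mem_image.1 hn
            exact hpos H hH q hq.1 h hh n' hn'
          have h2 := le_sq_div_of_lt_abs_sub hT hτ hτ1 hq.2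
          have hc : ((Finset.Icc 1 (J H)).card : ℝ) = J H := by simp
          refine (sum_le_card_mul hc hh).trans ?_
          calc (J H : ℝ) * X H q b ≤ J H * (2 * (X H q b - T) ^ 2 / (τ ^ 2 * T)) := by gcongr
            _ = _ := by ring
      _ ≤ _ := by
          refine Finset.sum_le_sum fun H _ => Finset.sum_le_sum_of_subset_of_nonneg
            (Finset.filter_subset _ _) fun _ _ _ => by positivity
  have hbound : ∀ b, ∑ n ∈ Finset.Icc 1 (y : ℤ), s b n *
        (if |∑ H ∈ 𝔥, ∑ q ∈ (G H).filter (fun q => |X H q b - T| ≤ τ * T),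
            ∑ h ∈ Finset.Icc 1 (J H), lam H q b (n - d q - (q : ℤ) * (h : ℤ)) - C₂ * T|
          ≤ 2 * τ * T then (0 : ℝ) else 1)
      ≤ 4 / (τ * T) ^ 2 * 𝔥.card * ∑ H ∈ 𝔥, ∑ n ∈ Finset.Icc 1 (y : ℤ),
          s b n * (Y H b n - μ H) ^ 2
        + 1 / (τ * T) * ∑ H ∈ 𝔥, ∑ q ∈ G H, 2 * J H / (τ ^ 2 * T) * (X H q b - T) ^ 2 := by
    intro b
    refine (Finset.sum_le_sum fun n _ => mul_le_mul_of_nonneg_left (hpt b n) (hs0 b n)).trans ?_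
    simp only [mul_add, Finset.sum_add_distrib]
    refine add_le_add (le_of_eq ?_) ?_
    · rw [Finset.sum_comm (s := 𝔥), Finset.mul_sum]
      refine Finset.sum_congr rfl fun n _ => ?_
      rw [← Finset.mul_sum]
      ring
    · refine le_trans (le_of_eq ?_) (mul_le_mul_of_nonneg_left (hremsum b) (by positivity))
      rw [Finset.mul_sum]
      refine Finset.sum_congr rfl fun n _ => ?_
      ring
  refine (avgMod_mono hbound).trans ?_
  rw [avgMod_add, avgMod_const_mul, avgMod_const_mul]
  simp only [avgMod_sum, avgMod_const_mul]
  have hC0 : 0 ≤ C := by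
    have h2 := Finset.sum_nonneg hμ
    by_contra! hneg
    have := mul_neg_of_neg_of_pos hneg hT
    linarith
  have hμ2 : ∑ H ∈ 𝔥, μ H ^ 2 ≤ (C * T) ^ 2 := by
    refine (Finset.sum_sq_le_sq_sum_of_nonneg hμ).trans ?_
    have := Finset.sum_nonneg hμ
    gcongr
  refine add_le_add ?_ ?_
  · calc 4 / (τ * T) ^ 2 * 𝔥.card * ∑ H ∈ 𝔥, ∑ n ∈ Finset.Icc 1 (y : ℤ),
          avgMod m (fun b => s b n * (Y H b n - μ H) ^ 2)
        ≤ 4 / (τ * T) ^ 2 * 𝔥.card * ∑ H ∈ 𝔥, y * (σ * κ * μ H ^ 2) := by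
          gcongr with H hH
          exact sum_le_card_mul (by simp) fun n hn => hY H hH n hn
      _ = 4 / (τ * T) ^ 2 * 𝔥.card * (y * σ * κ * ∑ H ∈ 𝔥, μ H ^ 2) := by
          congr 1
          rw [Finset.mul_sum]
          refine Finset.sum_congr rfl fun H _ => ?_
          ring
      _ ≤ 4 / (τ * T) ^ 2 * 𝔥.card * (y * σ * κ * (C * T) ^ 2) := by gcongr
      _ = _ := sq_scaling hT.ne' hτ.ne' _ _ _ _ _
  · calc 1 / (τ * T) * ∑ H ∈ 𝔥, ∑ q ∈ G H, 2 * J H / (τ ^ 2 * T) *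
          avgMod m (fun b => (X H q b - T) ^ 2)
        ≤ 1 / (τ * T) * ∑ H ∈ 𝔥, ∑ q ∈ G H, 2 * J H / (τ ^ 2 * T) * (κ * T ^ 2) := by
          gcongr with H hH q hq
          exact hX H hH q hq
      _ = 1 / (τ * T) * (2 / (τ ^ 2 * T) * (κ * T ^ 2) * ∑ H ∈ 𝔥, ((G H).card : ℝ) * J H) := by
          congr 1
          rw [Finset.mul_sum]
          refine Finset.sum_congr rfl fun H _ => ?_
          rw [Finset.sum_const, nsmul_eq_mul]
          ring
      _ ≤ 1 / (τ * T) * (2 / (τ ^ 2 * T) * (κ * T ^ 2) * (θ * (C * T))) := by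
          gcongr
          refine (Finset.sum_le_sum hGJ).trans ?_
          rw [← Finset.mul_sum]
          gcongr
      _ = _ := cube_scaling hT.ne' hτ.ne' _ _ _

/-! ### Error budget at a single scale -/

/-- The error caused by the moduli with more than `k` collisions. -/
def overlapTail (c₁ c₂ C u : ℝ) (k : ℕ) : ℝ :=
  C * (u * Real.log u ^ c₁) * (Real.exp (-(c₂ / 2) * k) / (1 - Real.exp (-(c₂ / 2))))

/-- The inequalities between the parameters of one scale that make all error terms of the moment
computations at most `ε₀` in relative terms. Here `v = H ^ M`, `J = K H`, `T = (K + 2) y`. -/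
structure ScaleBounds (I : (p : ℕ) → Finset (ZMod p)) (B : ℕ) (NU Δ ε₀ z T : ℝ) (k ν : ℕ)
    (v J : ℝ) (Q : Finset ℕ) : Prop where
  pos : 0 < v
  le_sieve : v ≤ z
  one_le_floor : 1 ≤ ⌊J⌋₊
  collision : 20 * (B : ℝ) ^ 3 * (ν * ⌊J⌋₊ : ℕ) ^ 2 * (k + 1) / v ≤ ε₀
  diagonal : ((ν * ⌊J⌋₊ : ℕ) : ℝ) ^ 2 * Real.exp (2 * (ν * ⌊J⌋₊ : ℕ) * logLoss I v z)
    + Real.exp (1 + 8 * ((ν * ⌊J⌋₊ : ℕ) : ℝ) ^ 2 * B ^ 2 * logLoss I v z) + 9 ≤ ε₀ * T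
  crossing : ((ν * ⌊J⌋₊ : ℕ) : ℝ) ^ 2 * NU * Real.exp (2 * (ν * ⌊J⌋₊ : ℕ) * logLoss I v z)
    ≤ ε₀ * (Q.card / 2)
  overlap : ((ν * ⌊J⌋₊ : ℕ) : ℝ) ^ 2 * Δ ≤ ε₀ * (Q.card / 2)

/-- The constant 20 = 4 + 16 and the factors B³ and k + 1 let one condition dominate all four error
terms. -/
theorem le_collision {B L k : ℕ} {v ε₀ : ℝ} (hB : 1 ≤ B) (hL : 1 ≤ L) (hv : 0 < v)
    (h : 20 * (B : ℝ) ^ 3 * (L : ℕ) ^ 2 * (k + 1) / v ≤ ε₀) :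
    4 * B * (L : ℝ) ^ 2 * k / v + 16 * (L : ℝ) ^ 2 * B ^ 3 / v ≤ ε₀ ∧
      4 * B * (L : ℝ) ^ 2 * k / v ≤ ε₀ ∧ 4 * ((L : ℝ) * B) ^ 2 / v ≤ ε₀ ∧
      4 * B * (L : ℝ) ^ 2 / v ≤ ε₀ := by
  have hB1 : (1 : ℝ) ≤ B := by exact_mod_cast hB
  have hL1 : (1 : ℝ) ≤ L := by exact_mod_cast hL
  have hk : (0 : ℝ) ≤ k := Nat.cast_nonneg k
  have hB3 : (B : ℝ) ≤ B ^ 3 := by nlinarith [sq_nonneg ((B : ℝ) - 1)]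
  have hB2 : (B : ℝ) ^ 2 ≤ B ^ 3 := by nlinarith [sq_nonneg (B : ℝ)]
  have hL2 : 0 ≤ (L : ℝ) ^ 2 := by positivity
  have e1 : (B : ℝ) * L ^ 2 * k ≤ B ^ 3 * L ^ 2 * k := by gcongr
  have e2 : (B : ℝ) ^ 2 * L ^ 2 ≤ B ^ 3 * L ^ 2 := by gcongr
  have e3 : (B : ℝ) * L ^ 2 ≤ B ^ 3 * L ^ 2 := by gcongr
  have e4 : 0 ≤ (B : ℝ) ^ 3 * L ^ 2 * k := by positivity
  have e5 : 0 ≤ (B : ℝ) ^ 3 * L ^ 2 := by positivity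
  rw [div_le_iff₀ hv] at h
  refine ⟨?_, ?_, ?_, ?_⟩
  · rw [← add_div, div_le_iff₀ hv]; nlinarith
  · rw [div_le_iff₀ hv]; nlinarith
  · rw [div_le_iff₀ hv]; nlinarith
  · rw [div_le_iff₀ hv]; nlinarith

/-- Mean at least N(1 - ε₀) and second moment at most N²(1 + 2ε₀) plus a diagonal term, with N
within 1 of T: the leading terms cancel. The constant 14 is generous here; it is the one needed for
point variances. -/
theorem avgMod_modulus_variance_le {I : (p : ℕ) → Finset (ZMod p)} {B : ℕ}
    (h1 : ∀ p : ℕ, p.Prime → (I p).card ≤ p - 1) (hB : ∀ p : ℕ, p.Prime → (I p).card ≤ B)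
    (hB1 : 1 ≤ B) {a : ℕ → ℕ → ℤ} {NU Δ ε₀ z T : ℝ} {k ν : ℕ} {v J : ℝ} {Q : Finset ℕ}
    (hs : ScaleBounds I B NU Δ ε₀ z T k ν v J Q) (hν : 1 ≤ ν) (hε₁ : ε₀ ≤ 1) (hT : 1 ≤ T) {q : ℕ}
    (hqν : (I q).card = ν) (hg : IsGoodModulus I a v z J k q) {α β : ℤ} (hαβ : α ≤ β)
    (hN : T ≤ β - α) (hN' : (β - α : ℝ) ≤ T + 1) :
    avgMod (modulusIoc 0 z)
      (fun b => (∑ n ∈ Finset.Ioc α β, splitWeight I a v z J q b b n - T) ^ 2)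
      ≤ 14 * ε₀ * T ^ 2 := by
  set L : ℕ := ν * ⌊J⌋₊ with hL
  have hcard : (apIndex I J q).card = L := by rw [card_apIndex, hqν]
  have hL1 : 1 ≤ L := Nat.mul_pos hν hs.one_le_floor
  obtain ⟨c1, c2, c3, c4⟩ := le_collision hB1 hL1 hs.pos hs.collision
  have hv := hs.pos
  have hε₀ : 0 ≤ ε₀ := le_trans (by positivity) c2
  have hLv : 4 * (B : ℝ) * L ^ 2 ≤ v := by
    have := c4.trans hε₁
    rwa [div_le_one hv] at this
  have hlv : 2 * ((L : ℝ) * B) ≤ v := by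
    have hL1' : (1 : ℝ) ≤ L := by exact_mod_cast hL1
    have : (L : ℝ) * B ≤ B * L ^ 2 := by
      have : 0 ≤ (B : ℝ) := by positivity
      nlinarith [mul_nonneg this (by positivity : (0 : ℝ) ≤ L)]
    have h0 : 0 ≤ (L : ℝ) * B := by positivity
    linarith
  have m1 := le_avgMod_sum_splitWeight h1 hB a hv hs.le_sieve (J := J) (q := q)
    (l := (L : ℝ) * B) (by rw [hcard]) hlv hαβ
  have m2 := avgMod_sum_splitWeight_sq_le h1 hB hv hs.le_sieve hcard hL1 hLv hg hαβ
  refine (avgMod_sq_sub_le (modulusIoc_pos _ _) (by linarith) m1 m2).trans ?_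
  set N : ℝ := (β : ℝ) - α with hNdef
  set E₁ := Real.exp (4 * B * (L : ℝ) ^ 2 * k / v + 16 * L ^ 2 * B ^ 3 / v) with hE₁
  have hE₁le : E₁ ≤ 1 + 2 * ε₀ := by
    refine (exp_le_one_add_two_mul (by positivity) (c1.trans hε₁)).trans ?_
    linarith
  have hR : (L : ℝ) ^ 2 * Real.exp (2 * L * logLoss I v z)
      + Real.exp (4 * B * L ^ 2 * k / v + 8 * L ^ 2 * B ^ 2 * logLoss I v z) + 9 ≤ ε₀ * T := by
    refine le_trans ?_ hs.diagonal
    gcongr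
    exact c2.trans hε₁
  set R := (L : ℝ) ^ 2 * Real.exp (2 * L * logLoss I v z)
      + Real.exp (4 * B * L ^ 2 * k / v + 8 * L ^ 2 * B ^ 2 * logLoss I v z) with hRdef
  have hR0 : 0 ≤ R := by positivity
  set η := 4 * ((L : ℝ) * B) ^ 2 / v with hη
  have hT0 : 0 ≤ T := by linarith
  -- Rounding of the window gives N ≤ T + 1. The resulting excess 3T(1 + 2ε₀) ≤ 9T is what the 9 in
  -- `ScaleBounds.diagonal` absorbs.
  have hN2 : N ^ 2 ≤ T ^ 2 + 3 * T := by nlinarith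
  have s1 : N ^ 2 * E₁ ≤ (T ^ 2 + 3 * T) * (1 + 2 * ε₀) := by
    refine mul_le_mul hN2 hE₁le (Real.exp_nonneg _) (by positivity)
  have s2 : N * R ≤ 2 * T * R := by
    refine mul_le_mul_of_nonneg_right (by linarith) hR0
  have s3 : T * (1 - ε₀) ≤ N * (1 - η) := by
    refine mul_le_mul hN (by linarith) (by linarith) (by linarith)
  have s4 : 2 * T * (T * (1 - ε₀)) ≤ 2 * T * (N * (1 - η)) := by gcongr
  have s5 : 2 * T * (R + 9) ≤ 2 * T * (ε₀ * T) := by gcongr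
  have s6 : T * ε₀ ≤ T * 1 := by gcongr
  have s7 : 0 ≤ ε₀ * T ^ 2 := by positivity
  nlinarith

/-- The number of bad moduli decays like exp(-c₂k), faster than the tail `overlapTail`; so the bound
imposed for cross collisions covers them too. -/
theorem ScaleBounds.card_good_ge {I : (p : ℕ) → Finset (ZMod p)} {B : ℕ} {c₁ c₂ C : ℝ}
    (hc₂ : 0 < c₂) (hC : 0 ≤ C) (hov : OverlapBound I c₁ c₂ C) {u : ℝ} (hu : 10 ≤ u)
    {a : ℕ → ℕ → ℤ} (ha : IsEnumeration I a) {NU ε₀ z T : ℝ} {k ν : ℕ} {v J : ℝ} {Q : Finset ℕ}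
    (hs : ScaleBounds I B NU (overlapTail c₁ c₂ C u k) ε₀ z T k ν v J Q)
    (hQp : ∀ q ∈ Q, q.Prime) (hν : 1 ≤ ν) (hQν : ∀ q ∈ Q, (I q).card = ν)
    (hQu : ∀ q ∈ Q, ∀ t ∈ apIndex I J q, ∀ t' ∈ apIndex I J q,
      |((apOffset a q t - apOffset a q t' : ℤ) : ℝ)| ≤ u) :
    open Classical in (Q.card : ℝ) - ε₀ * (Q.card / 2)
      ≤ (Q.filter fun q => IsGoodModulus I a v z J k q).card := by
  classical
  have h2 := card_not_isGoodModulus_le hc₂ hC hov hu ha hQp hν hQν rfl hQu v z k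
  have h3 := Finset.card_filter_add_card_filter_not (s := Q) (fun q => IsGoodModulus I a v z J k q)
  have h4 : ((Q.filter fun q => IsGoodModulus I a v z J k q).card : ℝ)
      + (Q.filter fun q => ¬ IsGoodModulus I a v z J k q).card = Q.card := by exact_mod_cast h3
  have h5 : C * (u * Real.log u ^ c₁ * Real.exp (-c₂ * k)) ≤ overlapTail c₁ c₂ C u k := by
    have hlog : 0 ≤ u * Real.log u ^ c₁ := by
      have := Real.log_nonneg (by linarith : 1 ≤ u)
      have h2 : 0 ≤ u := by linarith
      positivity
    have hr1 : Real.exp (-(c₂ / 2)) < 1 := by rw [Real.exp_lt_one_iff]; linarith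
    have hr0 := Real.exp_pos (-(c₂ / 2))
    unfold overlapTail
    rw [← mul_assoc]
    refine mul_le_mul_of_nonneg_left ?_ (by positivity)
    rw [le_div_iff₀ (by linarith)]
    calc Real.exp (-c₂ * k) * (1 - Real.exp (-(c₂ / 2)))
        ≤ Real.exp (-c₂ * k) * 1 := by gcongr; linarith
      _ ≤ Real.exp (-(c₂ / 2) * k) := by
          rw [mul_one, Real.exp_le_exp]
          have : (0 : ℝ) ≤ k := Nat.cast_nonneg k
          nlinarith
  have h6 : ((ν * ⌊J⌋₊ : ℕ) : ℝ) ^ 2 * (C * (u * Real.log u ^ c₁ * Real.exp (-c₂ * k)))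
      ≤ ((ν * ⌊J⌋₊ : ℕ) : ℝ) ^ 2 * overlapTail c₁ c₂ C u k := by gcongr
  have h7 := hs.overlap
  linarith

/-- With μ = gj/σ₂ the three terms are σ₂μ² times 1 + 12ε₀, -2(1 - ε₀) and 1, which leaves 14ε₀. The
12 is 11 from (1 + 2ε₀)(1 + 3ε₀) ≤ 1 + 11ε₀ and 1 from the crossing pairs. -/
theorem point_variance_arith {g j σ₂ ε₀ Xc E Γ η : ℝ} (hd : 0 < σ₂) (hd1 : σ₂ ≤ 1)
    (hg0 : 0 ≤ g) (hj0 : 0 ≤ j) (hε₀ : 0 ≤ ε₀) (hε₁ : ε₀ ≤ 1) (hX1 : Xc ≤ ε₀ * g)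
    (hEle : E ≤ 1 + 2 * ε₀) (hΓ0 : 0 ≤ Γ) (hΓ1 : Γ ≤ g * (1 + 3 * ε₀)) (hη : η ≤ ε₀) :
    g * j ^ 2 * (Xc + 1 / σ₂ * E * Γ) - 2 * (g * j / σ₂) * (g * j * (1 - η))
      + (g * j / σ₂) ^ 2 * σ₂ ≤ σ₂ * (14 * ε₀ * (g * j / σ₂) ^ 2) := by
  have hEΓ : E * Γ ≤ g * (1 + 11 * ε₀) := by
    calc E * Γ ≤ (1 + 2 * ε₀) * (g * (1 + 3 * ε₀)) := by
          refine mul_le_mul hEle hΓ1 hΓ0 (by linarith)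
      _ = g * (1 + 5 * ε₀ + 6 * (ε₀ * ε₀)) := by ring
      _ ≤ g * (1 + 11 * ε₀) := by
          have : ε₀ * ε₀ ≤ ε₀ * 1 := by gcongr
          exact mul_le_mul_of_nonneg_left (by linarith) hg0
  have h2 : Xc + 1 / σ₂ * E * Γ ≤ 1 / σ₂ * (g * (1 + 12 * ε₀)) := by
    have h3 : Xc ≤ 1 / σ₂ * (ε₀ * g) := by
      refine hX1.trans ?_
      have : 1 ≤ 1 / σ₂ := by rw [one_le_div hd]; exact hd1
      have h4 : 0 ≤ ε₀ * g := by positivity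
      nlinarith
    have h4 : 1 / σ₂ * E * Γ ≤ 1 / σ₂ * (g * (1 + 11 * ε₀)) := by
      rw [mul_assoc]
      gcongr
    calc _ ≤ 1 / σ₂ * (ε₀ * g) + 1 / σ₂ * (g * (1 + 11 * ε₀)) := add_le_add h3 h4
      _ = _ := by ring
  have h5 : g * j ^ 2 * (Xc + 1 / σ₂ * E * Γ) ≤ g * j ^ 2 * (1 / σ₂ * (g * (1 + 12 * ε₀))) := by
    gcongr
  have h6 : 2 * (g * j / σ₂) * (g * j * (1 - ε₀)) ≤ 2 * (g * j / σ₂) * (g * j * (1 - η)) := by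
    gcongr
  refine (add_le_add (sub_le_sub h5 h6) le_rfl).trans (le_of_eq ?_)
  field_simp
  ring

theorem avgMod_point_variance_le {I : (p : ℕ) → Finset (ZMod p)} {B : ℕ}
    (h1 : ∀ p : ℕ, p.Prime → (I p).card ≤ p - 1) (hB : ∀ p : ℕ, p.Prime → (I p).card ≤ B)
    (hB1 : 1 ≤ B) {c₁ c₂ C : ℝ}
    (hc₂ : 0 < c₂) (hC : 0 ≤ C) (hov : OverlapBound I c₁ c₂ C) {u : ℝ} (hu : 10 ≤ u)
    {a : ℕ → ℕ → ℤ} (ha : IsEnumeration I a) {NU ε₀ z T : ℝ} {k ν i : ℕ} {v J : ℝ}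
    {Q G : Finset ℕ} (hs : ScaleBounds I B NU (overlapTail c₁ c₂ C u k) ε₀ z T k ν v J Q)
    (hε₁ : ε₀ ≤ 1) (hεc : ε₀ ≤ c₂ / 2)
    (hGp : ∀ q ∈ G, q.Prime) (hGν : ∀ q ∈ G, (I q).card = ν) (hi : i ∈ Finset.Icc 1 ν)
    (hGu : ∀ q ∈ G, ∀ t ∈ apIndex I J q, ∀ t' ∈ apIndex I J q,
      |((apOffset a q t - apOffset a q t' : ℤ) : ℝ)| ≤ u)
    (hGg : ∀ q ∈ G, IsGoodModulus I a v z J k q) (hGQ : (Q.card : ℝ) / 2 ≤ G.card)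
    (hNU0 : 0 ≤ NU)
    (hNU : ∀ m : ℤ, m ≠ 0 → |(m : ℝ)| ≤ u → ∀ Q : Finset ℕ, (∀ q ∈ Q, q.Prime ∧ InDiff I q m) →
      (Q.card : ℝ) ≤ NU) (n : ℤ) :
    avgMod (modulusIoc 0 z) (fun b => sieveInd I 0 z b n *
        (weightSum I a v z J i G b b n - G.card * ⌊J⌋₊ / densityIoc I v z) ^ 2)
      ≤ sieveProd I z * (14 * ε₀) * (G.card * ⌊J⌋₊ / densityIoc I v z) ^ 2 := by
  set L : ℕ := ν * ⌊J⌋₊ with hL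
  have hν : 1 ≤ ν := by rw [Finset.mem_Icc] at hi; omega
  have hL1 : 1 ≤ L := Nat.mul_pos hν hs.one_le_floor
  have hL1' : (1 : ℝ) ≤ L := by exact_mod_cast hL1
  obtain ⟨c1, c2, c3, c4⟩ := le_collision hB1 hL1 hs.pos hs.collision
  have hv := hs.pos
  have hε₀ : 0 ≤ ε₀ := le_trans (by positivity) c2
  have hLv : 4 * (B : ℝ) * L ^ 2 ≤ v := by
    have := c4.trans hε₁
    rwa [div_le_one hv] at this
  have hLL : (L : ℝ) * B ≤ B * L ^ 2 := by
    have : 0 ≤ (B : ℝ) := by positivity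
    nlinarith [mul_nonneg this (by positivity : (0 : ℝ) ≤ L)]
  have hlv : 2 * ((L : ℝ) * B) ≤ v := by
    have h0 : 0 ≤ (L : ℝ) * B := by positivity
    linarith
  have hd := densityIoc_pos h1 v z
  have hd1 := densityIoc_le_one h1 v z
  set g : ℝ := (G.card : ℝ) with hg
  have hg0 : 0 ≤ g := Nat.cast_nonneg _
  set Δ := overlapTail c₁ c₂ C u k with hΔ
  have hr1 : Real.exp (-(c₂ / 2)) < 1 := by rw [Real.exp_lt_one_iff]; linarith
  have hΔ0 : 0 ≤ Δ := by
    have := Real.log_nonneg (by linarith : 1 ≤ u)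
    have h2 : 0 ≤ u := by linarith
    have h3 : 0 < 1 - Real.exp (-(c₂ / 2)) := by linarith
    rw [hΔ]
    unfold overlapTail
    positivity
  set A : ℝ := 4 * B * (L : ℝ) ^ 2 / v with hA
  -- Moduli with at most k cross collisions, plus the tail. The tail is at most ε₀|G| because |Q|/2
  -- ≤ |G|.
  set Γ : ℝ := g * Real.exp (A * k) + Δ with hΓdef
  have hΓ0 : g ≤ Γ := by
    have : 1 ≤ Real.exp (A * k) := Real.one_le_exp (by positivity)
    have : g * 1 ≤ g * Real.exp (A * k) := by gcongr
    linarith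
  have hM₂ := fun b (hn : n ∈ sievedShift I 0 v b) =>
    avgMod_weightSum_sq_le h1 hB ha hv hGp hGν hi hL.symm hL1 (z := z) (by linarith) hGg hGu
      hNU0 hNU hΓ0 (fun m w hm hw => sum_exp_collisions_le hc₂ hC hov hu hGp
        (fun q hq => by rw [hGν q hq]; exact hν) hm hw (by positivity)
        (c4.trans hεc) k) hn
  refine (avgMod_sieveInd_mul_sq_le h1 hB a hv hs.le_sieve hGν hi hL.symm (le_refl ((L : ℝ) * B))
    hlv (by positivity) hM₂).trans ?_
  rw [← sieveProd_mul_densityIoc I hs.le_sieve, ← densityIoc_zero_left]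
  have hd0 := densityIoc_pos h1 0 v
  simp only [← hg]
  refine (?_ : _ ≤ densityIoc I 0 v * (densityIoc I v z *
    (14 * ε₀ * (g * ⌊J⌋₊ / densityIoc I v z) ^ 2))).trans_eq (by ring)
  refine mul_le_mul_of_nonneg_left ?_ hd0.le
  have hEle : Real.exp (4 * B * (L : ℝ) ^ 2 * k / v) ≤ 1 + 2 * ε₀ :=
    (exp_le_one_add_two_mul (by positivity) (c2.trans hε₁)).trans (by linarith)
  have hAk : Real.exp (A * k) = Real.exp (4 * B * (L : ℝ) ^ 2 * k / v) := by
    rw [hA]; congr 1; ring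
  have hε₀g : ε₀ * (Q.card / 2) ≤ ε₀ * g := mul_le_mul_of_nonneg_left hGQ hε₀
  have hΔ1 : Δ ≤ ε₀ * g := by
    have h2 : Δ ≤ (L : ℝ) ^ 2 * Δ := by
      have : (1 : ℝ) ≤ (L : ℝ) ^ 2 := by nlinarith
      nlinarith
    exact h2.trans (hs.overlap.trans hε₀g)
  have hΓ1 : Γ ≤ g * (1 + 3 * ε₀) := by
    have : g * Real.exp (A * k) ≤ g * (1 + 2 * ε₀) :=
      mul_le_mul_of_nonneg_left (hAk.trans_le hEle) hg0
    linarith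
  exact point_variance_arith hd hd1 hg0 (Nat.cast_nonneg _) hε₀ hε₁ (hs.crossing.trans hε₀g)
    hEle (hg0.trans hΓ0) hΓ1 c3

/-- Since 1 ≤ a ≤ q and q ≤ hq ≤ KHq ≤ Ky, all offsets lie in an interval of length Ky. -/
theorem abs_apOffset_sub_le {I : (p : ℕ) → Finset (ZMod p)} {a : ℕ → ℕ → ℤ}
    (ha : IsEnumeration I a) {q : ℕ} (hq : q.Prime) {y H K : ℝ} (hH : 0 < H) (hK : 0 < K)
    (hqH : (q : ℝ) ≤ y / H) {t t' : ℕ × ℕ} (ht : t ∈ apIndex I (K * H) q)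
    (ht' : t' ∈ apIndex I (K * H) q) :
    |((apOffset a q t - apOffset a q t' : ℤ) : ℝ)| ≤ K * y := by
  have hb : ∀ t ∈ apIndex I (K * H) q, (q : ℝ) ≤ apOffset a q t ∧
      (apOffset a q t : ℝ) ≤ q + K * y := by
    intro t ht
    simp only [apIndex, Finset.mem_product, Finset.mem_Icc] at ht
    have h1 := (ha q hq).1 t.1 ht.1
    rw [Set.mem_Icc] at h1
    have h2 : (1 : ℝ) ≤ a t.1 q := by exact_mod_cast h1.1
    have h3 : (a t.1 q : ℝ) ≤ q := by exact_mod_cast h1.2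
    have h4 : (1 : ℝ) ≤ t.2 := by exact_mod_cast ht.2.1
    have h5 : (t.2 : ℝ) ≤ K * H := (Nat.le_floor_iff (by positivity)).1 ht.2.2
    have hq0 : (0 : ℝ) ≤ q := Nat.cast_nonneg q
    have h6 : (t.2 : ℝ) * q ≤ K * y := by
      rw [le_div_iff₀ hH] at hqH
      calc (t.2 : ℝ) * q ≤ K * H * q := by gcongr
        _ = K * (q * H) := by ring
        _ ≤ K * y := by gcongr
    unfold apOffset
    push_cast
    constructor <;> nlinarith
  have h1 := hb t ht
  have h2 := hb t' ht'
  push_cast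
  rw [abs_le]
  constructor <;> linarith

/-! ### Choice of the shift -/

theorem ncard_inter_Icc (S : Set ℤ) (P : ℤ → Prop) (y : ℕ) (f : ℤ → ℝ)
    (hf : ∀ n, n ∈ S → P n → f n = 1) (hf0 : ∀ n, 0 ≤ f n) :
    ({n : ℤ | n ∈ S ∩ Set.Icc 1 (y : ℤ) ∧ P n}.ncard : ℝ) ≤ ∑ n ∈ Finset.Icc 1 (y : ℤ), f n := by
  classical
  have h1 : {n : ℤ | n ∈ S ∩ Set.Icc 1 (y : ℤ) ∧ P n}
      = ((Finset.Icc 1 (y : ℤ)).filter fun n => n ∈ S ∧ P n : Finset ℤ) := by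
    ext n
    simp only [Set.mem_ofPred_eq, Set.mem_inter_iff, Finset.coe_filter, Finset.mem_Icc,
      Set.mem_Icc]
    tauto
  rw [h1, Set.ncard_coe_finset, Finset.card_filter]
  push_cast
  refine Finset.sum_le_sum fun n _ => ?_
  split_ifs with h
  · exact (hf n h.1 h.2).ge
  · exact hf0 n

-- Markov's inequality for one combined quantity: the normalised size of the sieved set and the
-- normalised numbers of exceptional points have small total expectation, so a single shift controls
-- them all. The deviation bound for the moduli needs no probability, as it defines R.
set_option maxHeartbeats 1000000 in
theorem exists_shift_of_scaleBounds {I : (p : ℕ) → Finset (ZMod p)} {B : ℕ}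
    (h1 : ∀ p : ℕ, p.Prime → (I p).card ≤ p - 1) (hB : ∀ p : ℕ, p.Prime → (I p).card ≤ B)
    (hB1 : 1 ≤ B) {c₁ c₂ C : ℝ}
    (hc₂ : 0 < c₂) (hC : 0 ≤ C) (hov : OverlapBound I c₁ c₂ C)
    {δ ξ x K M : ℝ} (hξ : 1 < ξ) (hK : 0 < K) {NU ε₀ τ θ C' D : ℝ} {k : ℕ}
    (hu : 10 ≤ (K + 1) * (yOf δ x : ℝ))
    (𝒩 : Finset ℕ) (h𝒩 : ∀ ν ∈ 𝒩, 1 ≤ ν ∧ ν ≤ B)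
    (𝔥 : Finset ℝ) (h𝔥 : (𝔥 : Set ℝ) = scales δ ξ x)
    (Q : ℕ → ℝ → Finset ℕ) (hQ : ∀ ν H, (Q ν H : Set ℕ) = primesAt I δ ξ x H ν)
    (hs : ∀ ν ∈ 𝒩, ∀ H ∈ 𝔥, ScaleBounds I B NU (overlapTail c₁ c₂ C ((K + 1) * (yOf δ x : ℝ)) k)
      ε₀ (zOf δ x) ((K + 2) * (yOf δ x : ℝ)) k ν (H ^ M) (K * H) (Q ν H))
    (hε₀ : 0 ≤ ε₀) (hε₁ : ε₀ ≤ 1) (hεc : ε₀ ≤ c₂ / 2) (hτ : 0 < τ) (hτ1 : τ ≤ 1)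
    (hετ : ε₀ * C' ≤ τ)
    (hNU0 : 0 ≤ NU)
    (hNU : ∀ m : ℤ, m ≠ 0 → |(m : ℝ)| ≤ (K + 1) * (yOf δ x : ℝ) → ∀ Q : Finset ℕ,
      (∀ q ∈ Q, q.Prime ∧ InDiff I q m) → (Q.card : ℝ) ≤ NU)
    (C₂ : ℕ → ℝ)
    (hC₂ : ∀ ν ∈ 𝒩, ∑ H ∈ 𝔥, ((Q ν H).card : ℝ) * ⌊K * H⌋₊ / densityIoc I (H ^ M) (zOf δ x)
      = C₂ ν * ((K + 2) * (yOf δ x : ℝ)))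
    (hC₂' : ∀ ν ∈ 𝒩, C₂ ν ≤ C') (hθ : 0 ≤ θ)
    (hdθ : ∀ H ∈ 𝔥, densityIoc I (H ^ M) (zOf δ x) ≤ θ) (hD : 0 < D)
    (hexc : 4 * 𝔥.card * C' ^ 2 * (yOf δ x : ℝ) * sieveProd I (zOf δ x) * (14 * ε₀) / τ ^ 2
      + 2 * C' * (14 * ε₀) * θ * ((K + 2) * (yOf δ x : ℝ)) / τ ^ 3 ≤ D / (4 * (B : ℝ) ^ 2))
    {a : ℕ → ℕ → ℤ} (ha : IsEnumeration I a) :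
    ∃ (b : ℤ) (R : ℕ → Finset ℕ),
      (∀ ν ∈ 𝒩, (R ν : Set ℕ) ⊆ primesOfSize I δ ξ x ν) ∧
      ((sievedShift I 0 (zOf δ x) b ∩ Set.Icc 1 (yOf δ x : ℤ)).ncard : ℝ)
        ≤ 2 * sieveProd I (zOf δ x) * (yOf δ x : ℝ) ∧
      (∀ ν ∈ 𝒩, ∀ q ∈ R ν,
        |(∑ n ∈ Finset.Ioc ⌊-((K + 1) * (yOf δ x : ℝ))⌋ (yOf δ x : ℤ),
            weight I a b K M (zOf δ x) (scaleOf ξ (yOf δ x) q) q n)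
          - (K + 2) * (yOf δ x : ℝ)|
        ≤ τ * ((K + 2) * (yOf δ x : ℝ))) ∧
      (∀ ν ∈ 𝒩, ∀ i : ℕ, 1 ≤ i → i ≤ ν →
        ({n : ℤ | n ∈ sievedShift I 0 (zOf δ x) b ∩ Set.Icc 1 (yOf δ x : ℤ) ∧
          ¬ |(∑ q ∈ R ν, ∑ h ∈ Finset.Icc 1 ⌊K * scaleOf ξ (yOf δ x) q⌋₊,
                weight I a b K M (zOf δ x) (scaleOf ξ (yOf δ x) q) q
                  (n - a i q - (q : ℤ) * (h : ℤ)))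
              - C₂ ν * ((K + 2) * (yOf δ x : ℝ))|
            ≤ 2 * τ * ((K + 2) * (yOf δ x : ℝ))}.ncard : ℝ) ≤ D) := by
  classical
  set y : ℕ := yOf δ x with hy
  set z : ℝ := zOf δ x with hz
  set T : ℝ := (K + 2) * (y : ℝ) with hT
  set u : ℝ := (K + 1) * (y : ℝ) with hudef
  have hy0 : (0 : ℝ) < y := by
    by_contra! hneg
    have : (K + 1) * (y : ℝ) ≤ 0 := mul_nonpos_of_nonneg_of_nonpos (by linarith) hneg
    linarith
  have hTu : T = u + y := by rw [hT, hudef]; ring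
  have hT1 : 1 ≤ T := by linarith
  -- For integers, -u < n is the same as ⌊-u⌋ < n.
  set α : ℤ := ⌊-u⌋ with hα
  have hα1 : (α : ℝ) ≤ -u := Int.floor_le _
  have hα2 : -u < α + 1 := Int.lt_floor_add_one _
  have hαy : α ≤ (y : ℤ) := by
    have : (α : ℝ) ≤ y := by linarith
    exact_mod_cast this
  have hN : T ≤ ((y : ℤ) : ℝ) - α := by push_cast; linarith
  have hN' : ((y : ℤ) : ℝ) - α ≤ T + 1 := by push_cast; linarith
  -- facts about the scales
  have hscale : ∀ H ∈ 𝔥, ∃ j : ℕ, H = ξ ^ j := by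
    intro H hH
    have : H ∈ scales δ ξ x := by rw [← h𝔥]; exact hH
    exact this.1
  have hH1 : ∀ H ∈ 𝔥, 1 ≤ H := by
    intro H hH
    obtain ⟨j, rfl⟩ := hscale H hH
    exact one_le_pow₀ hξ.le
  have hQm : ∀ ν H q, q ∈ Q ν H ↔ q ∈ primesAt I δ ξ x H ν := by
    intro ν H q
    rw [← hQ ν H]
    rfl
  have hscaleOf : ∀ ν, ∀ H ∈ 𝔥, ∀ q ∈ Q ν H, scaleOf ξ y q = H := by
    intro ν H hH q hq
    obtain ⟨j, rfl⟩ := hscale H hH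
    rw [hQm] at hq
    exact scaleOf_eq hξ hq.1.pos hq.2.1 hq.2.2.1
  -- Goodness of a modulus does not involve the shift, so G is fixed before averaging.
  set G : ℕ → ℝ → Finset ℕ := fun ν H =>
    (Q ν H).filter fun q => IsGoodModulus I a (H ^ M) z (K * H) k q with hG
  have hGQ : ∀ ν H q, q ∈ G ν H → q ∈ Q ν H := fun ν H q hq => (Finset.mem_filter.1 hq).1
  have hdiff : ∀ ν, ∀ H ∈ 𝔥, ∀ q ∈ Q ν H, ∀ t ∈ apIndex I (K * H) q, ∀ t' ∈ apIndex I (K * H) q,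
      |((apOffset a q t - apOffset a q t' : ℤ) : ℝ)| ≤ u := by
    intro ν H hH q hq t ht t' ht'
    rw [hQm] at hq
    refine (abs_apOffset_sub_le ha hq.1 (by linarith [hH1 H hH]) hK hq.2.2.1 ht ht').trans ?_
    rw [hudef]; linarith
  have hGcard : ∀ ν ∈ 𝒩, ∀ H ∈ 𝔥,
      ((Q ν H).card : ℝ) - ε₀ * ((Q ν H).card / 2) ≤ (G ν H).card := by
    intro ν hν H hH
    exact (hs ν hν H hH).card_good_ge hc₂ hC hov hu ha (fun q hq => ((hQm _ _ _).1 hq).1)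
      (h𝒩 ν hν).1 (fun q hq => ((hQm _ _ _).1 hq).2.2.2) (hdiff ν H hH)
  let lam : ℝ → ℕ → ℤ → ℤ → ℝ := fun H q b n => splitWeight I a (H ^ M) z (K * H) q b b n
  let X : ℝ → ℕ → ℤ → ℝ := fun H q b => ∑ n ∈ Finset.Ioc α (y : ℤ), lam H q b n
  -- The further selection by the total weight does depend on the shift.
  let R : ℤ → ℕ → Finset ℕ := fun b ν =>
    𝔥.biUnion fun H => (G ν H).filter fun q => |X H q b - T| ≤ τ * T
  set μ : ℕ → ℝ → ℝ := fun ν H => ((G ν H).card : ℝ) * ⌊K * H⌋₊ / densityIoc I (H ^ M) z with hμ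
  let exc : ℕ → ℕ → ℤ → ℤ → ℝ := fun ν i b n => sieveInd I 0 z b n *
        if |∑ H ∈ 𝔥, ∑ q ∈ (G ν H).filter (fun q => |X H q b - T| ≤ τ * T),
            ∑ h ∈ Finset.Icc 1 ⌊K * H⌋₊, lam H q b (n - a i q - (q : ℤ) * (h : ℤ)) - C₂ ν * T|
          ≤ 2 * τ * T then 0 else 1
  have hσ := densityIoc_pos h1 0 z
  rw [densityIoc_zero_left] at hσ
  have hexc' : ∀ ν ∈ 𝒩, ∀ i ∈ Finset.Icc 1 ν, avgMod (modulusIoc 0 z)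
      (fun b => ∑ n ∈ Finset.Icc 1 (y : ℤ), exc ν i b n) ≤ D / (4 * (B : ℝ) ^ 2) := by
    intro ν hν i hi
    have hdpos : ∀ H, 0 < densityIoc I (H ^ M) z := fun H => densityIoc_pos h1 _ _
    have hμQ : ∀ H ∈ 𝔥, μ ν H
        ≤ ((Q ν H).card : ℝ) * ⌊K * H⌋₊ / densityIoc I (H ^ M) z := by
      intro H _
      simp only [hμ]
      have := hdpos H
      have : (G ν H).card ≤ (Q ν H).card := Finset.card_filter_le _ _
      gcongr
    have hμQ' : ∀ H ∈ 𝔥, ((Q ν H).card : ℝ) * ⌊K * H⌋₊ / densityIoc I (H ^ M) z - μ ν H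
        ≤ ε₀ / 2 * (((Q ν H).card : ℝ) * ⌊K * H⌋₊ / densityIoc I (H ^ M) z) := by
      intro H hH
      simp only [hμ]
      have hd := hdpos H
      have h2 := hGcard ν hν H hH
      have h3 : (⌊K * H⌋₊ : ℝ) / densityIoc I (H ^ M) z * (((Q ν H).card : ℝ) - (G ν H).card)
          ≤ (⌊K * H⌋₊ : ℝ) / densityIoc I (H ^ M) z * (ε₀ * ((Q ν H).card / 2)) := by
        refine mul_le_mul_of_nonneg_left (by linarith) (by positivity)
      refine le_trans (le_of_eq ?_) (h3.trans (le_of_eq ?_)) <;> ring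
    refine (avgMod_exceptional_le 𝔥 (G ν) (fun H => ⌊K * H⌋₊) lam
      (fun H q b n => splitWeight_nonneg h1 a _ _ _ q b b n) (fun b n => sieveInd I 0 z b n)
      (fun b n => by unfold sieveInd; positivity)
      (fun b n => by unfold sieveInd; split_ifs <;> norm_num) (fun q => a i q) α y y ?_
      (κ := 14 * ε₀) (σ := sieveProd I z) (C := C') (θ := θ) (μ ν) (by linarith) hτ hτ1
      (by linarith) hσ.le hθ ?_ ?_ ?_ ?_ ?_ ?_).trans hexc
    · intro H hH q hq h hh n hn
      have hq' := (hQm _ _ _).1 (hGQ _ _ _ hq)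
      have hqI := hq'.2.2.2
      have h2 := (ha q hq'.1).1 i (by rw [hqI]; simpa using hi)
      rw [Set.mem_Icc] at h2
      have hH1' := hH1 H hH
      have hH0 : 0 < H := by linarith
      have hqH : (q : ℝ) * H ≤ y := (le_div_iff₀ hH0).1 hq'.2.2.1
      have hqy : (q : ℝ) ≤ y := by
        have : (0 : ℝ) ≤ q := Nat.cast_nonneg q
        nlinarith
      rw [Finset.mem_Icc] at hh hn
      have h5 : (h : ℝ) ≤ K * H := (Nat.le_floor_iff (by positivity)).1 hh.2
      have h6 : (q : ℝ) * h ≤ K * y := by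
        calc (q : ℝ) * h ≤ q * (K * H) := by gcongr
          _ = K * (q * H) := by ring
          _ ≤ K * y := by gcongr
      have h7 : (a i q : ℝ) ≤ q := by exact_mod_cast h2.2
      have h8 : (1 : ℝ) ≤ n := by exact_mod_cast hn.1
      have h9 : (0 : ℤ) ≤ (q : ℤ) * h := by positivity
      rw [Finset.mem_Ioc]
      constructor
      · have : (α : ℝ) < ((n - a i q - (q : ℤ) * (h : ℤ) : ℤ) : ℝ) := by
          push_cast
          have : u = K * y + y := by rw [hudef]; ring
          linarith
        exact_mod_cast this
      · linarith [hn.2, h2.1]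
    · intro H _
      have := hdpos H
      simp only [hμ]
      positivity
    · intro H hH q hq
      have hq' := (hQm _ _ _).1 (hGQ _ _ _ hq)
      exact avgMod_modulus_variance_le h1 hB hB1 (hs ν hν H hH) (h𝒩 ν hν).1 hε₁ hT1 hq'.2.2.2
        (Finset.mem_filter.1 hq).2 hαy hN hN'
    · intro H hH n _
      have hGp : ∀ q ∈ G ν H, q ∈ primesAt I δ ξ x H ν := fun q hq =>
        (hQm _ _ _).1 (hGQ _ _ _ hq)
      exact avgMod_point_variance_le h1 hB hB1 hc₂ hC hov hu ha (hs ν hν H hH) hε₁ hεc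
        (fun q hq => (hGp q hq).1) (fun q hq => (hGp q hq).2.2.2) hi
        (fun q hq => hdiff ν H hH q (hGQ _ _ _ hq)) (fun q hq => (Finset.mem_filter.1 hq).2)
        (by
          have h2 := hGcard ν hν H hH
          have h3 : ε₀ * (((Q ν H).card : ℝ) / 2) ≤ 1 * (((Q ν H).card : ℝ) / 2) := by gcongr
          linarith) hNU0 hNU n
    · refine (Finset.sum_le_sum hμQ).trans ?_
      rw [hC₂ ν hν]
      exact mul_le_mul_of_nonneg_right (hC₂' ν hν) (by linarith)
    -- Replacing Q by G changes the expected value by at most ε₀C₂T/2 ≤ τT/2.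
    · rw [← hC₂ ν hν, abs_sub_comm, ← Finset.sum_sub_distrib,
        abs_of_nonneg (Finset.sum_nonneg fun H hH => sub_nonneg.2 (hμQ H hH))]
      refine (Finset.sum_le_sum hμQ').trans ?_
      rw [← Finset.mul_sum, hC₂ ν hν]
      have h2 : ε₀ * (C₂ ν) ≤ τ := le_trans (by gcongr; exact hC₂' ν hν) hετ
      calc ε₀ / 2 * (C₂ ν * T) = ε₀ * C₂ ν * T / 2 := by ring
        _ ≤ τ * T / 2 := by gcongr
    · intro H hH
      have hd := hdpos H
      have h2 : ((G ν H).card : ℝ) * ⌊K * H⌋₊ = densityIoc I (H ^ M) z * μ ν H := by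
        simp only [hμ]; field_simp
      rw [h2]
      refine mul_le_mul_of_nonneg_right (hdθ H hH) ?_
      simp only [hμ]
      positivity
  have hexc0 : ∀ ν i b n, 0 ≤ exc ν i b n := by
    intro ν i b n
    simp only [exc, sieveInd]
    positivity
  -- choice of the shift
  have hB0 : (0 : ℝ) < B := by exact_mod_cast hB1
  -- The first summand has mean 1/2. The second has mean at most 1/4, as there are at most B sizes
  -- with at most B indices each and each pair contributes at most D/(4B²). Hence both are at most 1
  -- for some b.
  obtain ⟨b, hb⟩ := exists_le_avgMod (modulusIoc_pos 0 z) (fun b =>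
    1 / (2 * sieveProd I z * y) * ∑ n ∈ Finset.Icc 1 (y : ℤ), sieveInd I 0 z b n
      + 1 / D * ∑ ν ∈ 𝒩, ∑ i ∈ Finset.Icc 1 ν, ∑ n ∈ Finset.Icc 1 (y : ℤ), exc ν i b n)
  have hb' : 1 / (2 * sieveProd I z * y) * ∑ n ∈ Finset.Icc 1 (y : ℤ), sieveInd I 0 z b n
      + 1 / D * ∑ ν ∈ 𝒩, ∑ i ∈ Finset.Icc 1 ν, ∑ n ∈ Finset.Icc 1 (y : ℤ), exc ν i b n ≤ 1 := by
    refine hb.trans ?_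
    rw [avgMod_add, avgMod_const_mul, avgMod_const_mul, avgMod_sum, avgMod_sum]
    simp only [avgMod_sieveInd, densityIoc_zero_left]
    rw [Finset.sum_const]
    have h2 : ∑ ν ∈ 𝒩, avgMod (modulusIoc 0 z) (fun b => ∑ i ∈ Finset.Icc 1 ν,
        ∑ n ∈ Finset.Icc 1 (y : ℤ), exc ν i b n) ≤ B * (B * (D / (4 * (B : ℝ) ^ 2))) := by
      have hc : (𝒩.card : ℝ) ≤ B := by
        have : 𝒩 ⊆ Finset.Icc 1 B := fun ν hν => Finset.mem_Icc.2 (h𝒩 ν hν)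
        have := Finset.card_le_card this
        simp only [Nat.card_Icc, add_tsub_cancel_right] at this
        exact_mod_cast this
      have h3 : ∀ ν ∈ 𝒩, avgMod (modulusIoc 0 z) (fun b => ∑ i ∈ Finset.Icc 1 ν,
        ∑ n ∈ Finset.Icc 1 (y : ℤ), exc ν i b n) ≤ B * (D / (4 * (B : ℝ) ^ 2)) := by
        intro ν hν
        rw [avgMod_sum]
        refine (sum_le_card_mul rfl fun i hi => hexc' ν hν i hi).trans ?_
        have : (((Finset.Icc 1 ν).card : ℕ) : ℝ) ≤ B := by
          simp only [Nat.card_Icc, add_tsub_cancel_right]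
          exact_mod_cast (h𝒩 ν hν).2
        gcongr
      refine (sum_le_card_mul rfl h3).trans ?_
      gcongr
    have h3 : (Finset.Icc 1 (y : ℤ)).card = y := by simp
    rw [h3, nsmul_eq_mul]
    have h4 : 1 / (2 * sieveProd I z * y) * (y * sieveProd I z) = 1 / 2 := by field_simp
    have h5 : 1 / D * (B * (B * (D / (4 * (B : ℝ) ^ 2)))) = 1 / 4 := by field_simp
    rw [h4]
    have h6 := mul_le_mul_of_nonneg_left h2 (by positivity : 0 ≤ 1 / D)
    rw [h5] at h6
    linarith
  have hcnt0 : 0 ≤ ∑ n ∈ Finset.Icc 1 (y : ℤ), sieveInd I 0 z b n :=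
    Finset.sum_nonneg fun n _ => by unfold sieveInd; positivity
  have hsum0 : 0 ≤ ∑ ν ∈ 𝒩, ∑ i ∈ Finset.Icc 1 ν, ∑ n ∈ Finset.Icc 1 (y : ℤ), exc ν i b n :=
    Finset.sum_nonneg fun ν _ => Finset.sum_nonneg fun i _ => Finset.sum_nonneg fun n _ =>
      hexc0 _ _ _ _
  have hdisj : ∀ ν, Set.PairwiseDisjoint (𝔥 : Set ℝ)
      fun H => (G ν H).filter fun q => |X H q b - T| ≤ τ * T := by
    intro ν H hH H' hH' hne
    refine Finset.disjoint_left.2 fun q hq hq' => hne ?_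
    rw [← hscaleOf ν H hH q (hGQ _ _ _ (Finset.mem_filter.1 hq).1),
      ← hscaleOf ν H' hH' q (hGQ _ _ _ (Finset.mem_filter.1 hq').1)]
  refine ⟨b, R b, ?_, ?_, ?_, ?_⟩
  · intro ν _ q hq
    obtain ⟨H, hH, hq⟩ := Finset.mem_biUnion.1 hq
    refine Set.mem_iUnion₂.2 ⟨H, ?_, (hQm _ _ _).1 (hGQ _ _ _ (Finset.mem_filter.1 hq).1)⟩
    rw [← h𝔥]
    exact hH
  · have h2 := ncard_inter_Icc (sievedShift I 0 z b) (fun _ => True) y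
      (fun n => sieveInd I 0 z b n) (fun n hn _ => if_pos hn)
      (fun n => by unfold sieveInd; positivity)
    simp only [and_true, Set.ofPred_mem_eq] at h2
    refine h2.trans ?_
    have h3 : 1 / (2 * sieveProd I z * y) * ∑ n ∈ Finset.Icc 1 (y : ℤ), sieveInd I 0 z b n ≤ 1 := by
      have : 0 ≤ 1 / D * ∑ ν ∈ 𝒩, ∑ i ∈ Finset.Icc 1 ν,
        ∑ n ∈ Finset.Icc 1 (y : ℤ), exc ν i b n := by positivity
      linarith
    rwa [one_div_mul_eq_div, div_le_one (by positivity)] at h3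
  · intro ν hν q hq
    obtain ⟨H, hH, hq⟩ := Finset.mem_biUnion.1 hq
    rw [Finset.mem_filter] at hq
    rw [hscaleOf ν H hH q (hGQ _ _ _ hq.1)]
    simp only [weight_eq_splitWeight h1 a b K M z H (hs ν hν H hH).le_sieve]
    exact hq.2
  · intro ν hν i hi1 hi2
    have hi : i ∈ Finset.Icc 1 ν := Finset.mem_Icc.2 ⟨hi1, hi2⟩
    refine (ncard_inter_Icc _ _ y (fun n => exc ν i b n) ?_ (hexc0 ν i b)).trans ?_
    · intro n hn hP
      have hRsum : ∑ q ∈ R b ν, ∑ h ∈ Finset.Icc 1 ⌊K * scaleOf ξ y q⌋₊,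
            weight I a b K M z (scaleOf ξ y q) q (n - a i q - (q : ℤ) * (h : ℤ))
          = ∑ H ∈ 𝔥, ∑ q ∈ (G ν H).filter (fun q => |X H q b - T| ≤ τ * T),
            ∑ h ∈ Finset.Icc 1 ⌊K * H⌋₊, lam H q b (n - a i q - (q : ℤ) * (h : ℤ)) := by
        rw [Finset.sum_biUnion (hdisj ν)]
        refine Finset.sum_congr rfl fun H hH => Finset.sum_congr rfl fun q hq => ?_
        rw [hscaleOf ν H hH q (hGQ _ _ _ (Finset.mem_filter.1 hq).1)]
        refine Finset.sum_congr rfl fun h _ => ?_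
        rw [weight_eq_splitWeight h1 a b K M z H (hs ν hν H hH).le_sieve]
      rw [hRsum] at hP
      simp only [exc, sieveInd]
      rw [if_pos hn, if_neg hP, one_mul]
    · have h2 : ∑ n ∈ Finset.Icc 1 (y : ℤ), exc ν i b n ≤ ∑ ν ∈ 𝒩, ∑ i ∈ Finset.Icc 1 ν,
          ∑ n ∈ Finset.Icc 1 (y : ℤ), exc ν i b n := by
        refine le_trans ?_ (Finset.single_le_sum (fun ν _ => Finset.sum_nonneg fun i _ =>
          Finset.sum_nonneg fun n _ => hexc0 ν i b n) hν)
        exact Finset.single_le_sum (f := fun i => ∑ n ∈ Finset.Icc 1 (y : ℤ), exc ν i b n)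
          (fun i _ => Finset.sum_nonneg fun n _ => hexc0 ν i b n) hi
      refine h2.trans ?_
      have h3 : 1 / D * ∑ ν ∈ 𝒩, ∑ i ∈ Finset.Icc 1 ν,
          ∑ n ∈ Finset.Icc 1 (y : ℤ), exc ν i b n ≤ 1 := by
        have : 0 ≤ 1 / (2 * sieveProd I z * y) *
          ∑ n ∈ Finset.Icc 1 (y : ℤ), sieveInd I 0 z b n := by positivity
        linarith
      rwa [one_div_mul_eq_div, div_le_one hD] at h3

/-! ### Asymptotics uniform over the scales -/

/-- The filter of pairs `(x, H)` with `x → ∞` and `H` a scale for `x`. -/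
def scaleFilter (δ ξ : ℝ) : Filter (ℝ × ℝ) :=
  comap Prod.fst atTop ⊓ 𝓟 {p | p.2 ∈ scales δ ξ p.1}

/-- A limit along this filter is a limit as x → ∞ uniform over all admissible H, so uniform
estimates can be combined by the usual limit calculus. -/
theorem eventually_scaleFilter {δ ξ : ℝ} {P : ℝ × ℝ → Prop} :
    (∀ᶠ p in scaleFilter δ ξ, P p) ↔ ∀ᶠ x in atTop, ∀ H ∈ scales δ ξ x, P (x, H) := by
  rw [scaleFilter, eventually_inf_principal, eventually_comap]
  refine eventually_congr (Eventually.of_forall fun x => ?_)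
  constructor
  · intro h H hH
    exact h (x, H) rfl hH
  · rintro h ⟨x', H⟩ rfl hH
    exact h H hH

theorem tendsto_fst_scaleFilter (δ ξ : ℝ) : Tendsto Prod.fst (scaleFilter δ ξ) atTop :=
  tendsto_comap.mono_left inf_le_left

theorem tendsto_log_log : Tendsto (fun x : ℝ => Real.log (Real.log x)) atTop atTop :=
  Real.tendsto_log_atTop.comp Real.tendsto_log_atTop

theorem tendsto_log_div_self : Tendsto (fun t : ℝ => Real.log t / t) atTop (𝓝 0) :=
  Real.isLittleO_log_id_atTop.tendsto_div_nhds_zero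

theorem tendsto_loglog_div_log :
    Tendsto (fun x : ℝ => Real.log (Real.log x) / Real.log x) atTop (𝓝 0) :=
  tendsto_log_div_self.comp Real.tendsto_log_atTop

theorem eventually_yOf_bounds {δ : ℝ} (hδ : 0 < δ) :
    ∀ᶠ x in atTop, x * Real.log x ^ δ ≤ yOf δ x ∧ (yOf δ x : ℝ) ≤ 2 * (x * Real.log x ^ δ) := by
  filter_upwards [eventually_ge_atTop 1, Real.tendsto_log_atTop.eventually_ge_atTop 1] with x hx ht
  have h1 : 1 ≤ Real.log x ^ δ := Real.one_le_rpow ht hδ.le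
  have h2 : 1 ≤ x * Real.log x ^ δ := one_le_mul_of_one_le_of_one_le hx h1
  refine ⟨Nat.le_ceil _, ?_⟩
  have := Nat.ceil_lt_add_one (by linarith : 0 ≤ x * Real.log x ^ δ)
  unfold yOf
  linarith

theorem tendsto_log_yOf_div {δ : ℝ} (hδ : 0 < δ) :
    Tendsto (fun x : ℝ => Real.log (yOf δ x) / Real.log x) atTop (𝓝 1) := by
  have hl := tendsto_loglog_div_log.const_mul δ
  have h2 : Tendsto (fun x : ℝ => Real.log 2 / Real.log x) atTop (𝓝 0) :=
    tendsto_const_nhds.div_atTop Real.tendsto_log_atTop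
  have hlow : Tendsto (fun x : ℝ => 1 + δ * (Real.log (Real.log x) / Real.log x)) atTop (𝓝 1) := by
    simpa using hl.const_add 1
  have hup : Tendsto (fun x : ℝ => Real.log 2 / Real.log x +
      (1 + δ * (Real.log (Real.log x) / Real.log x))) atTop (𝓝 1) := by
    simpa using h2.add hlow
  have key : ∀ᶠ x : ℝ in atTop, 0 < x ∧ 0 < Real.log x ∧
      Real.log (x * Real.log x ^ δ) = Real.log x + δ * Real.log (Real.log x) := by
    filter_upwards [eventually_gt_atTop 0, Real.tendsto_log_atTop.eventually_gt_atTop 0]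
      with x hx ht
    refine ⟨hx, ht, ?_⟩
    rw [Real.log_mul hx.ne' (by positivity), Real.log_rpow ht]
  refine tendsto_of_tendsto_of_tendsto_of_le_of_le' hlow hup ?_ ?_
  · filter_upwards [key, eventually_yOf_bounds hδ] with x ⟨hx, ht, he⟩ hy
    have h3 : Real.log (x * Real.log x ^ δ) ≤ Real.log (yOf δ x) :=
      Real.log_le_log (by positivity) hy.1
    rw [he] at h3
    rw [le_div_iff₀ ht]
    refine le_trans (le_of_eq ?_) h3
    field_simp
  · filter_upwards [key, eventually_yOf_bounds hδ] with x ⟨hx, ht, he⟩ hy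
    have hpos : 0 < x * Real.log x ^ δ := by positivity
    have h3 : Real.log (yOf δ x) ≤ Real.log (2 * (x * Real.log x ^ δ)) :=
      Real.log_le_log (lt_of_lt_of_le hpos hy.1) hy.2
    rw [Real.log_mul two_ne_zero hpos.ne', he] at h3
    rw [div_le_iff₀ ht]
    refine h3.trans (le_of_eq ?_)
    field_simp

theorem eventually_zOf_pos {δ : ℝ} (hδ : 0 < δ) : ∀ᶠ x in atTop, 0 < zOf δ x := by
  filter_upwards [eventually_yOf_bounds hδ, tendsto_log_log.eventually_gt_atTop 0,
    Real.tendsto_log_atTop.eventually_gt_atTop 0, eventually_gt_atTop 0] with x hy hl ht hx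
  have : 0 < (yOf δ x : ℝ) := lt_of_lt_of_le (by positivity) hy.1
  unfold zOf
  positivity

theorem tendsto_log_zOf_div {δ : ℝ} (hδ : 0 < δ) :
    Tendsto (fun x : ℝ => Real.log (zOf δ x) / Real.log x) atTop (𝓝 1) := by
  have h1 : Tendsto (fun x : ℝ => Real.log (Real.log (Real.log x)) / Real.log x) atTop (𝓝 0) := by
    have h2 : Tendsto (fun x : ℝ => Real.log (Real.log (Real.log x)) / Real.log (Real.log x) *
        (Real.log (Real.log x) / Real.log x)) atTop (𝓝 (0 * 0)) :=
      (tendsto_log_div_self.comp tendsto_log_log).mul tendsto_loglog_div_log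
    rw [mul_zero] at h2
    refine h2.congr' ?_
    filter_upwards [tendsto_log_log.eventually_gt_atTop 0] with x hl
    field_simp
  have h3 := ((tendsto_log_yOf_div hδ).add h1).sub (tendsto_loglog_div_log.const_mul (1 / 2))
  simp only [add_zero, mul_zero, sub_zero] at h3
  refine h3.congr' ?_
  filter_upwards [eventually_yOf_bounds hδ, tendsto_log_log.eventually_gt_atTop 0,
    Real.tendsto_log_atTop.eventually_gt_atTop 0, eventually_gt_atTop 0] with x hy hl ht hx
  have hy0 : 0 < (yOf δ x : ℝ) := lt_of_lt_of_le (by positivity) hy.1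
  unfold zOf
  rw [Real.log_div (by positivity) (by positivity), Real.log_mul hy0.ne' hl.ne', Real.log_rpow ht]
  ring

theorem tendsto_zOf {δ : ℝ} (hδ : 0 < δ) : Tendsto (zOf δ) atTop atTop := by
  have h1 : Tendsto (fun x : ℝ => Real.log (zOf δ x) / Real.log x * Real.log x) atTop atTop :=
    (tendsto_log_zOf_div hδ).pos_mul_atTop one_pos Real.tendsto_log_atTop
  have h2 := Real.tendsto_exp_atTop.comp h1
  refine h2.congr' ?_
  filter_upwards [eventually_zOf_pos hδ, Real.tendsto_log_atTop.eventually_gt_atTop 0] with x hz ht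
  simp only [Function.comp_apply]
  rw [div_mul_cancel₀ _ ht.ne', Real.exp_log hz]

/-- Size of the scales and position of the corresponding prime intervals. -/
theorem eventually_scales_bounds {δ ξ : ℝ} (hδ : 0 < δ) (hξ : 1 < ξ) :
    ∀ᶠ x in atTop, ∀ H ∈ scales δ ξ x, 2 * Real.log x ^ δ ≤ H ∧
      H ≤ Real.log x ^ (1 / 2 : ℝ) / Real.log (Real.log x) ∧ (yOf δ x : ℝ) / H ≤ x ∧
      zOf δ x ≤ (yOf δ x : ℝ) / (ξ * H) := by
  filter_upwards [eventually_yOf_bounds hδ, tendsto_log_log.eventually_gt_atTop 0,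
    Real.tendsto_log_atTop.eventually_gt_atTop 0, eventually_gt_atTop 0,
    eventually_zOf_pos hδ] with x hy hl ht hx hz
  rintro H ⟨-, h1, h2⟩
  have hy0 : 0 < (yOf δ x : ℝ) := lt_of_lt_of_le (by positivity) hy.1
  have hH : 2 * Real.log x ^ δ ≤ H := by
    refine le_trans ?_ h1
    rw [le_div_iff₀ hx]
    linarith [hy.1]
  have hH0 : 0 < H := lt_of_lt_of_le (by positivity) hH
  refine ⟨hH, ?_, ?_, ?_⟩
  · refine h2.trans ?_
    unfold zOf
    have h3 : (yOf δ x : ℝ) / (ξ * ((yOf δ x : ℝ) * Real.log (Real.log x) /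
        Real.log x ^ (1 / 2 : ℝ))) = 1 / ξ * (Real.log x ^ (1 / 2 : ℝ) / Real.log (Real.log x)) := by
      have hξ0 : ξ ≠ 0 := by positivity
      have : Real.log x ^ (1 / 2 : ℝ) ≠ 0 := by positivity
      field_simp
    rw [h3]
    have h4 : 1 / ξ ≤ 1 := by rw [div_le_one (by linarith)]; exact hξ.le
    exact mul_le_of_le_one_left (by positivity) h4
  · rw [div_le_iff₀ hx] at h1
    rw [div_le_iff₀ hH0]
    linarith
  · have hξ0 : 0 < ξ := by linarith
    rw [le_div_iff₀ (by positivity)] at h2 ⊢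
    linarith

theorem eventually_scaleFilter_bounds {δ ξ : ℝ} (hδ : 0 < δ) (hξ : 1 < ξ) :
    ∀ᶠ p in scaleFilter δ ξ, 2 * Real.log p.1 ^ δ ≤ p.2 ∧
      p.2 ≤ Real.log p.1 ^ (1 / 2 : ℝ) / Real.log (Real.log p.1) ∧ (yOf δ p.1 : ℝ) / p.2 ≤ p.1 ∧
      zOf δ p.1 ≤ (yOf δ p.1 : ℝ) / (ξ * p.2) :=
  eventually_scaleFilter.2 (eventually_scales_bounds hδ hξ)

theorem tendsto_snd_scaleFilter {δ ξ : ℝ} (hδ : 0 < δ) (hξ : 1 < ξ) :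
    Tendsto Prod.snd (scaleFilter δ ξ) atTop := by
  have h1 : Tendsto (fun p : ℝ × ℝ => Real.log p.1 ^ δ) (scaleFilter δ ξ) atTop :=
    (tendsto_rpow_atTop hδ).comp (Real.tendsto_log_atTop.comp (tendsto_fst_scaleFilter δ ξ))
  refine tendsto_atTop_mono' _ ?_ h1
  filter_upwards [eventually_scaleFilter_bounds hδ hξ,
    (Real.tendsto_log_atTop.comp (tendsto_fst_scaleFilter δ ξ)).eventually_ge_atTop 0] with p hp ht
  have : 0 ≤ Real.log p.1 ^ δ := Real.rpow_nonneg ht δ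
  linarith [hp.1]

/-- The primes `p ≤ w` in `A`, counted by `HasPrimeDensity`. -/
def primeCount (A : Set ℕ) (w : ℝ) : ℝ := ({p : ℕ | p.Prime ∧ (p : ℝ) ≤ w ∧ p ∈ A}.ncard : ℝ)

/-- As log z ~ log x, every w between z and x has log w ~ log x, so the density may be normalised by
log x at all scales. -/
theorem HasPrimeDensity.tendsto_window {A : Set ℕ} {r : ℝ} (h : HasPrimeDensity A r) {δ : ℝ}
    (hδ : 0 < δ) {l : Filter (ℝ × ℝ)} {w : ℝ × ℝ → ℝ} (hl : Tendsto Prod.fst l atTop)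
    (hw : ∀ᶠ p in l, zOf δ p.1 ≤ w p ∧ w p ≤ p.1) :
    Tendsto (fun p => primeCount A (w p) * Real.log p.1 / w p) l (𝓝 r) := by
  have hz : Tendsto (fun p : ℝ × ℝ => zOf δ p.1) l atTop := (tendsto_zOf hδ).comp hl
  have hwt : Tendsto w l atTop := tendsto_atTop_mono' _ (hw.mono fun p hp => hp.1) hz
  have h1 : Tendsto (fun p => primeCount A (w p) / (w p / Real.log (w p))) l (𝓝 r) := h.comp hwt
  have hlog : Tendsto (fun p => Real.log (w p) / Real.log p.1) l (𝓝 1) := by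
    refine tendsto_of_tendsto_of_tendsto_of_le_of_le' ((tendsto_log_zOf_div hδ).comp hl)
      tendsto_const_nhds ?_ ?_
    · filter_upwards [hw, hz.eventually_gt_atTop 0,
        (Real.tendsto_log_atTop.comp hl).eventually_gt_atTop 0] with p hp hzp ht
      have h2 := Real.log_le_log hzp hp.1
      simp only [Function.comp_apply] at ht ⊢
      gcongr
    · filter_upwards [hw, hwt.eventually_gt_atTop 0,
        (Real.tendsto_log_atTop.comp hl).eventually_gt_atTop 0] with p hp hwp ht
      simp only [Function.comp_apply] at ht
      rw [div_le_one ht]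
      exact Real.log_le_log hwp hp.2
  have h2 := h1.div hlog one_ne_zero
  rw [div_one] at h2
  refine h2.congr' ?_
  filter_upwards [hwt.eventually_gt_atTop 0,
    (Real.tendsto_log_atTop.comp hwt).eventually_gt_atTop 0] with p hwp hlp
  simp only [Function.comp_apply] at hlp
  simp only [Pi.div_apply]
  field_simp

open Classical in
/-- `𝒬_{H,ν}` as a finite set. -/
def primesAtFin (I : (p : ℕ) → Finset (ZMod p)) (δ ξ x H : ℝ) (ν : ℕ) : Finset ℕ :=
  (Finset.Icc 1 ⌊(yOf δ x : ℝ) / H⌋₊).filter (· ∈ primesAt I δ ξ x H ν)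

theorem coe_primesAtFin (I : (p : ℕ) → Finset (ZMod p)) (δ ξ x H : ℝ) (ν : ℕ) :
    (primesAtFin I δ ξ x H ν : Set ℕ) = primesAt I δ ξ x H ν := by
  classical
  ext q
  simp only [primesAtFin, Finset.coe_filter, Finset.mem_Icc, Set.mem_ofPred_eq]
  refine ⟨fun h => h.2, fun h => ⟨⟨h.1.one_le, ?_⟩, h⟩⟩
  exact (Nat.le_floor_iff' h.1.ne_zero).2 h.2.2.1

theorem finite_setOf_prime_le (A : Set ℕ) (w : ℝ) :
    {p : ℕ | p.Prime ∧ (p : ℝ) ≤ w ∧ p ∈ A}.Finite := by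
  refine (Set.finite_Icc 0 ⌊w⌋₊).subset fun p hp => ⟨Nat.zero_le _, ?_⟩
  exact (Nat.le_floor_iff' hp.1.ne_zero).2 hp.2.1

theorem card_primesAtFin (I : (p : ℕ) → Finset (ZMod p)) {δ ξ x H : ℝ} (hξ : 1 < ξ) (hH : 0 < H)
    (ν : ℕ) :
    ((primesAtFin I δ ξ x H ν).card : ℝ) = primeCount {p | (I p).card = ν} ((yOf δ x : ℝ) / H)
      - primeCount {p | (I p).card = ν} ((yOf δ x : ℝ) / (ξ * H)) := by
  have h1 : primesAt I δ ξ x H ν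
      = {p : ℕ | p.Prime ∧ (p : ℝ) ≤ (yOf δ x : ℝ) / H ∧ p ∈ {p | (I p).card = ν}} \
        {p : ℕ | p.Prime ∧ (p : ℝ) ≤ (yOf δ x : ℝ) / (ξ * H) ∧ p ∈ {p | (I p).card = ν}} := by
    ext q
    simp only [primesAt, Set.mem_ofPred_eq, Set.mem_sdiff, not_and]
    constructor
    · rintro ⟨a, b, c, d⟩
      exact ⟨⟨a, c, d⟩, fun _ h => absurd h (not_le.2 b)⟩
    · rintro ⟨⟨a, c, d⟩, h⟩
      exact ⟨a, not_le.1 fun h' => h a h' d, c, d⟩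
  have hsub : {p : ℕ | p.Prime ∧ (p : ℝ) ≤ (yOf δ x : ℝ) / (ξ * H) ∧ p ∈ {p | (I p).card = ν}} ⊆
      {p : ℕ | p.Prime ∧ (p : ℝ) ≤ (yOf δ x : ℝ) / H ∧ p ∈ {p | (I p).card = ν}} := by
    rintro q ⟨a, b, c⟩
    refine ⟨a, b.trans ?_, c⟩
    gcongr
    nlinarith
  rw [← Set.ncard_coe_finset, coe_primesAtFin, h1, primeCount, primeCount,
    ← Set.ncard_sdiff_add_ncard_of_subset hsub (finite_setOf_prime_le _ _)]
  push_cast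
  ring

/-- `|𝒬_{H,ν}| ~ ρ_ν (1 - 1/ξ) y / (H log x)` uniformly in the scale. -/
theorem tendsto_card_primesAtFin {I : (p : ℕ) → Finset (ZMod p)} {ν : ℕ} {r : ℝ}
    (h : HasPrimeDensity {p | (I p).card = ν} r) {δ ξ : ℝ} (hδ : 0 < δ) (hξ : 1 < ξ) :
    Tendsto (fun p : ℝ × ℝ => ((primesAtFin I δ ξ p.1 p.2 ν).card : ℝ) *
      (p.2 * Real.log p.1 / yOf δ p.1)) (scaleFilter δ ξ) (𝓝 (r * (1 - 1 / ξ))) := by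
  have hb := eventually_scaleFilter_bounds hδ hξ
  have hpos := (tendsto_snd_scaleFilter hδ hξ).eventually_gt_atTop 0
  have hξ0 : 0 < ξ := by linarith
  have hmono : ∀ᶠ p in scaleFilter δ ξ,
      (yOf δ p.1 : ℝ) / (ξ * p.2) ≤ (yOf δ p.1 : ℝ) / p.2 := by
    filter_upwards [hpos] with p hp
    gcongr
    nlinarith
  have h1 := h.tendsto_window hδ (tendsto_fst_scaleFilter δ ξ)
    (w := fun p => (yOf δ p.1 : ℝ) / p.2) (by
      filter_upwards [hb, hmono] with p hp hm using ⟨hp.2.2.2.trans hm, hp.2.2.1⟩)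
  have h2 := h.tendsto_window hδ (tendsto_fst_scaleFilter δ ξ)
    (w := fun p => (yOf δ p.1 : ℝ) / (ξ * p.2)) (by
      filter_upwards [hb, hmono] with p hp hm using ⟨hp.2.2.2, hm.trans hp.2.2.1⟩)
  have h3 := h1.sub (h2.mul_const (1 / ξ))
  have h4 : r * (1 - 1 / ξ) = r - r * (1 / ξ) := by ring
  rw [h4]
  refine h3.congr' ?_
  filter_upwards [hpos] with p hp
  rw [card_primesAtFin I hξ hp]
  field_simp

theorem tendsto_loglog_fst (δ ξ : ℝ) :
    Tendsto (fun p : ℝ × ℝ => Real.log (Real.log p.1)) (scaleFilter δ ξ) atTop :=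
  tendsto_log_log.comp (tendsto_fst_scaleFilter δ ξ)

theorem tendsto_log_fst (δ ξ : ℝ) :
    Tendsto (fun p : ℝ × ℝ => Real.log p.1) (scaleFilter δ ξ) atTop :=
  Real.tendsto_log_atTop.comp (tendsto_fst_scaleFilter δ ξ)

theorem eventually_log_snd_bounds {δ ξ : ℝ} (hδ : 0 < δ) (hξ : 1 < ξ) :
    ∀ᶠ p in scaleFilter δ ξ, δ * Real.log (Real.log p.1) ≤ Real.log p.2 ∧
      Real.log p.2 ≤ 1 / 2 * Real.log (Real.log p.1) := by
  filter_upwards [eventually_scaleFilter_bounds hδ hξ,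
    (tendsto_snd_scaleFilter hδ hξ).eventually_gt_atTop 0,
    (tendsto_loglog_fst δ ξ).eventually_ge_atTop 1,
    (tendsto_log_fst δ ξ).eventually_gt_atTop 0] with p hp hH hl ht
  have htδ : 0 < Real.log p.1 ^ δ := by positivity
  constructor
  · rw [← Real.log_rpow ht]
    exact Real.log_le_log htδ (by linarith [hp.1])
  · rw [← Real.log_rpow ht]
    refine Real.log_le_log hH (hp.2.1.trans ?_)
    exact div_le_self (by positivity) hl

/-- H is at most a power of log x, whereas log z ~ log x. -/
theorem eventually_rpow_snd_le_zOf {δ ξ M : ℝ} (hδ : 0 < δ) (hξ : 1 < ξ) (hM : 0 < M) :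
    ∀ᶠ p in scaleFilter δ ξ, p.2 ^ M ≤ zOf δ p.1 := by
  have hz := (tendsto_log_zOf_div hδ).comp (tendsto_fst_scaleFilter δ ξ)
  have hl := tendsto_loglog_div_log.comp (tendsto_fst_scaleFilter δ ξ)
  have h1 : (0 : ℝ) < 1 / M := by positivity
  filter_upwards [eventually_log_snd_bounds hδ hξ,
    (tendsto_snd_scaleFilter hδ hξ).eventually_gt_atTop 0,
    (tendsto_log_fst δ ξ).eventually_gt_atTop 0,
    hz.eventually_const_lt (show (1 / 2 : ℝ) < 1 by norm_num), hl.eventually_lt_const h1,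
    (tendsto_fst_scaleFilter δ ξ).eventually (eventually_zOf_pos hδ)] with p hp hH ht hz hl hz0
  simp only [Function.comp_apply] at hz hl
  rw [lt_div_iff₀ ht] at hz
  rw [div_lt_iff₀ ht] at hl
  rw [← Real.log_le_log_iff (by positivity) hz0, Real.log_rpow hH]
  calc M * Real.log p.2 ≤ M * (1 / 2 * (1 / M * Real.log p.1)) := by
        refine mul_le_mul_of_nonneg_left ?_ hM.le
        linarith [hp.2]
    _ = 1 / 2 * Real.log p.1 := by field_simp
    _ ≤ _ := hz.le

theorem densityIoc_eq_div {I : (p : ℕ) → Finset (ZMod p)}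
    (h1 : ∀ p : ℕ, p.Prime → (I p).card ≤ p - 1) {v z : ℝ} (h : v ≤ z) :
    densityIoc I v z = sieveProd I z / sieveProd I v := by
  have h3 : sieveProd I v ≠ 0 := by
    rw [← densityIoc_zero_left]; exact (densityIoc_pos h1 _ _).ne'
  rw [eq_div_iff h3, mul_comm]
  exact sieveProd_mul_densityIoc I h

/-- The contribution of one scale to `C_{2,ν}`. -/
def scaleTerm (I : (p : ℕ) → Finset (ZMod p)) (δ ξ M K : ℝ) (ν : ℕ) (x H : ℝ) : ℝ :=
  ((primesAtFin I δ ξ x H ν).card : ℝ) * ⌊K * H⌋₊ / densityIoc I (H ^ M) (zOf δ x)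
    / ((K + 2) * (yOf δ x : ℝ))

/-- Here |Q| ~ ρ_ν(1 - 1/ξ)y/(H log x), ⌊KH⌋ ~ KH and, by Mertens, 1/σ₂ ~ log x/(M log H). -/
theorem tendsto_scaleTerm_mul_log {I : (p : ℕ) → Finset (ZMod p)}
    (h1 : ∀ p : ℕ, p.Prime → (I p).card ≤ p - 1) {C₁ : ℝ} (hC₁ : 0 < C₁)
    (hm : Tendsto (fun x : ℝ => sieveProd I x * Real.log x) atTop (𝓝 C₁)) {ν : ℕ} {r : ℝ}
    (h : HasPrimeDensity {p | (I p).card = ν} r) {δ ξ M K : ℝ} (hδ : 0 < δ) (hξ : 1 < ξ)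
    (hM : 0 < M) (hK : 0 < K) :
    Tendsto (fun p : ℝ × ℝ => scaleTerm I δ ξ M K ν p.1 p.2 * Real.log p.2) (scaleFilter δ ξ)
      (𝓝 (K * r * (1 - 1 / ξ) / ((K + 2) * M))) := by
  have hH := tendsto_snd_scaleFilter hδ hξ
  have hv : Tendsto (fun p : ℝ × ℝ => p.2 ^ M) (scaleFilter δ ξ) atTop :=
    (tendsto_rpow_atTop hM).comp hH
  have hz := (tendsto_zOf hδ).comp (tendsto_fst_scaleFilter δ ξ)
  have t1 := tendsto_card_primesAtFin h hδ hξ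
  have t2 : Tendsto (fun p : ℝ × ℝ => (⌊K * p.2⌋₊ : ℝ) / (K * p.2)) (scaleFilter δ ξ) (𝓝 1) :=
    tendsto_nat_floor_div_atTop.comp (hH.const_mul_atTop hK)
  have t3 := (hm.comp hv).div (hm.comp hz) hC₁.ne'
  have t4 := (tendsto_log_zOf_div hδ).comp (tendsto_fst_scaleFilter δ ξ)
  have t5 := ((((t1.mul t2).mul t3).mul t4).const_mul (K / ((K + 2) * M)))
  rw [div_self hC₁.ne'] at t5
  have he : K / ((K + 2) * M) * (r * (1 - 1 / ξ) * 1 * 1 * 1)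
      = K * r * (1 - 1 / ξ) / ((K + 2) * M) := by ring
  rw [he] at t5
  refine t5.congr' ?_
  filter_upwards [hH.eventually_gt_atTop 1, hz.eventually_gt_atTop 1,
    (tendsto_log_fst δ ξ).eventually_gt_atTop 0, eventually_rpow_snd_le_zOf hδ hξ hM,
    (tendsto_fst_scaleFilter δ ξ).eventually (eventually_yOf_bounds hδ),
    (tendsto_fst_scaleFilter δ ξ).eventually_gt_atTop 0] with p hH hz ht hvz hy hx
  simp only [Function.comp_apply] at hz
  have hy0 : 0 < (yOf δ p.1 : ℝ) := lt_of_lt_of_le (by positivity) hy.1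
  have hlz := Real.log_pos hz
  have hlH := Real.log_pos hH
  have hs1 : 0 < sieveProd I (zOf δ p.1) := by
    rw [← densityIoc_zero_left]; exact densityIoc_pos h1 _ _
  have hs2 : 0 < sieveProd I (p.2 ^ M) := by
    rw [← densityIoc_zero_left]; exact densityIoc_pos h1 _ _
  have hH0 : 0 < p.2 := by linarith
  simp only [Pi.div_apply, Function.comp_apply, scaleTerm]
  rw [densityIoc_eq_div h1 hvz, Real.log_rpow hH0]
  field_simp

/-! ### Sums over the scales and the constants C_{2,ν} -/

theorem sum_Icc_inv_eq_harmonic {m n : ℕ} (hmn : m ≤ n) :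
    ∑ j ∈ Finset.Icc m n, (1 : ℝ) / j = (harmonic n : ℝ) - harmonic m + 1 / m := by
  induction n, hmn using Nat.le_induction with
  | base => simp
  | succ n hmn ih =>
    rw [Finset.sum_Icc_succ_top (by omega), ih, harmonic_succ]
    push_cast
    ring

/-- Euler's constant cancels between the two harmonic numbers, and the logarithm of the ratio of the
endpoints remains. -/
theorem tendsto_sum_Icc_inv {ι : Type*} {l : Filter ι} {m n : ι → ℕ} {r : ℝ} (hr : 0 < r)
    (hm : Tendsto m l atTop) (hn : Tendsto n l atTop) (hmn : ∀ᶠ i in l, m i ≤ n i)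
    (hr' : Tendsto (fun i => (n i : ℝ) / m i) l (𝓝 r)) :
    Tendsto (fun i => ∑ j ∈ Finset.Icc (m i) (n i), (1 : ℝ) / j) l (𝓝 (Real.log r)) := by
  have h1 := Real.tendsto_harmonic_sub_log.comp hn
  have h2 := Real.tendsto_harmonic_sub_log.comp hm
  have h3 := (Real.continuousAt_log hr.ne').tendsto.comp hr'
  have h4 : Tendsto (fun i => 1 / (m i : ℝ)) l (𝓝 0) :=
    tendsto_one_div_atTop_nhds_zero_nat.comp hm
  have h5 := ((h1.sub h2).add h3).add h4
  simp only [sub_self, zero_add, add_zero] at h5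
  refine h5.congr' ?_
  filter_upwards [hmn, hm.eventually_ge_atTop 1] with i hi hi1
  have hm0 : (0 : ℝ) < m i := by exact_mod_cast hi1
  have hn0 : (0 : ℝ) < n i := by exact_mod_cast lt_of_lt_of_le hi1 hi
  simp only [Function.comp_apply]
  rw [sum_Icc_inv_eq_harmonic hi, Real.log_div hn0.ne' hm0.ne']
  ring

/-- The exponent of the lower end of the range of scales. -/
def scaleLow (δ ξ x : ℝ) : ℝ := Real.logb ξ (2 * (yOf δ x : ℝ) / x)

/-- The exponent of the upper end of the range of scales. -/
def scaleHigh (δ ξ x : ℝ) : ℝ := Real.logb ξ ((yOf δ x : ℝ) / (ξ * zOf δ x))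

open Classical in
/-- The set of scales as a finite set. -/
def scaleFin (δ ξ x : ℝ) : Finset ℝ :=
  (Finset.Icc ⌈scaleLow δ ξ x⌉₊ ⌊scaleHigh δ ξ x⌋₊).image fun j => ξ ^ j

/-- The quantity 2y/x lies between 2(log x)^δ and 4(log x)^δ. -/
theorem tendsto_scaleLow_div {δ ξ : ℝ} (hδ : 0 < δ) (hξ : 1 < ξ) :
    Tendsto (fun x => scaleLow δ ξ x / Real.log (Real.log x)) atTop (𝓝 (δ / Real.log ξ)) := by
  have hlξ := Real.log_pos hξ
  have h2 : ∀ c : ℝ, Tendsto (fun x : ℝ => (c / Real.log (Real.log x) + δ) / Real.log ξ) atTop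
      (𝓝 (δ / Real.log ξ)) := by
    intro c
    have := (((tendsto_const_nhds (x := c)).div_atTop tendsto_log_log).add_const δ).div_const
      (Real.log ξ)
    simpa using this
  have key : ∀ᶠ x in atTop, 0 < Real.log (Real.log x) ∧
      Real.log 2 + δ * Real.log (Real.log x) ≤ Real.log (2 * (yOf δ x : ℝ) / x) ∧
      Real.log (2 * (yOf δ x : ℝ) / x) ≤ 2 * Real.log 2 + δ * Real.log (Real.log x) := by
    filter_upwards [eventually_yOf_bounds hδ, tendsto_log_log.eventually_gt_atTop 0,
      Real.tendsto_log_atTop.eventually_gt_atTop 0, eventually_gt_atTop 0] with x hy hl ht hx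
    have hy0 : 0 < (yOf δ x : ℝ) := lt_of_lt_of_le (by positivity) hy.1
    have htδ : 0 < Real.log x ^ δ := by positivity
    refine ⟨hl, ?_, ?_⟩
    · rw [← Real.log_rpow ht, ← Real.log_mul two_ne_zero htδ.ne']
      refine Real.log_le_log (by positivity) ?_
      rw [le_div_iff₀ hx]
      linarith [hy.1]
    · have : 2 * Real.log 2 = Real.log 4 := by
        rw [show (4 : ℝ) = 2 ^ 2 by norm_num, Real.log_pow]; norm_num
      rw [this, ← Real.log_rpow ht, ← Real.log_mul (by norm_num) htδ.ne']
      refine Real.log_le_log (by positivity) ?_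
      rw [div_le_iff₀ hx]
      linarith [hy.2]
  refine tendsto_of_tendsto_of_tendsto_of_le_of_le' (h2 (Real.log 2)) (h2 (2 * Real.log 2)) ?_ ?_
  · filter_upwards [key] with x ⟨hl, h3, _⟩
    rw [scaleLow, Real.logb, div_div, mul_comm (Real.log ξ), ← div_div]
    refine div_le_div_of_nonneg_right ?_ hlξ.le
    rw [le_div_iff₀ hl]
    refine le_trans (le_of_eq ?_) h3
    field_simp
  · filter_upwards [key] with x ⟨hl, _, h3⟩
    rw [scaleLow, Real.logb, div_div, mul_comm (Real.log ξ), ← div_div]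
    refine div_le_div_of_nonneg_right ?_ hlξ.le
    rw [div_le_iff₀ hl]
    refine h3.trans (le_of_eq ?_)
    field_simp

/-- The quantity y/(ξz) equals (log x)^(1/2)/(ξ log log x). -/
theorem tendsto_scaleHigh_div {δ ξ : ℝ} (hδ : 0 < δ) (hξ : 1 < ξ) :
    Tendsto (fun x => scaleHigh δ ξ x / Real.log (Real.log x)) atTop
      (𝓝 (1 / 2 / Real.log ξ)) := by
  have hlξ := Real.log_pos hξ
  have h1 : Tendsto (fun x : ℝ => (1 / 2 - Real.log (Real.log (Real.log x)) /
      Real.log (Real.log x) - Real.log ξ / Real.log (Real.log x)) / Real.log ξ) atTop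
      (𝓝 ((1 / 2 - 0 - 0) / Real.log ξ)) :=
    ((tendsto_const_nhds.sub (tendsto_log_div_self.comp tendsto_log_log)).sub
      (tendsto_const_nhds.div_atTop tendsto_log_log)).div_const _
  rw [sub_zero, sub_zero] at h1
  refine h1.congr' ?_
  filter_upwards [eventually_yOf_bounds hδ, tendsto_log_log.eventually_gt_atTop 0,
      Real.tendsto_log_atTop.eventually_gt_atTop 0, eventually_gt_atTop 0] with x hy hl ht hx
  have hy0 : 0 < (yOf δ x : ℝ) := lt_of_lt_of_le (by positivity) hy.1
  have hξ0 : 0 < ξ := by linarith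
  have h3 : (yOf δ x : ℝ) / (ξ * zOf δ x)
      = Real.log x ^ (1 / 2 : ℝ) / (ξ * Real.log (Real.log x)) := by
    unfold zOf
    have : Real.log x ^ (1 / 2 : ℝ) ≠ 0 := by positivity
    field_simp
  rw [scaleHigh, Real.logb, h3, Real.log_div (by positivity) (by positivity),
    Real.log_mul hξ0.ne' hl.ne', Real.log_rpow ht]
  field_simp
  ring

theorem tendsto_of_tendsto_div_loglog {f : ℝ → ℝ} {c : ℝ} (hc : 0 < c)
    (h : Tendsto (fun x => f x / Real.log (Real.log x)) atTop (𝓝 c)) : Tendsto f atTop atTop := by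
  refine (h.pos_mul_atTop hc tendsto_log_log).congr' ?_
  filter_upwards [tendsto_log_log.eventually_gt_atTop 0] with x hl
  field_simp

theorem eventually_coe_scaleFin {δ ξ : ℝ} (hδ : 0 < δ) (hξ : 1 < ξ) :
    ∀ᶠ x in atTop, (scaleFin δ ξ x : Set ℝ) = scales δ ξ x := by
  have hlξ := Real.log_pos hξ
  filter_upwards [eventually_yOf_bounds hδ, Real.tendsto_log_atTop.eventually_gt_atTop 0,
    eventually_gt_atTop 0, eventually_zOf_pos hδ,
    (tendsto_of_tendsto_div_loglog (by positivity)
      (tendsto_scaleHigh_div hδ hξ)).eventually_ge_atTop 0] with x hy ht hx hz hhigh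
  have hy0 : 0 < (yOf δ x : ℝ) := lt_of_lt_of_le (by positivity) hy.1
  have hξ0 : 0 < ξ := by linarith
  have hj : ∀ j : ℕ, (⌈scaleLow δ ξ x⌉₊ ≤ j ∧ j ≤ ⌊scaleHigh δ ξ x⌋₊) ↔
      (2 * (yOf δ x : ℝ) / x ≤ ξ ^ j ∧ ξ ^ j ≤ (yOf δ x : ℝ) / (ξ * zOf δ x)) := by
    intro j
    refine and_congr ?_ ?_
    · rw [Nat.ceil_le, scaleLow, Real.logb_le_iff_le_rpow hξ (by positivity), Real.rpow_natCast]
    · rw [Nat.le_floor_iff hhigh, scaleHigh, Real.le_logb_iff_rpow_le hξ (by positivity),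
        Real.rpow_natCast]
  ext H
  simp only [scaleFin, Finset.coe_image, Set.mem_image, Finset.mem_coe, Finset.mem_Icc, scales,
    Set.mem_ofPred_eq]
  constructor
  · rintro ⟨j, h, rfl⟩
    exact ⟨⟨j, rfl⟩, (hj j).1 h⟩
  · rintro ⟨⟨j, rfl⟩, h⟩
    exact ⟨j, (hj j).2 h, rfl⟩

/-- With H = ξ^j the sum is a block of the harmonic series divided by log ξ, whose endpoints have
ratio tending to (1/2)/δ. The condition δ < 1/2 makes the block nonempty. -/
theorem tendsto_sum_inv_log_scaleFin {δ ξ : ℝ} (hδ : 0 < δ) (hδ2 : δ < 1 / 2) (hξ : 1 < ξ) :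
    Tendsto (fun x => ∑ H ∈ scaleFin δ ξ x, 1 / Real.log H) atTop
      (𝓝 (Real.log (1 / (2 * δ)) / Real.log ξ)) := by
  have hlξ := Real.log_pos hξ
  have hA := tendsto_scaleLow_div hδ hξ
  have hB := tendsto_scaleHigh_div hδ hξ
  have hA' := tendsto_of_tendsto_div_loglog (by positivity) hA
  have hB' := tendsto_of_tendsto_div_loglog (by positivity) hB
  have hm : Tendsto (fun x => ⌈scaleLow δ ξ x⌉₊) atTop atTop := tendsto_nat_ceil_atTop.comp hA'
  have hn : Tendsto (fun x => ⌊scaleHigh δ ξ x⌋₊) atTop atTop := tendsto_nat_floor_atTop.comp hB'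
  have hmr : Tendsto (fun x => (⌈scaleLow δ ξ x⌉₊ : ℝ) / scaleLow δ ξ x) atTop (𝓝 1) :=
    tendsto_nat_ceil_div_atTop.comp hA'
  have hnr : Tendsto (fun x => (⌊scaleHigh δ ξ x⌋₊ : ℝ) / scaleHigh δ ξ x) atTop (𝓝 1) :=
    tendsto_nat_floor_div_atTop.comp hB'
  have hratio : Tendsto (fun x => (⌊scaleHigh δ ξ x⌋₊ : ℝ) / ⌈scaleLow δ ξ x⌉₊) atTop
      (𝓝 (1 / (2 * δ))) := by
    have h1 := (hnr.mul hB).div (hmr.mul hA) (by positivity)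
    have h2 : 1 * (1 / 2 / Real.log ξ) / (1 * (δ / Real.log ξ)) = 1 / (2 * δ) := by field_simp
    rw [h2] at h1
    refine h1.congr' ?_
    filter_upwards [hA'.eventually_gt_atTop 0, hB'.eventually_gt_atTop 0,
      hm.eventually_ge_atTop 1, tendsto_log_log.eventually_gt_atTop 0] with x ha hb hm1 hl
    simp only [Pi.div_apply]
    have : (0 : ℝ) < ⌈scaleLow δ ξ x⌉₊ := by exact_mod_cast hm1
    field_simp
  have hmn : ∀ᶠ x in atTop, ⌈scaleLow δ ξ x⌉₊ ≤ ⌊scaleHigh δ ξ x⌋₊ := by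
    have : (1 : ℝ) < 1 / (2 * δ) := by rw [lt_div_iff₀ (by positivity)]; linarith
    filter_upwards [hratio.eventually_const_lt this, hm.eventually_ge_atTop 1] with x h1 hm1
    have h2 : (0 : ℝ) < ⌈scaleLow δ ξ x⌉₊ := by exact_mod_cast hm1
    rw [lt_div_iff₀ h2, one_mul] at h1
    exact_mod_cast h1.le
  have h1 := (tendsto_sum_Icc_inv (by positivity) hm hn hmn hratio).div_const (Real.log ξ)
  refine h1.congr fun x => ?_
  rw [scaleFin, Finset.sum_image, Finset.sum_div]
  · refine Finset.sum_congr rfl fun j _ => ?_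
    rw [Real.log_pow, div_div]
  · intro j _ j' _ h
    exact (pow_right_injective₀ (by linarith) hξ.ne') h

/-- `C_{2,ν}(x)`. -/
def scaleConst (I : (p : ℕ) → Finset (ZMod p)) (δ ξ M K : ℝ) (ν : ℕ) (x : ℝ) : ℝ :=
  ∑ H ∈ scaleFin δ ξ x, scaleTerm I δ ξ M K ν x H

/-- The asymptotics of the terms are uniform in H and the sum of 1/log H stays bounded, so the sum
may be replaced term by term. -/
theorem tendsto_scaleConst {I : (p : ℕ) → Finset (ZMod p)}
    (h1 : ∀ p : ℕ, p.Prime → (I p).card ≤ p - 1) {C₁ : ℝ} (hC₁ : 0 < C₁)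
    (hm : Tendsto (fun x : ℝ => sieveProd I x * Real.log x) atTop (𝓝 C₁)) {ν : ℕ} {r : ℝ}
    (h : HasPrimeDensity {p | (I p).card = ν} r) {δ ξ M K : ℝ} (hδ : 0 < δ) (hδ2 : δ < 1 / 2)
    (hξ : 1 < ξ) (hM : 0 < M) (hK : 0 < K) :
    Tendsto (scaleConst I δ ξ M K ν) atTop
      (𝓝 (K * r / ((K + 2) * M) * ((1 - 1 / ξ) / Real.log ξ) * Real.log (1 / (2 * δ)))) := by
  have hterm := tendsto_scaleTerm_mul_log h1 hC₁ hm h hδ hξ hM hK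
  have hsum := tendsto_sum_inv_log_scaleFin hδ hδ2 hξ
  set c := K * r * (1 - 1 / ξ) / ((K + 2) * M) with hc
  set S := Real.log (1 / (2 * δ)) / Real.log ξ with hS
  have he : K * r / ((K + 2) * M) * ((1 - 1 / ξ) / Real.log ξ) * Real.log (1 / (2 * δ))
      = c * S := by rw [hc, hS]; ring
  rw [he]
  have hdiff : Tendsto (fun x => scaleConst I δ ξ M K ν x
      - c * ∑ H ∈ scaleFin δ ξ x, 1 / Real.log H) atTop (𝓝 0) := by
    rw [Metric.tendsto_nhds]
    intro η hη
    have hS1 : 0 < |S| + 1 := by positivity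
    have h2 := (Metric.tendsto_nhds.1 hterm) (η / (|S| + 1)) (by positivity)
    have h3 := (tendsto_snd_scaleFilter hδ hξ).eventually_gt_atTop 1
    filter_upwards [eventually_scaleFilter.1 (h2.and h3), eventually_coe_scaleFin hδ hξ,
      hsum.eventually_lt_const (show S < |S| + 1 by linarith [le_abs_self S])] with x hx hfin hsx
    rw [Real.dist_eq, sub_zero, scaleConst, Finset.mul_sum, ← Finset.sum_sub_distrib]
    have hb : ∀ H ∈ scaleFin δ ξ x, |scaleTerm I δ ξ M K ν x H - c * (1 / Real.log H)|
        ≤ η / (|S| + 1) * (1 / Real.log H) := by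
      intro H hH
      have hH' : H ∈ scales δ ξ x := by rw [← hfin]; exact hH
      obtain ⟨h4, h5⟩ := hx H hH'
      have hl : 0 < Real.log H := Real.log_pos h5
      rw [Real.dist_eq] at h4
      have h6 : scaleTerm I δ ξ M K ν x H - c * (1 / Real.log H)
          = (scaleTerm I δ ξ M K ν x H * Real.log H - c) * (1 / Real.log H) := by field_simp
      rw [h6, abs_mul, abs_of_pos (by positivity : 0 < 1 / Real.log H)]
      exact mul_le_mul_of_nonneg_right h4.le (by positivity)
    refine lt_of_le_of_lt ((Finset.abs_sum_le_sum_abs _ _).trans (Finset.sum_le_sum hb)) ?_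
    rw [← Finset.mul_sum]
    calc η / (|S| + 1) * ∑ H ∈ scaleFin δ ξ x, 1 / Real.log H < η / (|S| + 1) * (|S| + 1) := by
          gcongr
      _ = η := by field_simp
  have := hdiff.add (hsum.const_mul c)
  rw [zero_add] at this
  refine this.congr fun x => ?_
  ring

/-! ### Size of the density σ₂ at a scale -/

theorem tendsto_densityIoc_rpow_snd {I : (p : ℕ) → Finset (ZMod p)}
    (h1 : ∀ p : ℕ, p.Prime → (I p).card ≤ p - 1) {C₁ : ℝ} (hC₁ : 0 < C₁)
    (hm : Tendsto (fun x : ℝ => sieveProd I x * Real.log x) atTop (𝓝 C₁)) {δ ξ M : ℝ}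
    (hδ : 0 < δ) (hξ : 1 < ξ) (hM : 0 < M) :
    Tendsto (fun p : ℝ × ℝ => densityIoc I (p.2 ^ M) (zOf δ p.1) *
      (Real.log p.1 / Real.log p.2)) (scaleFilter δ ξ) (𝓝 M) := by
  have hH := tendsto_snd_scaleFilter hδ hξ
  have hv : Tendsto (fun p : ℝ × ℝ => p.2 ^ M) (scaleFilter δ ξ) atTop :=
    (tendsto_rpow_atTop hM).comp hH
  have hz := (tendsto_zOf hδ).comp (tendsto_fst_scaleFilter δ ξ)
  have t3 := (hm.comp hz).div (hm.comp hv) hC₁.ne'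
  have t4 := ((tendsto_log_zOf_div hδ).comp (tendsto_fst_scaleFilter δ ξ)).inv₀ one_ne_zero
  have t5 := (t3.mul t4).const_mul M
  rw [div_self hC₁.ne', inv_one, mul_one, mul_one] at t5
  refine t5.congr' ?_
  filter_upwards [hH.eventually_gt_atTop 1, hz.eventually_gt_atTop 1,
    (tendsto_log_fst δ ξ).eventually_gt_atTop 0, eventually_rpow_snd_le_zOf hδ hξ hM]
    with p hH hz ht hvz
  simp only [Function.comp_apply] at hz
  have hlz := Real.log_pos hz
  have hlH := Real.log_pos hH
  have hs2 : 0 < sieveProd I (p.2 ^ M) := by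
    rw [← densityIoc_zero_left]; exact densityIoc_pos h1 _ _
  have hH0 : 0 < p.2 := by linarith
  simp only [Pi.div_apply, Function.comp_apply]
  rw [densityIoc_eq_div h1 hvz, Real.log_rpow hH0]
  field_simp

/-- Both bounds follow from σ₂ ~ M log H/log x: the lower one uses log H ≥ 2/M, the upper one log H
≤ (1/2) log log x. -/
theorem eventually_densityIoc_bounds {I : (p : ℕ) → Finset (ZMod p)}
    (h1 : ∀ p : ℕ, p.Prime → (I p).card ≤ p - 1) {C₁ : ℝ} (hC₁ : 0 < C₁)
    (hm : Tendsto (fun x : ℝ => sieveProd I x * Real.log x) atTop (𝓝 C₁)) {δ ξ M : ℝ}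
    (hδ : 0 < δ) (hξ : 1 < ξ) (hM : 0 < M) :
    ∀ᶠ p in scaleFilter δ ξ,
      logLoss I (p.2 ^ M) (zOf δ p.1) ≤ Real.log (Real.log p.1) ∧
      densityIoc I (p.2 ^ M) (zOf δ p.1) ≤ M * Real.log (Real.log p.1) / Real.log p.1 := by
  have ht := tendsto_densityIoc_rpow_snd h1 hC₁ hm hδ hξ hM
  filter_upwards [ht.eventually (lt_mem_nhds (half_lt_self hM)),
    ht.eventually (gt_mem_nhds (by linarith : M < 2 * M)),
    (tendsto_log_fst δ ξ).eventually_gt_atTop 0, eventually_log_snd_bounds hδ hξ,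
    (Real.tendsto_log_atTop.comp (tendsto_snd_scaleFilter hδ hξ)).eventually_ge_atTop (2 / M)]
    with p hp1 hp2 ht hl hH
  simp only [Function.comp_apply] at hH
  have hlH : 0 < Real.log p.2 := lt_of_lt_of_le (by positivity) hH
  rw [div_le_iff₀ hM] at hH
  set d := densityIoc I (p.2 ^ M) (zOf δ p.1)
  rw [mul_div_assoc', lt_div_iff₀ hlH] at hp1
  rw [mul_div_assoc', div_lt_iff₀ hlH] at hp2
  have hd : 1 / Real.log p.1 ≤ d := by rw [div_le_iff₀ ht]; linarith
  constructor
  · have := Real.log_le_log (by positivity) hd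
    rw [Real.log_div one_ne_zero ht.ne', Real.log_one] at this
    change -Real.log d ≤ _
    linarith
  · rw [le_div_iff₀ ht]
    nlinarith

/-! ### Parameter inequalities, with t standing for log x -/

theorem eventually_mul_rpow_le_exp (c a : ℝ) {b : ℝ} (hb : 0 < b) :
    ∀ᶠ t : ℝ in atTop, c * t ^ a ≤ Real.exp (b * t) := by
  have h := (isLittleO_rpow_exp_pos_mul_atTop a hb).bound
    (show (0 : ℝ) < 1 / (|c| + 1) by positivity)
  filter_upwards [h, eventually_gt_atTop 0] with t ht ht0
  rw [Real.norm_of_nonneg (by positivity), Real.norm_of_nonneg (by positivity),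
    div_mul_eq_mul_div, one_mul, le_div_iff₀ (by positivity)] at ht
  have : 0 ≤ t ^ a := by positivity
  nlinarith [le_abs_self c]

theorem eventually_mul_log_add_le_rpow (c d : ℝ) {b : ℝ} (hb : 0 < b) :
    ∀ᶠ t : ℝ in atTop, c * Real.log t + d ≤ t ^ b := by
  have h := (isLittleO_log_rpow_atTop hb).bound
    (show (0 : ℝ) < 1 / (2 * (|c| + 1)) by positivity)
  filter_upwards [h, eventually_ge_atTop 1, (tendsto_rpow_atTop hb).eventually_ge_atTop (2 * d)]
    with t ht ht0 htd
  have hl := Real.log_nonneg ht0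
  rw [Real.norm_of_nonneg hl, Real.norm_of_nonneg (by positivity),
    div_mul_eq_mul_div, one_mul, le_div_iff₀ (by positivity)] at ht
  nlinarith [le_abs_self c]

/-- L² costs H² out of H^M, and the remaining H^(M-2) ≥ t^(δ(M-2)) yields the saving t^(-a). The
factor k + 1 is absorbed by the slack δ(M-2) - a. -/
theorem scale_collision_bound {t H δ M a b c : ℝ} {L k : ℕ} (ht : 1 ≤ t)
    (hH : t ^ δ ≤ H) (hM : 2 ≤ M) (hc : 0 ≤ c) (hL : (L : ℝ) ≤ b * H)
    (hk : c * b ^ 2 * (k + 1) ≤ t ^ (δ * (M - 2) - a)) :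
    c * (L : ℝ) ^ 2 * (k + 1) / H ^ M ≤ t ^ (-a) := by
  have ht0 : 0 < t := by linarith
  have hH0 : 0 < H := lt_of_lt_of_le (by positivity) hH
  have h1 : H ^ M = H ^ 2 * H ^ (M - 2) := by
    rw [← Real.rpow_natCast H 2, ← Real.rpow_add hH0]; norm_num
  have h2 : t ^ (δ * (M - 2)) ≤ H ^ (M - 2) := by
    rw [Real.rpow_mul ht0.le]
    exact Real.rpow_le_rpow (by positivity) hH (by linarith)
  have h3 : (L : ℝ) ^ 2 ≤ (b * H) ^ 2 := by gcongr
  have h4 : t ^ (-a) * t ^ (δ * (M - 2)) = t ^ (δ * (M - 2) - a) := by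
    rw [← Real.rpow_add ht0]; ring_nf
  rw [div_le_iff₀ (by positivity), h1]
  calc c * (L : ℝ) ^ 2 * (k + 1) ≤ c * (b * H) ^ 2 * (k + 1) := by gcongr
    _ = H ^ 2 * (c * b ^ 2 * (k + 1)) := by ring
    _ ≤ H ^ 2 * (t ^ (-a) * t ^ (δ * (M - 2))) := by rw [h4]; gcongr
    _ ≤ H ^ 2 * (t ^ (-a) * H ^ (M - 2)) := by gcongr
    _ = t ^ (-a) * (H ^ 2 * H ^ (M - 2)) := by ring

/-- The upper limit on H gives H² ≤ t/(log t)², so L² log(1/σ₂) is at most of order t/log t and all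
exponentials of this size are small powers of x. The factor log log x in z serves this purpose. -/
theorem scale_exponent_bounds {t H b Λ : ℝ} {L B : ℕ} (ht : 200 ≤ t) (hB : 1 ≤ B)
    (hl : 1 ≤ Real.log t) (hH : H ≤ t ^ (1 / 2 : ℝ) / Real.log t) (hH0 : 0 < H) (hL1 : 1 ≤ L)
    (hL : (L : ℝ) ≤ b * H) (hΛ0 : 0 ≤ Λ) (hΛ : Λ ≤ Real.log t)
    (hlb : 1600 * B ^ 2 * b ^ 2 ≤ Real.log t) :
    (L : ℝ) ^ 2 ≤ b ^ 2 * t ∧ 2 * L * Λ ≤ 1 / 100 * t ∧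
      1 + 8 * (L : ℝ) ^ 2 * B ^ 2 * Λ ≤ 1 / 100 * t := by
  have ht0 : 0 < t := by linarith
  have hl0 : 0 < Real.log t := by linarith
  have hB' : (1 : ℝ) ≤ B := by exact_mod_cast hB
  have hB2 : (1 : ℝ) ≤ (B : ℝ) ^ 2 := one_le_pow₀ hB'
  have hL1' : (1 : ℝ) ≤ L := by exact_mod_cast hL1
  have h1 : H ^ 2 ≤ t / Real.log t ^ 2 := by
    calc H ^ 2 ≤ (t ^ (1 / 2 : ℝ) / Real.log t) ^ 2 := by gcongr
      _ = t / Real.log t ^ 2 := by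
        rw [div_pow, ← Real.rpow_natCast, ← Real.rpow_mul ht0.le]; norm_num
  have h2 : (L : ℝ) ^ 2 ≤ b ^ 2 * (t / Real.log t ^ 2) := by
    calc (L : ℝ) ^ 2 ≤ (b * H) ^ 2 := by gcongr
      _ = b ^ 2 * H ^ 2 := by ring
      _ ≤ _ := by gcongr
  have h3 : (L : ℝ) ^ 2 * Λ ≤ b ^ 2 * t / Real.log t := by
    calc (L : ℝ) ^ 2 * Λ ≤ b ^ 2 * (t / Real.log t ^ 2) * Real.log t := by gcongr
      _ = b ^ 2 * t / Real.log t := by field_simp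
  -- The target 1 + 8L²B²Λ ≤ t/100 splits as 8/1600 = 1/200 and 1 ≤ t/200, the latter being t ≥ 200.
  have h4 : 1600 * B ^ 2 * ((L : ℝ) ^ 2 * Λ) ≤ t := by
    calc 1600 * B ^ 2 * ((L : ℝ) ^ 2 * Λ) ≤ 1600 * B ^ 2 * (b ^ 2 * t / Real.log t) := by gcongr
      _ = (1600 * B ^ 2 * b ^ 2) * (t / Real.log t) := by ring
      _ ≤ Real.log t * (t / Real.log t) := by gcongr
      _ = t := by field_simp
  have h5 : L * Λ ≤ (L : ℝ) ^ 2 * Λ := by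
    rw [sq]; nlinarith [mul_nonneg (by positivity : (0 : ℝ) ≤ L) hΛ0]
  have h6 : (L : ℝ) ^ 2 * Λ ≤ B ^ 2 * ((L : ℝ) ^ 2 * Λ) := by
    have : 0 ≤ (L : ℝ) ^ 2 * Λ := by positivity
    nlinarith
  refine ⟨h2.trans ?_, by nlinarith, by nlinarith⟩
  gcongr
  exact div_le_self ht0.le (one_le_pow₀ hl)

theorem scale_diagonal_bound {t a T A E₁ E₂ : ℝ} (ht : 0 < t)
    (hA : A ≤ Real.exp (1 / 100 * t)) (hE₁ : E₁ ≤ 1 / 100 * t) (hE₂ : E₂ ≤ 1 / 100 * t)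
    (hT : Real.exp t ≤ T) (hta : 11 * t ^ a ≤ Real.exp (1 / 2 * t)) :
    A * Real.exp E₁ + Real.exp E₂ + 9 ≤ t ^ (-a) * T := by
  have h1 : Real.exp E₁ ≤ Real.exp (1 / 100 * t) := Real.exp_le_exp.2 hE₁
  have h2 : Real.exp E₂ ≤ Real.exp (1 / 100 * t) := Real.exp_le_exp.2 hE₂
  set e := Real.exp (1 / 100 * t)
  have he : 1 ≤ e := Real.one_le_exp (by positivity)
  have h3 : A * Real.exp E₁ ≤ e * e := by gcongr
  have h4 : e * e * Real.exp (1 / 2 * t) ≤ T := by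
    refine le_trans ?_ hT
    rw [← Real.exp_add, ← Real.exp_add, Real.exp_le_exp]; linarith
  have h5 : 0 < t ^ a := by positivity
  have h6 : A * Real.exp E₁ + Real.exp E₂ + 9 ≤ 11 * (e * e) := by nlinarith
  refine h6.trans ?_
  rw [Real.rpow_neg ht.le, inv_mul_eq_div, le_div_iff₀ h5]
  calc 11 * (e * e) * t ^ a = e * e * (11 * t ^ a) := by ring
    _ ≤ e * e * Real.exp (1 / 2 * t) := by gcongr
    _ ≤ T := h4

/-- As 0.49 · 1.01 < 1/2, the left side is at most C·exp(0.52t), while |Q| is at least exp(t) up to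
powers of t; a spare exp(0.4t) absorbs those powers. -/
theorem scale_crossing_bound {t a A E u q c C : ℝ} (ht : 0 < t)
    (hA : A ≤ Real.exp (1 / 100 * t)) (hE : E ≤ 1 / 100 * t) (hu0 : 0 ≤ u)
    (hu : u ≤ Real.exp ((1 + 1 / 100) * t)) (hc : 0 < c) (hC : 0 ≤ C)
    (hq : c * (Real.exp t / t ^ 2) ≤ q) (hta : 2 * C / c * t ^ (a + 2) ≤ Real.exp (4 / 10 * t)) :
    A * (C * u ^ (0.49 : ℝ)) * Real.exp E ≤ t ^ (-a) * (q / 2) := by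
  have h1 : Real.exp E ≤ Real.exp (1 / 100 * t) := Real.exp_le_exp.2 hE
  have h2 : u ^ (0.49 : ℝ) ≤ Real.exp (1 / 2 * t) := by
    refine (Real.rpow_le_rpow hu0 hu (by norm_num)).trans ?_
    rw [← Real.exp_mul, Real.exp_le_exp]
    nlinarith
  have hta2 : 0 < t ^ (a + 2) := by positivity
  have h3 : t ^ (-a) * (c * (Real.exp t / t ^ 2) / 2) = c * Real.exp t / (2 * t ^ (a + 2)) := by
    rw [Real.rpow_add ht, Real.rpow_neg ht.le, Real.rpow_two]
    field_simp
  calc A * (C * u ^ (0.49 : ℝ)) * Real.exp E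
      ≤ Real.exp (1 / 100 * t) * (C * Real.exp (1 / 2 * t)) * Real.exp (1 / 100 * t) := by gcongr
    _ ≤ t ^ (-a) * (c * (Real.exp t / t ^ 2) / 2) := by
      rw [h3, le_div_iff₀ (by positivity)]
      have h4 : Real.exp (1 / 100 * t) * Real.exp (1 / 2 * t) * Real.exp (1 / 100 * t)
          * Real.exp (4 / 10 * t) ≤ Real.exp t := by
        rw [← Real.exp_add, ← Real.exp_add, ← Real.exp_add, Real.exp_le_exp]; linarith
      calc _ = c * (Real.exp (1 / 100 * t) * Real.exp (1 / 2 * t) * Real.exp (1 / 100 * t)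
            * (2 * C / c * t ^ (a + 2))) := by field_simp
        _ ≤ c * (Real.exp (1 / 100 * t) * Real.exp (1 / 2 * t) * Real.exp (1 / 100 * t)
            * Real.exp (4 / 10 * t)) := by gcongr
        _ ≤ c * Real.exp t := by gcongr
    _ ≤ t ^ (-a) * (q / 2) := by gcongr

/-- The lower bound on k gives exp(-c₂k/2) ≤ t^(-a-c₁-4). The c₁ cancels the logarithm in the
overlap bound; of the four further powers, one pays for A, two for |Q| ≥ cy/t², and the last for the
constants. -/
theorem scale_overlap_bound {t a A b c c₁ c₂ C K y q : ℝ} {k : ℕ} (ht : 1 ≤ t)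
    (hA : A ≤ b ^ 2 * t) (hc₁ : 0 ≤ c₁) (hc₂ : 0 < c₂) (hC : 0 ≤ C) (hK : 0 ≤ K)
    (hy : 0 < y) (hu : 1 ≤ (K + 1) * y) (hlu : Real.log ((K + 1) * y) ≤ 2 * t) (hc : 0 < c)
    (hq : c * (y / t ^ 2) ≤ q) (hk : 2 / c₂ * (a + c₁ + 4) * Real.log t ≤ k)
    (ht1 : b ^ 2 * (C * (K + 1) * 2 ^ c₁ / (1 - Real.exp (-(c₂ / 2)))) * 2 ≤ c * t) :
    A * overlapTail c₁ c₂ C ((K + 1) * y) k ≤ t ^ (-a) * (q / 2) := by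
  have ht0 : 0 < t := by linarith
  have hr : 0 < 1 - Real.exp (-(c₂ / 2)) := by
    have : Real.exp (-(c₂ / 2)) < 1 := by rw [Real.exp_lt_one_iff]; linarith
    linarith
  have h1 : Real.exp (-(c₂ / 2) * k) ≤ t ^ (-(a + c₁ + 4)) := by
    rw [Real.rpow_def_of_pos ht0, Real.exp_le_exp]
    have h2 : c₂ / 2 * (2 / c₂ * (a + c₁ + 4) * Real.log t) ≤ c₂ / 2 * k := by gcongr
    have h3 : c₂ / 2 * (2 / c₂ * (a + c₁ + 4) * Real.log t) = (a + c₁ + 4) * Real.log t := by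
      field_simp
    linarith
  have h2 : Real.log ((K + 1) * y) ^ c₁ ≤ 2 ^ c₁ * t ^ c₁ := by
    rw [← Real.mul_rpow (by norm_num) ht0.le]
    exact Real.rpow_le_rpow (Real.log_nonneg hu) hlu hc₁
  have h3 : t ^ c₁ * t ^ (-(a + c₁ + 4)) = t ^ (-a) / t ^ 4 := by
    rw [← Real.rpow_add ht0, eq_div_iff (by positivity), ← Real.rpow_natCast t 4,
      ← Real.rpow_add ht0]
    congr 1
    push_cast
    ring
  have ha0 : 0 < t ^ (-a) := by positivity
  unfold overlapTail
  calc A * (C * ((K + 1) * y * Real.log ((K + 1) * y) ^ c₁)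
        * (Real.exp (-(c₂ / 2) * k) / (1 - Real.exp (-(c₂ / 2)))))
      ≤ b ^ 2 * t * (C * ((K + 1) * y * (2 ^ c₁ * t ^ c₁))
        * (t ^ (-(a + c₁ + 4)) / (1 - Real.exp (-(c₂ / 2))))) := by
        have : 0 ≤ Real.log ((K + 1) * y) ^ c₁ := Real.rpow_nonneg (Real.log_nonneg hu) _
        gcongr
    _ = b ^ 2 * (C * (K + 1) * 2 ^ c₁ / (1 - Real.exp (-(c₂ / 2)))) * (t * y)
        * (t ^ c₁ * t ^ (-(a + c₁ + 4))) := by field_simp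
    _ ≤ c * t / 2 * (t * y) * (t ^ (-a) / t ^ 4) := by
        rw [h3]
        gcongr
        linarith
    _ = t ^ (-a) * (c * (y / t ^ 2) / 2) := by field_simp
    _ ≤ t ^ (-a) * (q / 2) := by gcongr

theorem eventually_log_yOf_le {δ c : ℝ} (hδ : 0 < δ) (hc : 0 < c) :
    ∀ᶠ x in atTop, Real.log (c * yOf δ x) ≤ 1.01 * Real.log x := by
  have h := tendsto_log_yOf_div hδ
  have h2 : Tendsto (fun x : ℝ => Real.log c / Real.log x) atTop (𝓝 0) :=
    Real.tendsto_log_atTop.const_div_atTop _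
  have h3 := h2.add h
  rw [zero_add] at h3
  filter_upwards [h3.eventually (gt_mem_nhds (by norm_num : (1 : ℝ) < 1.01)),
    eventually_yOf_bounds hδ, Real.tendsto_log_atTop.eventually_gt_atTop 0,
    eventually_gt_atTop 0] with x hx hy ht hx0
  have hy0 : 0 < (yOf δ x : ℝ) := lt_of_lt_of_le (by positivity) hy.1
  rw [Real.log_mul hc.ne' hy0.ne']
  rw [← add_div, div_lt_iff₀ ht] at hx
  exact hx.le

/-- The number of common values allowed between two progressions of good moduli. -/
def collisionCap (a c₁ c₂ x : ℝ) : ℕ := ⌈2 / c₂ * (a + c₁ + 4) * Real.log (Real.log x)⌉₊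

theorem eventually_collisionCap_le {a c₁ c₂ C η : ℝ} (hC : 0 ≤ C) (hη : 0 < η)
    (hc₂ : 0 < c₂) (ha : 0 ≤ a) (hc₁ : 0 < c₁) :
    ∀ᶠ x in atTop, C * ((collisionCap a c₁ c₂ x : ℝ) + 1) ≤ Real.log x ^ η := by
  filter_upwards [Real.tendsto_log_atTop.eventually (eventually_mul_log_add_le_rpow
    (C * (2 / c₂ * (a + c₁ + 4))) (C * 2) hη), tendsto_log_log.eventually_ge_atTop 0] with x hx hl
  refine le_trans ?_ hx
  have h := (Nat.ceil_lt_add_one (show 0 ≤ 2 / c₂ * (a + c₁ + 4) * Real.log (Real.log x) by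
    positivity)).le
  calc C * ((collisionCap a c₁ c₂ x : ℝ) + 1)
      ≤ C * (2 / c₂ * (a + c₁ + 4) * Real.log (Real.log x) + 1 + 1) := by
        unfold collisionCap; gcongr
    _ = _ := by ring

/-- The order of magnitude is y/(H log x), and H ≤ log x. -/
theorem eventually_card_primesAtFin_ge {I : (p : ℕ) → Finset (ZMod p)} {ν : ℕ} {r : ℝ}
    (h : HasPrimeDensity {p | (I p).card = ν} r) (hr : 0 < r) {δ ξ : ℝ} (hδ : 0 < δ)
    (hξ : 1 < ξ) :
    ∀ᶠ p in scaleFilter δ ξ, r * (1 - 1 / ξ) / 2 * ((yOf δ p.1 : ℝ) / Real.log p.1 ^ 2)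
      ≤ (primesAtFin I δ ξ p.1 p.2 ν).card := by
  have hξ0 : 0 < ξ := by linarith
  have hξ1 : 0 < 1 - 1 / ξ := by rw [sub_pos, div_lt_one hξ0]; exact hξ
  have hc : 0 < r * (1 - 1 / ξ) := mul_pos hr hξ1
  filter_upwards [(tendsto_card_primesAtFin h hδ hξ).eventually (lt_mem_nhds (half_lt_self hc)),
    eventually_scaleFilter_bounds hδ hξ, (tendsto_snd_scaleFilter hδ hξ).eventually_gt_atTop 0,
    (tendsto_log_fst δ ξ).eventually_ge_atTop 1, (tendsto_loglog_fst δ ξ).eventually_ge_atTop 1,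
    (tendsto_fst_scaleFilter δ ξ).eventually (eventually_yOf_bounds hδ),
    (tendsto_fst_scaleFilter δ ξ).eventually_gt_atTop 0] with p hp hb hH ht hl hy hx
  have ht0 : 0 < Real.log p.1 := by linarith
  have hy0 : 0 < (yOf δ p.1 : ℝ) := lt_of_lt_of_le (by positivity) hy.1
  have hHt : p.2 ≤ Real.log p.1 := by
    refine hb.2.1.trans ((div_le_self (by positivity) hl).trans ?_)
    calc Real.log p.1 ^ (1 / 2 : ℝ) ≤ Real.log p.1 ^ (1 : ℝ) :=
          Real.rpow_le_rpow_of_exponent_le ht (by norm_num)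
      _ = _ := Real.rpow_one _
  rw [mul_div_assoc', lt_div_iff₀ hy0] at hp
  have h3 : p.2 * Real.log p.1 ≤ Real.log p.1 ^ 2 := by rw [sq]; gcongr
  have h4 : (0 : ℝ) ≤ (primesAtFin I δ ξ p.1 p.2 ν).card := Nat.cast_nonneg _
  rw [mul_div_assoc', div_le_iff₀ (by positivity)]
  nlinarith

/-- Only the collision condition restricts the exponent a. The diagonal and crossing terms have
power savings in x, and the overlap term is made small by the choice of `collisionCap`. -/
theorem eventually_scaleBounds {I : (p : ℕ) → Finset (ZMod p)} {B : ℕ}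
    (h1 : ∀ p : ℕ, p.Prime → (I p).card ≤ p - 1) {C₁ : ℝ} (hC₁ : 0 < C₁)
    (hm : Tendsto (fun x : ℝ => sieveProd I x * Real.log x) atTop (𝓝 C₁)) {ν : ℕ} {r : ℝ}
    (h : HasPrimeDensity {p | (I p).card = ν} r) (hr : 0 < r) (hν : 1 ≤ ν) (hνB : ν ≤ B)
    {δ ξ M K : ℝ} (hδ : 0 < δ) (hξ : 1 < ξ) (hM : 2 ≤ M) (hK : 0 < K)
    {c₁ c₂ C N a : ℝ} (hc₁ : 0 < c₁) (hc₂ : 0 < c₂) (hC : 0 ≤ C) (hN : 0 ≤ N) (ha : 0 ≤ a)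
    (haM : a < δ * (M - 2)) :
    ∀ᶠ p in scaleFilter δ ξ, ScaleBounds I B (N * ((K + 1) * (yOf δ p.1 : ℝ)) ^ (0.49 : ℝ))
      (overlapTail c₁ c₂ C ((K + 1) * (yOf δ p.1 : ℝ)) (collisionCap a c₁ c₂ p.1))
      (Real.log p.1 ^ (-a)) (zOf δ p.1) ((K + 2) * (yOf δ p.1 : ℝ)) (collisionCap a c₁ c₂ p.1) ν
      (p.2 ^ M) (K * p.2) (primesAtFin I δ ξ p.1 p.2 ν) := by
  have hB : 1 ≤ B := hν.trans hνB
  set b : ℝ := B * K with hb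
  set c : ℝ := r * (1 - 1 / ξ) / 2 with hc
  have hξ0 : 0 < ξ := by linarith
  have hξ1 : 0 < 1 - 1 / ξ := by rw [sub_pos, div_lt_one hξ0]; exact hξ
  have hc0 : 0 < c := by positivity
  have hlog := tendsto_log_fst δ ξ
  have hfst := tendsto_fst_scaleFilter δ ξ
  filter_upwards [eventually_scaleFilter_bounds hδ hξ,
    eventually_card_primesAtFin_ge h hr hδ hξ,
    (tendsto_snd_scaleFilter hδ hξ).eventually_ge_atTop (1 / K),
    hlog.eventually_ge_atTop 200, (tendsto_loglog_fst δ ξ).eventually_ge_atTop 1,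
    (tendsto_loglog_fst δ ξ).eventually_ge_atTop (1600 * B ^ 2 * b ^ 2),
    hfst.eventually (eventually_yOf_bounds hδ), hfst.eventually_gt_atTop 0,
    hfst.eventually (eventually_log_yOf_le hδ (by linarith : 0 < K + 1)),
    eventually_densityIoc_bounds h1 hC₁ hm hδ hξ (by linarith : 0 < M),
    eventually_rpow_snd_le_zOf hδ hξ (by linarith : 0 < M),
    hlog.eventually (eventually_mul_rpow_le_exp 11 a (by norm_num : (0 : ℝ) < 1 / 2)),
    hlog.eventually (eventually_mul_rpow_le_exp (2 * N / c) (a + 2)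
      (by norm_num : (0 : ℝ) < 4 / 10)),
    hlog.eventually (eventually_mul_rpow_le_exp (b ^ 2) 1 (by norm_num : (0 : ℝ) < 1 / 100)),
    hlog.eventually_ge_atTop
      (b ^ 2 * (C * (K + 1) * 2 ^ c₁ / (1 - Real.exp (-(c₂ / 2)))) * 2 / c),
    hfst.eventually (eventually_collisionCap_le
      (by positivity : 0 ≤ 20 * (B : ℝ) ^ 3 * b ^ 2) (sub_pos.2 haM) hc₂ ha hc₁)]
    with p hp hq hH ht hl hlb hy hx hlu hd hvz e1 e2 e3 e4 hk
  set t := Real.log p.1 with htdef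
  have ht0 : 0 < t := by linarith
  have ht1 : 1 ≤ t := by linarith
  have hH0 : 0 < p.2 := lt_of_lt_of_le (by positivity) hH
  have hKH : 1 ≤ K * p.2 := by rw [div_le_iff₀ hK] at hH; linarith
  have htδ : 1 ≤ t ^ δ := Real.one_le_rpow ht1 hδ.le
  have hxt : p.1 = Real.exp t := (Real.exp_log hx).symm
  have hyx : Real.exp t ≤ yOf δ p.1 := by
    rw [← hxt]; exact (le_mul_of_one_le_right hx.le htδ).trans hy.1
  have hy0 : 0 < (yOf δ p.1 : ℝ) := lt_of_lt_of_le (Real.exp_pos t) hyx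
  have hy1 : 1 ≤ (yOf δ p.1 : ℝ) := le_trans (Real.one_le_exp ht0.le) hyx
  have hfl : 1 ≤ ⌊K * p.2⌋₊ := Nat.le_floor (by exact_mod_cast hKH)
  have hL1 : 1 ≤ ν * ⌊K * p.2⌋₊ := Nat.mul_pos hν hfl
  have hL : ((ν * ⌊K * p.2⌋₊ : ℕ) : ℝ) ≤ b * p.2 := by
    push_cast
    have h2 : (⌊K * p.2⌋₊ : ℝ) ≤ K * p.2 := Nat.floor_le (by linarith)
    have h3 : (ν : ℝ) ≤ B := by exact_mod_cast hνB
    calc (ν : ℝ) * ⌊K * p.2⌋₊ ≤ B * (K * p.2) := by gcongr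
      _ = b * p.2 := by rw [hb]; ring
  have hΛ0 := logLoss_nonneg h1 (p.2 ^ M) (zOf δ p.1)
  obtain ⟨s1, s2, s3⟩ := scale_exponent_bounds ht hB hl hp.2.1 hH0 hL1 hL hΛ0 hd.1 hlb
  rw [Real.rpow_one] at e3
  have hu1 : 1 ≤ (K + 1) * (yOf δ p.1 : ℝ) := one_le_mul_of_one_le_of_one_le (by linarith) hy1
  have hu2 : (K + 1) * (yOf δ p.1 : ℝ) ≤ Real.exp ((1 + 1 / 100) * t) := by
    rw [← Real.log_le_iff_le_exp (by linarith)]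
    convert hlu using 2
    norm_num
  have hq2 : c * (Real.exp t / t ^ 2) ≤ (primesAtFin I δ ξ p.1 p.2 ν).card :=
    le_trans (by gcongr) hq
  have hT : Real.exp t ≤ (K + 2) * (yOf δ p.1 : ℝ) :=
    hyx.trans (le_mul_of_one_le_left hy0.le (by linarith))
  rw [div_le_iff₀ hc0] at e4
  constructor
  · positivity
  · exact hvz
  · exact hfl
  · refine scale_collision_bound ht1 ((le_mul_of_one_le_left (by positivity) (by norm_num)).trans hp.1) hM (by positivity) hL hk
  · exact scale_diagonal_bound ht0 (s1.trans e3) s2 s3 hT e1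
  · exact scale_crossing_bound ht0 (s1.trans e3) s2 (by linarith) hu2 hc0 hN hq2 e2
  · exact scale_overlap_bound ht1 s1 hc₁.le hc₂ hC hK.le hy0 hu1 (by linarith)
      hc0 hq (Nat.le_ceil _) (by linarith)

/-! ### Assembly -/

/-- I_p - I_p is symmetric, so the hypothesis for positive integers applies to |m|. -/
theorem exists_card_inDiff_le {I : (p : ℕ) → Finset (ZMod p)} {e : ℝ} (he : 0 ≤ e)
    (h : ∃ C : ℝ, ∀ v : ℤ, 1 ≤ v →
      (diffPrimes I v).Finite ∧ ((diffPrimes I v).ncard : ℝ) ≤ C * (v : ℝ) ^ e) :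
    ∃ N : ℝ, 0 ≤ N ∧ ∀ (u : ℝ) (m : ℤ), m ≠ 0 → |(m : ℝ)| ≤ u → ∀ Q : Finset ℕ,
      (∀ q ∈ Q, q.Prime ∧ InDiff I q m) → (Q.card : ℝ) ≤ N * u ^ e := by
  obtain ⟨C, hC⟩ := h
  refine ⟨|C|, abs_nonneg C, fun u m hm hmu Q hQ => ?_⟩
  obtain ⟨hf, hc⟩ := hC |m| (Int.one_le_abs hm)
  have hsub : (Q : Set ℕ) ⊆ diffPrimes I |m| := by
    intro q hq
    obtain ⟨hp, hd⟩ := hQ q hq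
    refine ⟨hp, ?_⟩
    rcases abs_choice m with h | h <;> rw [h]
    · exact hd
    · exact hd.neg
  have h1 := Set.ncard_le_ncard hsub hf
  rw [Set.ncard_coe_finset] at h1
  have h2 : (Q.card : ℝ) ≤ (diffPrimes I |m|).ncard := by exact_mod_cast h1
  have h3 : ((|m| : ℤ) : ℝ) = |(m : ℝ)| := by push_cast; rfl
  rw [h3] at hc
  calc (Q.card : ℝ) ≤ C * |(m : ℝ)| ^ e := h2.trans hc
    _ ≤ |C| * |(m : ℝ)| ^ e := by gcongr; exact le_abs_self C
    _ ≤ |C| * u ^ e := by gcongr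

theorem OverlapBound.mono {I : (p : ℕ) → Finset (ZMod p)} {c₁ c₂ C C' : ℝ}
    (h : OverlapBound I c₁ c₂ C) (hC : C ≤ C') : OverlapBound I c₁ c₂ C' := by
  intro u hu m hm w hw k hk
  obtain ⟨hf, hc⟩ := h u hu m hm w hw k hk
  refine ⟨hf, hc.trans ?_⟩
  have : 0 ≤ Real.log u := Real.log_nonneg (by linarith)
  gcongr

/-- Serves to show that ρ₀ is positive as soon as some ρ_ν is. -/
theorem HasPrimeDensity.mono {A A' : Set ℕ} {r r' : ℝ} (h : HasPrimeDensity A r)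
    (h' : HasPrimeDensity A' r') (hA : A ⊆ A') : r ≤ r' := by
  refine le_of_tendsto_of_tendsto h h' ?_
  filter_upwards [Real.tendsto_log_atTop.eventually_gt_atTop 0, eventually_gt_atTop 0]
    with x hx hx0
  have hsub : {p : ℕ | p.Prime ∧ (p : ℝ) ≤ x ∧ p ∈ A} ⊆ {p : ℕ | p.Prime ∧ (p : ℝ) ≤ x ∧ p ∈ A'} :=
    fun p hp => ⟨hp.1, hp.2.1, hA hp.2.2⟩
  have := Set.ncard_le_ncard hsub (finite_setOf_prime_le A' x)
  gcongr

theorem eventually_sieveProd_zOf_le {I : (p : ℕ) → Finset (ZMod p)} {C₁ : ℝ} (hC₁ : 0 < C₁)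
    (hm : Tendsto (fun x : ℝ => sieveProd I x * Real.log x) atTop (𝓝 C₁)) {δ : ℝ} (hδ : 0 < δ) :
    ∀ᶠ x in atTop, sieveProd I (zOf δ x) ≤ 2 * C₁ / Real.log x := by
  have h := (hm.comp (tendsto_zOf hδ)).mul ((tendsto_log_zOf_div hδ).inv₀ one_ne_zero)
  rw [inv_one, mul_one] at h
  filter_upwards [h.eventually (gt_mem_nhds (by linarith : C₁ < 2 * C₁)),
    (tendsto_zOf hδ).eventually_gt_atTop 1, Real.tendsto_log_atTop.eventually_gt_atTop 0]
    with x hx hz ht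
  have hlz := Real.log_pos hz
  rw [le_div_iff₀ ht]
  refine le_trans (le_of_eq ?_) hx.le
  simp only [Function.comp_apply]
  field_simp

/-- Each scale has 1/log H ≥ 2/log log x, and the sum of these reciprocals is bounded. -/
theorem eventually_card_scaleFin_le {δ ξ : ℝ} (hδ : 0 < δ) (hδ2 : δ < 1 / 2) (hξ : 1 < ξ) :
    ∃ S : ℝ, 0 ≤ S ∧ ∀ᶠ x in atTop,
      ((scaleFin δ ξ x).card : ℝ) ≤ S * Real.log (Real.log x) := by
  have h := tendsto_sum_inv_log_scaleFin hδ hδ2 hξ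
  set S := Real.log (1 / (2 * δ)) / Real.log ξ with hS
  have hS0 : 0 ≤ S := div_nonneg (Real.log_nonneg (by rw [le_div_iff₀ (by positivity)]; linarith))
    (Real.log_nonneg hξ.le)
  refine ⟨S + 1, by linarith, ?_⟩
  filter_upwards [h.eventually (gt_mem_nhds (lt_add_one S)), eventually_coe_scaleFin hδ hξ,
    eventually_scaleFilter.1 (eventually_log_snd_bounds hδ hξ),
    tendsto_log_log.eventually_gt_atTop 0] with x hx hc hb hl
  have h2 : ∑ _H ∈ scaleFin δ ξ x, 2 / Real.log (Real.log x)
      ≤ ∑ H ∈ scaleFin δ ξ x, 1 / Real.log H := by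
    refine Finset.sum_le_sum fun H hH => ?_
    have hH' : H ∈ scales δ ξ x := by rw [← hc]; exact hH
    obtain ⟨h3, h4⟩ := hb H hH'
    have hlH : 0 < Real.log H := lt_of_lt_of_le (by positivity) h3
    rw [div_le_div_iff₀ hl hlH]
    linarith
  rw [Finset.sum_const, nsmul_eq_mul, mul_div_assoc'] at h2
  have h5 := h2.trans hx.le
  rw [div_le_iff₀ hl] at h5
  have : (0 : ℝ) ≤ (scaleFin δ ξ x).card := Nat.cast_nonneg _
  linarith

/-- The exponents balance: t^δ · t^(-δ(4+6ε)) · t^(3δ(1+ε)) = t^(-3δε). This saving beats the factor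
l, which stands for log log x; the first summand has only two factors 1/τ and is smaller still. -/
theorem exceptional_bound {t l x y σ n S W C₁ M K δ ε c : ℝ} (ht : 1 ≤ t) (hl : 0 ≤ l)
    (hx : 0 ≤ x) (hδ : 0 < δ) (hε : 0 < ε) (hS : 0 ≤ S) (hW : 0 ≤ W) (hC₁ : 0 ≤ C₁) (hM : 0 ≤ M)
    (hK : 0 ≤ K) (hn : n ≤ S * l) (hy0 : 0 ≤ y) (hy : y ≤ 2 * (x * t ^ δ))
    (hσ0 : 0 ≤ σ) (hσ : σ ≤ 2 * C₁ / t)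
    (hb : (224 * S * W ^ 2 * C₁ + 56 * W * M * (K + 2)) * l ≤ c * t ^ (3 * δ * ε)) :
    4 * n * W ^ 2 * y * σ * (14 * t ^ (-(δ * (4 + 6 * ε)))) / (1 / t ^ (δ * (1 + ε))) ^ 2
      + 2 * W * (14 * t ^ (-(δ * (4 + 6 * ε)))) * (M * l / t) * ((K + 2) * y)
        / (1 / t ^ (δ * (1 + ε))) ^ 3 ≤ c * (x / t) := by
  have ht0 : 0 < t := by linarith
  set E := t ^ (-(δ * (4 + 6 * ε))) with hE
  set F := t ^ (δ * (1 + ε)) with hF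
  set G := t ^ (3 * δ * ε) with hG
  have hE0 : 0 < E := by positivity
  have hF0 : 0 < F := by positivity
  have hG0 : 0 < G := by positivity
  have hF1 : 1 ≤ F := Real.one_le_rpow ht (by positivity)
  have h3 : t ^ δ * E * F ^ 3 * G = 1 := by
    rw [hE, hF, hG, ← Real.rpow_natCast, ← Real.rpow_mul ht0.le, ← Real.rpow_add ht0,
      ← Real.rpow_add ht0, ← Real.rpow_add ht0]
    convert Real.rpow_zero t using 2
    push_cast
    ring
  have h4 : t ^ δ * E * F ^ 3 = 1 / G := by rw [eq_div_iff hG0.ne', h3]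
  have h5 : t ^ δ * E * F ^ 2 ≤ 1 / G := by
    rw [← h4]
    exact mul_le_mul_of_nonneg_left (pow_le_pow_right₀ hF1 (by norm_num)) (by positivity)
  have h6 : 4 * n * W ^ 2 * y * σ * (14 * E) / (1 / F) ^ 2
      ≤ 4 * (S * l) * W ^ 2 * (2 * (x * t ^ δ)) * (2 * C₁ / t) * (14 * E) * F ^ 2 := by
    rw [one_div, inv_pow, div_inv_eq_mul]
    gcongr
  have h7 : 2 * W * (14 * E) * (M * l / t) * ((K + 2) * y) / (1 / F) ^ 3
      ≤ 2 * W * (14 * E) * (M * l / t) * ((K + 2) * (2 * (x * t ^ δ))) * F ^ 3 := by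
    rw [one_div, inv_pow, div_inv_eq_mul]
    gcongr
  have h8 : 4 * (S * l) * W ^ 2 * (2 * (x * t ^ δ)) * (2 * C₁ / t) * (14 * E) * F ^ 2
      = 224 * S * W ^ 2 * C₁ * l * (x / t) * (t ^ δ * E * F ^ 2) := by ring
  have h9 : 2 * W * (14 * E) * (M * l / t) * ((K + 2) * (2 * (x * t ^ δ))) * F ^ 3
      = 56 * W * M * (K + 2) * l * (x / t) * (1 / G) := by rw [← h4]; ring
  have h10 : 224 * S * W ^ 2 * C₁ * l * (x / t) * (t ^ δ * E * F ^ 2)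
      ≤ 224 * S * W ^ 2 * C₁ * l * (x / t) * (1 / G) := by gcongr
  calc _ ≤ 224 * S * W ^ 2 * C₁ * l * (x / t) * (1 / G)
        + 56 * W * M * (K + 2) * l * (x / t) * (1 / G) := by linarith
    _ = (224 * S * W ^ 2 * C₁ + 56 * W * M * (K + 2)) * l * (x / t * (1 / G)) := by ring
    _ ≤ c * G * (x / t * (1 / G)) := by gcongr
    _ = c * (x / t) := by field_simp

theorem lt_half_of_lt_critExp {r δ : ℝ} (hδ : 0 < δ) (h : δ < critExp r) : δ < 1 / 2 := by
  unfold critExp at h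
  have hne : {δ : ℝ | 0 < δ ∧ δ < 1 / 2 ∧
      6 * (10 : ℝ) ^ (2 * δ) / Real.log (1 / (2 * δ)) < r}.Nonempty := by
    -- The supremum of the empty set is 0 by convention, which δ > 0 excludes.
    by_contra hne
    rw [Set.not_nonempty_iff_eq_empty] at hne
    rw [hne, Real.sSup_empty] at h
    linarith
  obtain ⟨d, hd, hdδ⟩ := exists_lt_of_lt_csSup hne h
  exact hdδ.trans hd.2.1

/-- Plain first-moment bound, for the case in which no size has positive density. -/
theorem exists_shift_ncard_le {I : (p : ℕ) → Finset (ZMod p)}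
    (h1 : ∀ p : ℕ, p.Prime → (I p).card ≤ p - 1) (z : ℝ) (y : ℕ) :
    ∃ b : ℤ, ((sievedShift I 0 z b ∩ Set.Icc 1 (y : ℤ)).ncard : ℝ) ≤ 2 * sieveProd I z * y := by
  obtain ⟨b, hb⟩ := exists_le_avgMod (modulusIoc_pos 0 z)
    (fun b => ∑ n ∈ Finset.Icc 1 (y : ℤ), sieveInd I 0 z b n)
  refine ⟨b, ?_⟩
  rw [avgMod_sum] at hb
  simp only [avgMod_sieveInd, densityIoc_zero_left, Finset.sum_const, Int.card_Icc,
    nsmul_eq_mul] at hb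
  have hσ : 0 < sieveProd I z := by rw [← densityIoc_zero_left]; exact densityIoc_pos h1 _ _
  have h3 := ncard_inter_Icc (sievedShift I 0 z b) (fun _ => True) y
    (fun n => sieveInd I 0 z b n) (fun n hn _ => if_pos hn)
    (fun n => by unfold sieveInd; positivity)
  simp only [and_true, Set.ofPred_mem_eq] at h3
  refine h3.trans (hb.trans ?_)
  have h4 : ((y : ℤ) + 1 - 1).toNat = y := by simp
  rw [h4]
  have : 0 ≤ sieveProd I z * y := by positivity
  linarith

theorem eventually_exists_shift {I : (p : ℕ) → Finset (ZMod p)} {B : ℕ} {ρ : ℕ → ℝ} {ρ₀ : ℝ}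
    (hI : IsRegularSystem I B ρ) (hρ₀ : HasPrimeDensity {p | 1 ≤ (I p).card} ρ₀)
    {δ M ξ K ε : ℝ} (hδ : 0 < δ) (hδ2 : δ < 1 / 2) (hξ : 1 < ξ) (hK : 0 < K) (hε : 0 < ε)
    (hεM : 7 * ε < M - 6) (hne : (goodSizes B ρ).Nonempty) :
    ∀ᶠ x : ℝ in atTop, ∀ a : ℕ → ℕ → ℤ, IsEnumeration I a →
      ∃ (b : ℤ) (R : ℕ → Finset ℕ),
        (∀ ν ∈ goodSizes B ρ, (R ν : Set ℕ) ⊆ primesOfSize I δ ξ x ν) ∧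
        ((sievedShift I 0 (zOf δ x) b ∩ Set.Icc 1 (yOf δ x : ℤ)).ncard : ℝ)
          ≤ 2 * sieveProd I (zOf δ x) * (yOf δ x : ℝ) ∧
        (∀ ν ∈ goodSizes B ρ, ∀ q ∈ R ν,
          |(∑ n ∈ Finset.Ioc ⌊-((K + 1) * (yOf δ x : ℝ))⌋ (yOf δ x : ℤ),
              weight I a b K M (zOf δ x) (scaleOf ξ (yOf δ x) q) q n)
            - (K + 2) * (yOf δ x : ℝ)|
          ≤ 1 / Real.log x ^ (δ * (1 + ε)) * ((K + 2) * (yOf δ x : ℝ))) ∧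
        (∀ ν ∈ goodSizes B ρ, ∀ i : ℕ, 1 ≤ i → i ≤ ν →
          ({n : ℤ | n ∈ sievedShift I 0 (zOf δ x) b ∩ Set.Icc 1 (yOf δ x : ℤ) ∧
            ¬ |(∑ q ∈ R ν, ∑ h ∈ Finset.Icc 1 ⌊K * scaleOf ξ (yOf δ x) q⌋₊,
                  weight I a b K M (zOf δ x) (scaleOf ξ (yOf δ x) q) q
                    (n - a i q - (q : ℤ) * (h : ℤ)))
                - scaleConst I δ ξ M K ν x * ((K + 2) * (yOf δ x : ℝ))|
              ≤ 2 * (1 / Real.log x ^ (δ * (1 + ε))) * ((K + 2) * (yOf δ x : ℝ))}.ncard : ℝ)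
            ≤ ρ₀ * x / (8 * (B : ℝ) ^ 2 * Real.log x)) := by
  classical
  have hM : 6 < M := by linarith
  have hM0 : 0 < M := by linarith
  have h1 := hI.card_le_sub_one
  obtain ⟨C₁, hC₁, hm⟩ := hI.mertens
  obtain ⟨c₁, c₂, C, hc₁, hc₂, hov⟩ := hI.diff_overlap
  -- Passing to the absolute value of the implied constant makes it nonnegative.
  replace hov : OverlapBound I c₁ c₂ |C| :=
    OverlapBound.mono (show OverlapBound I c₁ c₂ C from hov) (le_abs_self C)
  obtain ⟨N, hN0, hN⟩ := exists_card_inDiff_le (by norm_num) hI.few_diff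
  obtain ⟨S, hS0, hS⟩ := eventually_card_scaleFin_le hδ hδ2 hξ
  obtain ⟨ν₀, hν₀⟩ := hne
  have hB1 : 1 ≤ B := hν₀.1.trans hν₀.2.1
  have hB0 : (0 : ℝ) < B := by exact_mod_cast hB1
  have hρpos : 0 < ρ₀ := lt_of_lt_of_le hν₀.2.2 <|
    HasPrimeDensity.mono (hI.density ν₀ hν₀.1 hν₀.2.1) hρ₀ fun p hp => by
      rw [Set.mem_ofPred_eq] at hp ⊢; rw [hp]; exact hν₀.1
  have hfin : (goodSizes B ρ).Finite :=
    (Set.finite_Icc 1 B).subset fun ν hν => ⟨hν.1, hν.2.1⟩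
  -- Three factors 1/τ and one factor y/x cost δ(3 + 3ε) + δ; the surplus 3δε is the net saving.
  set a₀ : ℝ := δ * (4 + 6 * ε) with ha₀
  have ha₀0 : 0 ≤ a₀ := by positivity
  have haM : a₀ < δ * (M - 2) := by rw [ha₀]; gcongr; linarith
  -- There are finitely many sizes, each with a convergent constant, so one bound serves for all.
  obtain ⟨W, hW0, hW⟩ : ∃ W : ℝ, 0 ≤ W ∧
      ∀ᶠ x in atTop, ∀ ν ∈ goodSizes B ρ, scaleConst I δ ξ M K ν x ≤ W := by
    set L : ℕ → ℝ := fun ν =>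
      K * ρ ν / ((K + 2) * M) * ((1 - 1 / ξ) / Real.log ξ) * Real.log (1 / (2 * δ))
    refine ⟨∑ ν ∈ hfin.toFinset, (|L ν| + 1), Finset.sum_nonneg fun _ _ => by positivity, ?_⟩
    rw [hfin.eventually_all]
    intro ν hν
    have ht := tendsto_scaleConst h1 hC₁ hm (hI.density ν hν.1 hν.2.1) hδ hδ2 hξ hM0 hK
    filter_upwards [ht.eventually (gt_mem_nhds (lt_of_le_of_lt (le_abs_self (L ν))
      (lt_add_one |L ν|)))] with x hx
    exact hx.le.trans (Finset.single_le_sum (f := fun ν => |L ν| + 1)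
      (fun _ _ => by positivity) (hfin.mem_toFinset.2 hν))
  have hscale : ∀ᶠ x in atTop, ∀ ν ∈ goodSizes B ρ, ∀ H ∈ scales δ ξ x,
      ScaleBounds I B (N * ((K + 1) * (yOf δ x : ℝ)) ^ (0.49 : ℝ))
        (overlapTail c₁ c₂ |C| ((K + 1) * (yOf δ x : ℝ)) (collisionCap a₀ c₁ c₂ x))
        (Real.log x ^ (-a₀)) (zOf δ x) ((K + 2) * (yOf δ x : ℝ)) (collisionCap a₀ c₁ c₂ x) ν
        (H ^ M) (K * H) (primesAtFin I δ ξ x H ν) := by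
    rw [hfin.eventually_all]
    intro ν hν
    exact eventually_scaleFilter.1 (eventually_scaleBounds h1 hC₁ hm
      (hI.density ν hν.1 hν.2.1) hν.2.2 hν.1 hν.2.1 hδ hξ (by linarith) hK hc₁ hc₂ (abs_nonneg C)
      hN0 ha₀0 haM)
  have hlog := Real.tendsto_log_atTop
  have hε₀lim : Tendsto (fun x : ℝ => Real.log x ^ (-a₀)) atTop (𝓝 0) :=
    (tendsto_rpow_neg_atTop (by positivity)).comp hlog
  -- Chosen so that D/(4B²) = c·x/log x for the permitted number D of exceptional points.
  set c : ℝ := ρ₀ / (32 * (B : ℝ) ^ 4) with hc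
  have hc0 : 0 < c := by positivity
  filter_upwards [hscale, hW, hS, eventually_coe_scaleFin hδ hξ, eventually_yOf_bounds hδ,
    eventually_sieveProd_zOf_le hC₁ hm hδ, hlog.eventually_ge_atTop 1,
    tendsto_log_log.eventually_ge_atTop 0, eventually_ge_atTop 10,
    hε₀lim.eventually (gt_mem_nhds zero_lt_one),
    hε₀lim.eventually (gt_mem_nhds (half_pos hc₂)),
    eventually_scaleFilter.1 (eventually_densityIoc_bounds h1 hC₁ hm hδ hξ hM0),
    hlog.eventually ((tendsto_rpow_atTop (by positivity : 0 < δ * (3 + 5 * ε))).eventually_ge_atTop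
      W),
    hlog.eventually (eventually_mul_log_add_le_rpow
      ((224 * S * W ^ 2 * C₁ + 56 * W * M * (K + 2)) / c) 0 (by positivity : 0 < 3 * δ * ε))]
    with x hsc hWx hSx hcoe hy hσ ht hl hx hε₁ hεc hd hWt hbig a ha
  have ht0 : 0 < Real.log x := by linarith
  have hx0 : 0 < x := by linarith
  have htδ : 1 ≤ Real.log x ^ δ := Real.one_le_rpow ht hδ.le
  have hy10 : 10 ≤ (yOf δ x : ℝ) :=
    hx.trans ((le_mul_of_one_le_right hx0.le htδ).trans hy.1)
  have hτ0 : 0 < Real.log x ^ (δ * (1 + ε)) := by positivity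
  have hσ0 : 0 < sieveProd I (zOf δ x) := by
    rw [← densityIoc_zero_left]; exact densityIoc_pos h1 _ _
  -- Split a₀ = δ(3 + 5ε) + δ(1 + ε): the first part absorbs W, the second is τ.
  have hετ : Real.log x ^ (-a₀) * W ≤ 1 / Real.log x ^ (δ * (1 + ε)) := by
    rw [le_div_iff₀ hτ0]
    calc Real.log x ^ (-a₀) * W * Real.log x ^ (δ * (1 + ε))
        ≤ Real.log x ^ (-a₀) * Real.log x ^ (δ * (3 + 5 * ε)) * Real.log x ^ (δ * (1 + ε)) := by
          gcongr
      _ = 1 := by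
          rw [← Real.rpow_add ht0, ← Real.rpow_add ht0]
          convert Real.rpow_zero (Real.log x) using 2
          rw [ha₀]; ring
  have hb : (224 * S * W ^ 2 * C₁ + 56 * W * M * (K + 2)) * Real.log (Real.log x)
      ≤ c * Real.log x ^ (3 * δ * ε) := by
    rw [add_zero, div_mul_eq_mul_div, div_le_iff₀ hc0] at hbig
    linarith
  have hexc := exceptional_bound ht hl hx0.le hδ hε hS0 hW0 hC₁.le hM0.le hK.le
    hSx (by linarith) hy.2 hσ0.le hσ hb
  obtain ⟨b, R, hR1, hR2, hR3, hR4⟩ := exists_shift_of_scaleBounds h1 hI.card_le_bound hB1 hc₂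
    (abs_nonneg C) hov hξ hK (by nlinarith) hfin.toFinset
    (fun ν hν => by
      rw [hfin.mem_toFinset] at hν; exact ⟨hν.1, hν.2.1⟩)
    (scaleFin δ ξ x) hcoe (fun ν H => primesAtFin I δ ξ x H ν)
    (fun ν H => coe_primesAtFin I δ ξ x H ν)
    (fun ν hν H hH => hsc ν (hfin.mem_toFinset.1 hν) H (by rw [← hcoe]; exact hH))
    (by positivity) hε₁.le hεc.le (τ := 1 / Real.log x ^ (δ * (1 + ε)))
    (θ := M * Real.log (Real.log x) / Real.log x)
    (D := ρ₀ * x / (8 * (B : ℝ) ^ 2 * Real.log x)) (by positivity)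
    (by rw [div_le_one hτ0]; exact Real.one_le_rpow ht (by positivity))
    hετ (by positivity) (fun m hm hmu Q hQ => hN _ m hm hmu Q hQ)
    (fun ν => scaleConst I δ ξ M K ν x)
    (fun ν _ => by
      have hT : (K + 2) * (yOf δ x : ℝ) ≠ 0 := by positivity
      simp only [scaleConst, scaleTerm]
      rw [Finset.sum_mul]
      exact Finset.sum_congr rfl fun H _ => (div_mul_cancel₀ _ hT).symm)
    (fun ν hν => hWx ν (hfin.mem_toFinset.1 hν)) (by positivity)
    (fun H hH => (hd H (by rw [← hcoe]; exact hH)).2) (by positivity)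
    (hexc.trans (le_of_eq (by rw [hc]; field_simp; norm_num))) ha
  simp only [hfin.mem_toFinset] at hR1 hR3 hR4
  exact ⟨b, R, hR1, hR2, hR3, hR4⟩

end

theorem theorem3 (I : (p : ℕ) → Finset (ZMod p)) (B : ℕ) (ρ : ℕ → ℝ) (ρ₀ : ℝ)
    (hI : IsRegularSystem I B ρ) (hρ₀ : HasPrimeDensity {p | 1 ≤ (I p).card} ρ₀)
    (δ M ξ K : ℝ) (hδ₀ : 0 < δ) (hδ : δ < critExp 1) (hM : 6 < M) (hξ : 1 < ξ) (hK : 0 < K) :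
    ∃ C₂ : ℕ → ℝ → ℝ,
      (∀ ν ∈ goodSizes B ρ, Tendsto (C₂ ν) atTop
        (𝓝 (K * ρ ν / ((K + 2) * M) * ((1 - 1 / ξ) / Real.log ξ) * Real.log (1 / (2 * δ))))) ∧
      ∀ ε : ℝ, 0 < ε → ε < 1 / 7 * (M - 6) → ∀ᶠ x : ℝ in atTop,
        ∀ a : ℕ → ℕ → ℤ, IsEnumeration I a →
        ∃ (b : ℤ) (R : ℕ → Finset ℕ),
          (∀ ν ∈ goodSizes B ρ, (R ν : Set ℕ) ⊆ primesOfSize I δ ξ x ν) ∧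
          ((sievedShift I 0 (zOf δ x) b ∩ Set.Icc 1 (yOf δ x : ℤ)).ncard : ℝ)
            ≤ 2 * sieveProd I (zOf δ x) * (yOf δ x : ℝ) ∧
          (∀ ν ∈ goodSizes B ρ, ∀ q ∈ R ν,
            |(∑ n ∈ Finset.Ioc ⌊-((K + 1) * (yOf δ x : ℝ))⌋ (yOf δ x : ℤ),
                weight I a b K M (zOf δ x) (scaleOf ξ (yOf δ x) q) q n)
              - (K + 2) * (yOf δ x : ℝ)|
            ≤ 1 / Real.log x ^ (δ * (1 + ε)) * ((K + 2) * (yOf δ x : ℝ))) ∧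
          (∀ ν ∈ goodSizes B ρ, ∀ i : ℕ, 1 ≤ i → i ≤ ν →
            ({n : ℤ | n ∈ sievedShift I 0 (zOf δ x) b ∩ Set.Icc 1 (yOf δ x : ℤ) ∧
              ¬ |(∑ q ∈ R ν, ∑ h ∈ Finset.Icc 1 ⌊K * scaleOf ξ (yOf δ x) q⌋₊,
                    weight I a b K M (zOf δ x) (scaleOf ξ (yOf δ x) q) q
                      (n - a i q - (q : ℤ) * (h : ℤ)))
                  - C₂ ν x * ((K + 2) * (yOf δ x : ℝ))|
                ≤ 2 / Real.log x ^ (δ * (1 + ε)) * ((K + 2) * (yOf δ x : ℝ))}.ncard : ℝ)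
              ≤ ρ₀ * x / (8 * (B : ℝ) ^ 2 * Real.log x)) := by
  -- The critical exponent enters only through δ < 1/2.
  have hδ2 := lt_half_of_lt_critExp hδ₀ hδ
  obtain ⟨C₁, hC₁, hm⟩ := hI.mertens
  refine ⟨fun ν x => scaleConst I δ ξ M K ν x, fun ν hν => tendsto_scaleConst
    hI.card_le_sub_one hC₁ hm (hI.density ν hν.1 hν.2.1) hδ₀ hδ2 hξ (by linarith) hK,
    fun ε hε hεM => ?_⟩
  -- Without a size of positive density, positivity of ρ₀, and so of the permitted number of
  -- exceptions, is not available; but then only the size of the sieved set is at stake.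
  rcases (goodSizes B ρ).eq_empty_or_nonempty with he | hne
  · refine Eventually.of_forall fun x a _ => ?_
    obtain ⟨b, hb⟩ := exists_shift_ncard_le hI.card_le_sub_one (zOf δ x) (yOf δ x)
    exact ⟨b, fun _ => ∅, by simp [he], hb, by simp, by simp [he]⟩
  · have h := eventually_exists_shift (M := M) hI hρ₀ hδ₀ hδ2 hξ hK hε (by linarith) hne
    have h2 : ∀ x : ℝ, 2 / Real.log x ^ (δ * (1 + ε)) = 2 * (1 / Real.log x ^ (δ * (1 + ε))) :=
      fun x => by ring
    simpa only [h2] using h
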